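/- Let $m,n\ge 1$. Let $\Delta=\{\lambda\in\mathbb R^m:\lambda_i\ge 0,\ |\lambda|=\lambda_1+\dots+\lambda_m\le 1\}$ be the unit simplex with the measure $d\lambda=m!\,d\lambda_1\cdots d\lambda_m$. For $\lambda\in\Delta$ put $\hat\lambda=(1-|\lambda|,\lambda_1,\dots,\lambda_m)$ and $\langle\hat\lambda,\log\hat\lambda\rangle=\sum_{i=0}^m\hat\lambda_i\log\hat\lambda_i$, where $0\log 0=0$. Define $$F_n:\mathbb R^m\to\mathbb R,\qquad F_n(\rho)=\int_{\Delta^n}\max_{j=1,\dots,n}\bigl[\langle\rho,\lambda^j\rangle-\langle\widehat{\lambda^j},\log\widehat{\lambda^j}\rangle\bigr]\,d\lambda^1\cdots d\lambda^n ,$$ where the integrand is integrable for every $\rho$. Regard $F_n$ as a function on $(\mathbb C^*)^m$ through $z=(e^{\rho_1/2+i\theta_1},\dots,e^{\rho_m/2+i\theta_m})$, that is, $\rho_i=\log|z_i|^2$. Then $F_n$ is $C^2$ on $\mathbb R^m$. Consequently, for every $1\le k\le m$, the current $\bigl(\frac{i}{2\pi}\partial\bar\partial F_n\bigr)^k$ on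 $(\mathbb C^*)^m$ (defined recursively in the sense of Bedford and Taylor, $(\frac{i}{2\pi}\partial\bar\partial F_n)^{j+1}=\frac{i}{2\pi}\partial\bar\partial\bigl(F_n\,(\frac{i}{2\pi}\partial\bar\partial F_n)^{j}\bigr)$) is a $(k,k)$-form with continuous coefficients, namely the pointwise $k$-th wedge power of the form $\frac{i}{2\pi}\partial\bar\partial F_n$. For $k=m$ it is given by $$m!\,\det\Bigl(\frac1{2\pi}\frac{\partial^2F_n}{\partial\rho_i\,\partial\rho_j}\Bigr)\,d\rho\,d\theta ,$$ where $\theta$ runs over $(\mathbb R/2\pi\mathbb Z)^m$, and it has a continuous density with respect to Lebesgue measure on $(\mathbb C^*)^m$. -/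

import Mathlib

open MeasureTheory
open scoped ContDiff

namespace Fewnomial

noncomputable section

/-! ### The potential -/

/-- The unit simplex `Δ = {λ ∈ ℝ^m | λ_i ≥ 0, λ_1 + ⋯ + λ_m ≤ 1}`. -/
def simplex (m : ℕ) : Set (Fin m → ℝ) :=
  {l | (∀ i, 0 ≤ l i) ∧ ∑ i, l i ≤ 1}

/-- The measure `dλ = m! dλ_1 ⋯ dλ_m` on the unit simplex. -/
def simplexMeasure (m : ℕ) : Measure (Fin m → ℝ) :=
  (m.factorial : ENNReal) • (volume : Measure (Fin m → ℝ)).restrict (simplex m)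

/-- `λ̂ = (1 - |λ|, λ_1, …, λ_m)`. -/
def hat {m : ℕ} (l : Fin m → ℝ) : Fin (m + 1) → ℝ :=
  Fin.cons (1 - ∑ i, l i) l

/-- `⟨ρ, λ⟩ - ⟨λ̂, log λ̂⟩`, with the convention `0 log 0 = 0`. -/
def phase {m : ℕ} (ρ l : Fin m → ℝ) : ℝ :=
  ∑ i, ρ i * l i - ∑ i, hat l i * Real.log (hat l i)

/-- `max_{j = 1, …, n} [⟨ρ, λ^j⟩ - ⟨λ̂^j, log λ̂^j⟩]` (for `n ≥ 1`). -/
def maxPhase {m n : ℕ} (ρ : Fin m → ℝ) (L : Fin n → Fin m → ℝ) : ℝ :=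
  ⨆ j, phase ρ (L j)

/-- `F_n : ℝ^m → ℝ`, the integral of `maxPhase` over `Δ^n` against `dλ^1 ⋯ dλ^n`. -/
def F (m n : ℕ) (ρ : Fin m → ℝ) : ℝ :=
  ∫ L, maxPhase ρ L ∂(Measure.pi fun _ : Fin n => simplexMeasure m)

/-- The second partial derivative `∂²f / ∂ρ_i ∂ρ_j`. -/
def secondPartial {m : ℕ} (f : (Fin m → ℝ) → ℝ) (ρ : Fin m → ℝ) (i j : Fin m) : ℝ :=
  fderiv ℝ (fun r => fderiv ℝ f r (Pi.single j 1)) ρ (Pi.single i 1)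

/-! ### Differential forms on `ℂ^m` -/

/-- Complex valued, real multilinear alternating `p`-forms on `ℂ^m`. -/
abbrev Form (m p : ℕ) : Type :=
  (Fin m → ℂ) [⋀^Fin p]→L[ℝ] ℂ

/-- The complex torus `(ℂ^*)^m` as an open subset of `ℂ^m`. -/
def torus (m : ℕ) : Set (Fin m → ℂ) :=
  {z | ∀ i, z i ≠ 0}

/-- The point `z = (exp(ρ_1/2 + iθ_1), …, exp(ρ_m/2 + iθ_m))`. -/
def logPolar {m : ℕ} (ρ θ : Fin m → ℝ) : Fin m → ℂ :=
  fun i => Complex.exp ((ρ i : ℂ) / 2 + Complex.I * (θ i : ℂ))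

/-- A function of `ρ` as a function of `z ∈ (ℂ^*)^m`, through `ρ_i = log |z_i|²`. -/
def pullLog {m : ℕ} (f : (Fin m → ℝ) → ℝ) (z : Fin m → ℂ) : ℝ :=
  f fun i => Real.log (‖z i‖ ^ 2)

/-- A function as a `0`-form. -/
def zeroForm {m : ℕ} (u : (Fin m → ℂ) → ℝ) (z : Fin m → ℂ) : Form m 0 :=
  ContinuousAlternatingMap.constOfIsEmpty ℝ (Fin m → ℂ) (Fin 0) (u z : ℂ)

/-- Multiplication by `i` on `ℂ^m`. -/
def J (m : ℕ) : (Fin m → ℂ) →L[ℝ] (Fin m → ℂ) :=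
  Complex.I • ContinuousLinearMap.id ℝ (Fin m → ℂ)

/-- `d^c = i(∂̄ - ∂)`, that is, `d` conjugated by the action of `J` on forms: on forms of
bidegree `(a, b)` the pullback by `J` is multiplication by `i^(a-b)`. -/
def dc {m p : ℕ} (ψ : (Fin m → ℂ) → Form m p) (z : Fin m → ℂ) : Form m (p + 1) :=
  (extDeriv (fun w => (ψ w).compContinuousLinearMap (J m)) z).compContinuousLinearMap (-J m)

/-- `∂ = (d + i d^c) / 2`. -/
def del {m p : ℕ} (ψ : (Fin m → ℂ) → Form m p) (z : Fin m → ℂ) : Form m (p + 1) :=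
  (1 / 2 : ℂ) • (extDeriv ψ z + Complex.I • dc ψ z)

/-- `∂̄ = (d - i d^c) / 2`. -/
def delbar {m p : ℕ} (ψ : (Fin m → ℂ) → Form m p) (z : Fin m → ℂ) : Form m (p + 1) :=
  (1 / 2 : ℂ) • (extDeriv ψ z - Complex.I • dc ψ z)

/-- The `2`-form `(i / 2π) ∂∂̄ u` of a real valued function `u`. -/
def ddbar {m : ℕ} (u : (Fin m → ℂ) → ℝ) (z : Fin m → ℂ) : Form m 2 :=
  (Complex.I / (2 * (Real.pi : ℂ))) • del (delbar (zeroForm u)) z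

/-- The wedge product as an alternating map (sum over shuffles). -/
def wedgeAux {m p q : ℕ} (α : Form m p) (β : Form m q) :
    (Fin m → ℂ) [⋀^Fin p ⊕ Fin q]→ₗ[ℝ] ℂ :=
  (LinearMap.mul' ℝ ℂ).compAlternatingMap (α.toAlternatingMap.domCoprod β.toAlternatingMap)

theorem continuous_wedgeAux {m p q : ℕ} (α : Form m p) (β : Form m q) :
    Continuous (fun v => wedgeAux α β v) := by
  have h : ∀ v, wedgeAux α β v = ∑ σ : Equiv.Perm.ModSumCongr (Fin p) (Fin q),
      LinearMap.mul' ℝ ℂ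
        (AlternatingMap.domCoprod.summand α.toAlternatingMap β.toAlternatingMap σ v) := by
    intro v
    simp [wedgeAux, AlternatingMap.domCoprod, map_sum]
  simp only [h]
  refine continuous_finsetSum _ fun σ _ => ?_
  induction σ using Quotient.inductionOn' with
  | h σ =>
    simp only [AlternatingMap.domCoprod.summand_mk'']
    have : (fun v : Fin p ⊕ Fin q → Fin m → ℂ => (LinearMap.mul' ℝ ℂ)
        ((Equiv.Perm.sign σ • (MultilinearMap.domDomCongr σ
          ((α.toAlternatingMap : MultilinearMap ℝ (fun _ => Fin m → ℂ) ℂ).domCoprod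
            (β.toAlternatingMap : MultilinearMap ℝ (fun _ => Fin m → ℂ) ℂ))) :
          MultilinearMap ℝ (fun _ => Fin m → ℂ) _) v)) =
        fun v => Equiv.Perm.sign σ • (α (fun i => v (σ (Sum.inl i))) *
          β (fun i => v (σ (Sum.inr i)))) := by
      funext v
      rcases Int.units_eq_one_or (Equiv.Perm.sign σ) with h | h <;> simp [h]
    rw [this]
    have h1 : Continuous fun v : Fin p ⊕ Fin q → Fin m → ℂ =>
        α (fun i => v (σ (Sum.inl i))) := α.cont.comp (by fun_prop)
    have h2 : Continuous fun v : Fin p ⊕ Fin q → Fin m → ℂ =>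
        β (fun i => v (σ (Sum.inr i))) := β.cont.comp (by fun_prop)
    exact (h1.mul h2).const_smul _

/-- The wedge product `α ∧ β` of forms on `ℂ^m`. -/
def wedge {m p q : ℕ} (α : Form m p) (β : Form m q) : Form m (p + q) :=
  { (wedgeAux α β).domDomCongr finSumFinEquiv with
    cont := (continuous_wedgeAux α β).comp
      (continuous_pi fun i => continuous_apply (finSumFinEquiv i)) }

/-- The power `α^k = α ∧ ⋯ ∧ α` of a `2`-form. -/
def wedgePow {m : ℕ} (α : Form m 2) : (k : ℕ) → Form m (2 * k)
  | 0 => ContinuousAlternatingMap.constOfIsEmpty ℝ (Fin m → ℂ) (Fin 0) 1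
  | k + 1 => wedge (wedgePow α k) α

/-- `α` has bidegree `(p, q)`: it is a form of degree `p + q` and
`α(c v_1, …, c v_r) = c^p c̄^q α(v_1, …, v_r)` for all complex numbers `c`. -/
def IsBidegree {m r : ℕ} (p q : ℕ) (α : Form m r) : Prop :=
  r = p + q ∧ ∀ (c : ℂ) (v : Fin r → Fin m → ℂ),
    α (fun i => c • v i) = c ^ p * (starRingEnd ℂ c) ^ q * α v

/-- The pointwise power `((i / 2π) ∂∂̄ u)^k` of the `(1,1)`-form of a `C²` function. -/
def powForm {m : ℕ} (u : (Fin m → ℂ) → ℝ) (k : ℕ) (z : Fin m → ℂ) : Form m (2 * k) :=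
  wedgePow (ddbar u z) k

/-! ### Currents

Currents are forms with distribution coefficients: a current of degree `p` on an open set `U`
maps a test function on `U` to a `p`-form with constant coefficients. -/

/-- `φ` is a test function on the open set `U`. -/
def IsTest {m : ℕ} (U : Set (Fin m → ℂ)) (φ : (Fin m → ℂ) → ℝ) : Prop :=
  ContDiff ℝ ∞ φ ∧ HasCompactSupport φ ∧ tsupport φ ⊆ U

/-- The locally integrable form `η` represents the current `((i / 2π) ∂∂̄ u)^k` on `U`. Powers are
taken in the sense of Bedford and Taylor: the power `0` is the constant `1`, and
`((i / 2π) ∂∂̄ u)^(k+1)` is `(i / 2π) ∂∂̄ (u T)` where `T = ((i / 2π) ∂∂̄ u)^k`. This last derivative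
is taken in the sense of currents. For a locally integrable form `T` of even degree, the value
of `(i / 2π) ∂∂̄ (u T)` on a test function `φ` is `∫ u T ∧ (i / 2π) ∂∂̄ φ`. -/
def RepresentsPow {m : ℕ} (U : Set (Fin m → ℂ)) (u : (Fin m → ℂ) → ℝ) :
    (k : ℕ) → ((Fin m → ℂ) → Form m (2 * k)) → Prop
  | 0, η => ∀ᵐ z ∂(volume.restrict U),
      η z = ContinuousAlternatingMap.constOfIsEmpty ℝ (Fin m → ℂ) (Fin 0) 1
  | k + 1, η => LocallyIntegrableOn η U ∧
      ∃ T : (Fin m → ℂ) → Form m (2 * k),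
        RepresentsPow U u k T ∧ LocallyIntegrableOn (fun z => u z • T z) U ∧
        ∀ φ, IsTest U φ →
          ∫ z in U, φ z • η z = ∫ z in U, u z • wedge (T z) (ddbar φ z)

/-- The real basis `e_1, i e_1, …, e_m, i e_m` of `ℂ^m`, positively oriented and of volume `1`. -/
def frame (m : ℕ) (j : Fin (2 * m)) : Fin m → ℂ :=
  Pi.single ⟨j.val / 2, by omega⟩ (if j.val % 2 = 0 then 1 else Complex.I)

end

end Fewnomial

/-!
# Regularity of the expected maximum and its Monge-Ampère measures

**Regularity of `F`.** Differentiating the maximum, which has no ties almost surely, the gradient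
of `F` is the expectation of the maximizing point. By symmetry under permutations of the points
(`integral_maxPairing`) it equals
`n ∫ b(ρ, l)^(n-1) l dl`, where `b(ρ, l)` is the mass of the points `x` of the simplex with
`phase ρ x < phase ρ l`. So it has to be shown that this integral is `C¹` in `ρ`, and by dominated
differentiation (`contDiffAt_integral_of_lipschitz`) it suffices that for each interior `l` the
function `b(·, l)` is Lipschitz, uniformly in `l`, and `C¹` away from one value of `ρ` (which
determines `l`): this is `superVol_regularity`. In polar coordinates around `l` the volume of the
superlevel set `{x | phase ρ l ≤ phase ρ x}` is an integral of `T^m / m` over the directions, where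
`T` is the length of the intersection of the superlevel set, which is convex, with a ray. The
behaviour of `T` is a one-dimensional question, settled in `exists_levelTime`. The relative entropy
along the ray is bounded below by a quadratic function, which makes `T` Lipschitz. When the ray
leaves the superlevel set through the boundary of the simplex, `T` is constant; at the transition
the infinite slope of `x log x` at `0` makes the derivative of `T` tend to `0`, so that `T`
remains `C¹`. The derivative may fail to exist only where the slope of the phase at `l` along the
ray vanishes, and for `ρ` different from the gradient of the entropy at `l` this happens for a null
set of directions only.

**Powers.** For a `C²` function `u` the form `(i / 2π) ∂∂̄ u` is the antisymmetrization of
`(x, y) ↦ -D²u(x, iy) / 4π` (`ddbar_isAltOf`), and a power of an antisymmetrized bilinear form is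
a sum over permutations (`wedgePow_apply`). That the pointwise powers are the Bedford-Taylor
powers amounts to `∫ φ ω^(k+1) = ∫ u ω^k ∧ (i / 2π) ∂∂̄ φ` with `ω = (i / 2π) ∂∂̄ u`. For smooth `u`
this is two integrations by parts; the terms in which a derivative falls on `ω^k` contain symmetric
third derivatives of `u` and cancel in the sum over permutations, which is the closedness of `ω`
(`integral_mul_altSum_of_contDiff`). Both sides involve only `u` and its second derivatives, so
mollification gives the case of a `C²` function (`integral_mul_altSum`).

**The top power.** In the coordinates `ρ_i = log |z_i|²` one has
`ω = (i / 2π) ∑ F_{ab} (dz_a / z_a) ∧ (dz̄_b / z̄_b)` (`isAltOf_logBilin`). Its `m`-th power on the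
standard frame is `m! π^(-m) det (F_{ab}) ∏ |z_i|^(-2)` (`wedgePow_frame`), and the volume element
of `ℂ^m` in logarithmic polar coordinates is `∏ (|z_i|² / 2) dρ dθ` (`setIntegral_torus_eq`).
-/

namespace Fewnomial

open Filter Topology

/-! ### Level sets of the entropy along a line -/

section LineEntropy

variable {ι : Type*} [Fintype ι] {a b : ι → ℝ}

/-- The function `t ↦ ∑ x_i log x_i` along the line `x_i = a_i + t b_i`. -/
noncomputable def lineEntropy (a b : ι → ℝ) (t : ℝ) : ℝ :=
  ∑ i, (a i + t * b i) * Real.log (a i + t * b i)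

/-- The relative entropy of `a` with respect to the point `a + t b`. -/
noncomputable def lineKL (a b : ι → ℝ) (t : ℝ) : ℝ :=
  ∑ i, a i * (Real.log (a i) - Real.log (a i + t * b i))

theorem exists_exit_time (ha : ∀ i, 0 < a i) (hsb : ∑ i, b i = 0) (hb : ∃ i, b i ≠ 0) :
    ∃ tm > 0, (∀ t, 0 ≤ t → ((∀ i, 0 ≤ a i + t * b i) ↔ t ≤ tm)) ∧
      (∀ t, 0 ≤ t → t < tm → ∀ i, 0 < a i + t * b i) ∧ ∃ i, a i + tm * b i = 0 := by
  obtain ⟨j, hj⟩ : ∃ i, b i < 0 := by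
    obtain ⟨i, -, hi⟩ := Finset.exists_pos_of_sum_zero_of_exists_nonzero (s := Finset.univ)
      (fun i => -b i) (by simp [hsb]) (by simpa using hb)
    exact ⟨i, by linarith⟩
  obtain ⟨i₀, hi₀, hmin⟩ := Finset.exists_min_image (Finset.univ.filter fun i => b i < 0)
    (fun i => a i / (-b i)) ⟨j, by simp [hj]⟩
  simp only [Finset.mem_filter, Finset.mem_univ, true_and] at hi₀ hmin
  have key : ∀ i, b i < 0 → (a i / (-b i)) * b i = - a i := fun i hi => by
    field_simp [hi.ne]
  refine ⟨a i₀ / (-b i₀), div_pos (ha _) (by linarith), fun t ht => ⟨fun h => ?_, fun h i => ?_⟩,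
    fun t ht h i => ?_, i₀, ?_⟩
  · rw [le_div_iff₀ (by linarith)]
    linarith [h i₀]
  · rcases lt_or_ge (b i) 0 with hi | hi
    · have := h.trans (hmin i hi)
      rw [le_div_iff₀ (by linarith)] at this
      linarith
    · have := ha i
      positivity
  · rcases lt_or_ge (b i) 0 with hi | hi
    · have := h.trans_le (hmin i hi)
      rw [lt_div_iff₀ (by linarith)] at this
      linarith
    · have := ha i
      positivity
  · rw [key _ hi₀]; ring

theorem continuous_lineEntropy : Continuous (lineEntropy a b) := by
  have : ∀ i, Continuous fun t : ℝ => (a i + t * b i) * Real.log (a i + t * b i) := fun i =>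
    Real.continuous_mul_log.comp (by fun_prop)
  exact continuous_finsetSum _ fun i _ => this i

theorem hasDerivAt_lineEntropy (hsb : ∑ i, b i = 0) {t : ℝ} (ht : ∀ i, 0 < a i + t * b i) :
    HasDerivAt (lineEntropy a b) (∑ i, b i * Real.log (a i + t * b i)) t := by
  have h1 : ∀ i, HasDerivAt (fun t : ℝ => (a i + t * b i) * Real.log (a i + t * b i))
      ((Real.log (a i + t * b i) + 1) * b i) t := fun i => by
    have h2 : HasDerivAt (fun t : ℝ => a i + t * b i) (b i) t := by
      simpa using ((hasDerivAt_id t).mul_const (b i)).const_add (a i)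
    exact (Real.hasDerivAt_mul_log (ht i).ne').comp t h2
  have h3 : ∑ i, b i * Real.log (a i + t * b i) =
      ∑ i, (Real.log (a i + t * b i) + 1) * b i := by
    simp only [add_mul, one_mul, Finset.sum_add_distrib, hsb, add_zero]
    exact Finset.sum_congr rfl fun i _ => mul_comm _ _
  rw [h3]
  exact HasDerivAt.fun_sum fun i _ => h1 i

/-- Quadratic lower bound `a log (a / x) - a + x ≥ (a - x)² / 4` for `a, x ∈ (0, 1]`: the
left side is at least `(√a - √x)²`, by `log y ≤ y - 1` for `y = √(x / a)`. -/
theorem sq_div_four_le_kl {a x : ℝ} (ha : 0 < a) (ha1 : a ≤ 1) (hx : 0 < x) (hx1 : x ≤ 1) :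
    (a - x) ^ 2 / 4 ≤ a * (Real.log a - Real.log x) - a + x := by
  obtain ⟨p, hp, rfl⟩ : ∃ p, 0 < p ∧ a = p ^ 2 := ⟨√a, Real.sqrt_pos.2 ha, (Real.sq_sqrt ha.le).symm⟩
  obtain ⟨q, hq, rfl⟩ : ∃ q, 0 < q ∧ x = q ^ 2 := ⟨√x, Real.sqrt_pos.2 hx, (Real.sq_sqrt hx.le).symm⟩
  have hp1 : p ≤ 1 := by nlinarith
  have hq1 : q ≤ 1 := by nlinarith
  have h := Real.log_le_sub_one_of_pos (div_pos hq hp)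
  rw [Real.log_div hq.ne' hp.ne'] at h
  have h2 : p * (Real.log q - Real.log p) ≤ q - p := by
    calc _ ≤ p * (q / p - 1) := by gcongr
      _ = q - p := by field_simp
  have h3 : p * (p * (Real.log q - Real.log p)) ≤ p * (q - p) := by gcongr
  rw [Real.log_pow, Real.log_pow]
  have h4 : (p ^ 2 - q ^ 2) ^ 2 ≤ 4 * (p - q) ^ 2 := by
    have : (p ^ 2 - q ^ 2) ^ 2 = (p + q) ^ 2 * (p - q) ^ 2 := by ring
    rw [this]
    have : (p + q) ^ 2 ≤ 4 := by nlinarith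
    gcongr
  push_cast
  nlinarith

theorem le_one_of_sum_eq_one {x : ι → ℝ} (hx : ∀ i, 0 ≤ x i) (h : ∑ i, x i = 1) (i : ι) :
    x i ≤ 1 := by
  rw [← h]; exact Finset.single_le_sum (f := x) (fun j _ => hx j) (Finset.mem_univ i)

theorem sum_line (hsa : ∑ i, a i = 1) (hsb : ∑ i, b i = 0) (t : ℝ) :
    ∑ i, (a i + t * b i) = 1 := by
  rw [Finset.sum_add_distrib, ← Finset.mul_sum, hsa, hsb]; ring

theorem sq_div_four_le_lineKL (ha : ∀ i, 0 < a i) (hsa : ∑ i, a i = 1) (hsb : ∑ i, b i = 0)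
    (hb : ∃ i, 1 ≤ |b i|) {t : ℝ} (ht : ∀ i, 0 < a i + t * b i) :
    t ^ 2 / 4 ≤ lineKL a b t := by
  have h1 : lineKL a b t = ∑ i, (a i * (Real.log (a i) - Real.log (a i + t * b i)) - a i
      + (a i + t * b i)) := by
    rw [Finset.sum_add_distrib, Finset.sum_sub_distrib, sum_line hsa hsb, hsa, lineKL]; ring
  obtain ⟨j, hj⟩ := hb
  have h2 : ∀ i, (a i - (a i + t * b i)) ^ 2 / 4 ≤
      a i * (Real.log (a i) - Real.log (a i + t * b i)) - a i + (a i + t * b i) := fun i =>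
    sq_div_four_le_kl (ha i) (le_one_of_sum_eq_one (fun i => (ha i).le) hsa i) (ht i)
      (le_one_of_sum_eq_one (fun i => (ht i).le) (sum_line hsa hsb t) i)
  rw [h1]
  calc t ^ 2 / 4 ≤ (a j - (a j + t * b j)) ^ 2 / 4 := by
        have : 1 ≤ b j ^ 2 := by rw [← sq_abs]; nlinarith
        have : (a j - (a j + t * b j)) ^ 2 = t ^ 2 * b j ^ 2 := by ring
        rw [this]
        nlinarith [sq_nonneg t]
    _ ≤ _ := h2 j
    _ ≤ _ := Finset.single_le_sum (f := fun i => a i * (Real.log (a i) - Real.log (a i + t * b i))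
        - a i + (a i + t * b i)) (fun i _ => le_trans (by positivity) (h2 i)) (Finset.mem_univ j)

theorem continuousAt_lineKL {t : ℝ} (ht : ∀ i, 0 < a i + t * b i) :
    ContinuousAt (lineKL a b) t := by
  refine tendsto_finsetSum _ fun i _ => ?_
  have : ContinuousAt (fun t : ℝ => Real.log (a i + t * b i)) t :=
    ContinuousAt.log (by fun_prop) (ht i).ne'
  exact (continuousAt_const.mul (continuousAt_const.sub this))

/-- The difference quotient of the entropy along the line has derivative `KL / t²`. -/
theorem hasDerivAt_dslope_lineEntropy (hsb : ∑ i, b i = 0) {t : ℝ} (ht0 : 0 < t)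
    (ht : ∀ i, 0 < a i + t * b i) :
    HasDerivAt (dslope (lineEntropy a b) 0) (lineKL a b t / t ^ 2) t := by
  have h1 : HasDerivAt (fun s => (lineEntropy a b s - lineEntropy a b 0) / s)
      (lineKL a b t / t ^ 2) t := by
    have h2 : lineKL a b t = (∑ i, b i * Real.log (a i + t * b i)) * t -
        (lineEntropy a b t - lineEntropy a b 0) * 1 := by
      simp only [lineKL, lineEntropy, Finset.sum_mul, mul_one, zero_mul, add_zero]
      rw [← Finset.sum_sub_distrib, ← Finset.sum_sub_distrib]
      refine Finset.sum_congr rfl fun i _ => ?_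
      ring
    rw [h2]
    exact ((hasDerivAt_lineEntropy hsb ht).sub_const (lineEntropy a b 0)).div
      (hasDerivAt_id t) ht0.ne'
  refine h1.congr_of_eventuallyEq ?_
  filter_upwards [isOpen_ne.mem_nhds ht0.ne'] with s hs
  rw [dslope_of_ne _ hs, slope_def_field, sub_zero]

/-- Near the exit time `tm`, where the line leaves the simplex, the relative entropy of `a`
blows up. -/
theorem tendsto_lineKL_atTop (ha : ∀ i, 0 < a i) (hsa : ∑ i, a i = 1) (hsb : ∑ i, b i = 0)
    {tm : ℝ} (h0 : 0 < tm) (hpos : ∀ t, 0 ≤ t → t < tm → ∀ i, 0 < a i + t * b i)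
    {i₀ : ι} (hi₀ : a i₀ + tm * b i₀ = 0) :
    Tendsto (lineKL a b) (𝓝[<] tm) atTop := by
  classical
  have h1 : Tendsto (fun t : ℝ => a i₀ + t * b i₀) (𝓝[<] tm) (𝓝[≠] 0) := by
    refine tendsto_nhdsWithin_iff.2 ⟨?_, ?_⟩
    · rw [← hi₀]
      exact (Continuous.tendsto (by fun_prop) tm).mono_left nhdsWithin_le_nhds
    · filter_upwards [Ioo_mem_nhdsLT h0] with t ht using (hpos t ht.1.le ht.2 i₀).ne'
  have h2 := (Real.tendsto_log_nhdsNE_zero.comp h1)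
  have h3 : Tendsto (fun t : ℝ => a i₀ * (Real.log (a i₀) - Real.log (a i₀ + t * b i₀)) +
      ∑ i ∈ Finset.univ.erase i₀, a i * Real.log (a i)) (𝓝[<] tm) atTop := by
    refine tendsto_atTop_add_const_right _ _ (Tendsto.const_mul_atTop (ha i₀) ?_)
    simp only [sub_eq_add_neg]
    exact tendsto_atTop_add_const_left _ _ (tendsto_neg_atBot_atTop.comp h2)
  refine tendsto_atTop_mono' _ ?_ h3
  filter_upwards [Ioo_mem_nhdsLT h0] with t ht
  have hp := hpos t ht.1.le ht.2
  rw [lineKL, ← Finset.add_sum_erase _ _ (Finset.mem_univ i₀)]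
  gcongr with i
  · exact (ha i).le
  · have := Real.log_nonpos (hp i).le
      (le_one_of_sum_eq_one (fun i => (hp i).le) (sum_line hsa hsb t) i)
    linarith

/-- **Level sets along a line.** Let `a` be a point of the open simplex, `b` a direction with a
coordinate of size at least `1`. The points of the ray `a + t b`, `t > 0`, that lie in the simplex
and where the entropy has grown at most by `α t` form an interval `(0, T(α)]`. The function `T` is
Lipschitz, and it is `C¹` except where `α` is the derivative of the entropy at `a`. At the value of
`α` at which the interval reaches the boundary of the simplex, differentiability comes from the
fact that the logarithmic singularity of the entropy makes `T'` tend to `0`. -/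
theorem exists_levelTime (ha : ∀ i, 0 < a i) (hsa : ∑ i, a i = 1) (hsb : ∑ i, b i = 0)
    (hb : ∃ i, 1 ≤ |b i|) :
    ∃ T : ℝ → ℝ, (∀ α, 0 ≤ T α ∧ T α ≤ 1) ∧
      (∀ α t, (0 < t ∧ (∀ i, 0 ≤ a i + t * b i) ∧
        lineEntropy a b t - lineEntropy a b 0 ≤ α * t) ↔ 0 < t ∧ t ≤ T α) ∧
      (∀ α β, |T α - T β| ≤ 4 * |α - β|) ∧
      (∀ α t, 0 < t → (∀ i, 0 ≤ a i + t * b i) →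
        lineEntropy a b t - lineEntropy a b 0 = α * t → t = T α) ∧
      ∀ α, α ≠ ∑ i, b i * Real.log (a i) → ContDiffAt ℝ 1 T α := by
  obtain ⟨tm, htm, hfeas, hpos, i₀, hi₀⟩ := exists_exit_time ha hsb
    (hb.imp fun i hi h => by norm_num [h] at hi)
  set σ : ℝ → ℝ := dslope (lineEntropy a b) 0 with hσ
  set α₀ := ∑ i, b i * Real.log (a i) with hα₀
  have hd0 : HasDerivAt (lineEntropy a b) α₀ 0 := by
    simpa using hasDerivAt_lineEntropy (a := a) (t := 0) hsb (by simpa using ha)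
  have hσ0 : σ 0 = α₀ := by rw [hσ, dslope_same, hd0.deriv]
  have hσc : Continuous σ := by
    rw [continuous_iff_continuousAt]
    intro t
    rcases eq_or_ne t 0 with rfl | ht
    · exact continuousAt_dslope_same.2 hd0.differentiableAt
    · exact (continuousAt_dslope_of_ne ht).2 continuous_lineEntropy.continuousAt
  have hσeq : ∀ t, 0 < t → σ t * t = lineEntropy a b t - lineEntropy a b 0 := fun t ht => by
    rw [hσ, dslope_of_ne _ ht.ne', slope_def_field, sub_zero]
    field_simp
  have hσd : ∀ t, 0 < t → t < tm → HasDerivAt σ (lineKL a b t / t ^ 2) t := fun t h1 h2 =>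
    hasDerivAt_dslope_lineEntropy hsb h1 (hpos t h1.le h2)
  have hquarter : ∀ t, 0 < t → t < tm → 1 / 4 ≤ lineKL a b t / t ^ 2 := fun t h1 h2 => by
    rw [le_div_iff₀ (by positivity)]
    linarith [sq_div_four_le_lineKL ha hsa hsb hb (hpos t h1.le h2)]
  have hexp : ∀ s ∈ Set.Icc 0 tm, ∀ t ∈ Set.Icc 0 tm, s ≤ t → 1 / 4 * (t - s) ≤ σ t - σ s := by
    refine (convex_Icc 0 tm).mul_sub_le_image_sub_of_le_deriv hσc.continuousOn ?_ ?_
    · rw [interior_Icc]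
      exact fun t ht => (hσd t ht.1 ht.2).differentiableAt.differentiableWithinAt
    · rw [interior_Icc]
      exact fun t ht => by rw [(hσd t ht.1 ht.2).deriv]; exact hquarter t ht.1 ht.2
  have hex : ∀ α, ∃ t ∈ Set.Icc 0 tm, (t < tm → α ≤ σ t) ∧ (0 < t → σ t ≤ α) := by
    intro α
    rcases le_total α (σ 0) with h | h
    · exact ⟨0, ⟨le_rfl, htm.le⟩, fun _ => h, fun h => absurd h (lt_irrefl _)⟩
    rcases le_total (σ tm) α with h' | h'
    · exact ⟨tm, ⟨htm.le, le_rfl⟩, fun h => absurd h (lt_irrefl _), fun _ => h'⟩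
    · obtain ⟨t, ht, rfl⟩ := intermediate_value_Icc htm.le hσc.continuousOn ⟨h, h'⟩
      exact ⟨t, ht, fun _ => le_rfl, fun _ => le_rfl⟩
  choose T hT hTle hTge using hex
  have hiff : ∀ α t, (0 < t ∧ (∀ i, 0 ≤ a i + t * b i) ∧
        lineEntropy a b t - lineEntropy a b 0 ≤ α * t) ↔ 0 < t ∧ t ≤ T α := by
    intro α t
    refine and_congr_right fun ht => ?_
    rw [hfeas t ht.le, ← hσeq t ht, mul_le_mul_iff_left₀ ht]
    constructor
    · rintro ⟨h1, h2⟩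
      by_contra! hlt
      have := hTle α (hlt.trans_le h1)
      have := hexp _ (hT α) t ⟨ht.le, h1⟩ hlt.le
      linarith
    · intro h
      have h1 := h.trans (hT α).2
      refine ⟨h1, ?_⟩
      have := hTge α (ht.trans_le h)
      have := hexp t ⟨ht.le, h1⟩ _ (hT α) h
      linarith
  have hlip : ∀ α β, |T α - T β| ≤ 4 * |α - β| := by
    have key : ∀ α β, T α ≤ T β → T β - T α ≤ 4 * |α - β| := by
      intro α β h
      rcases h.eq_or_lt with h | h
      · rw [h, sub_self]; positivity
      · have h1 := hTle α (h.trans_le (hT β).2)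
        have h2 := hTge β ((hT α).1.trans_lt h)
        have h3 := hexp _ (hT α) _ (hT β) h.le
        have := neg_abs_le (α - β)
        linarith
    intro α β
    rcases le_total (T α) (T β) with h | h
    · rw [abs_sub_comm, abs_of_nonneg (by linarith)]; exact key _ _ h
    · rw [abs_of_nonneg (by linarith), abs_sub_comm α]; exact key _ _ h
  have hTc : Continuous T := by
    refine (LipschitzWith.of_dist_le_mul (K := 4) fun α β => ?_).continuous
    rw [Real.dist_eq, Real.dist_eq]; exact hlip α β
  have hTone : ∀ α, T α ≤ 1 := by
    intro α
    obtain ⟨i, hi⟩ := hb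
    have h1 := (hfeas (T α) (hT α).1).2 (hT α).2
    have h2 := le_one_of_sum_eq_one h1 (sum_line hsa hsb _) i
    have h3 := le_one_of_sum_eq_one (fun i => (ha i).le) hsa i
    have h4 := ha i
    have h5 := h1 i
    have h6 := (hT α).1
    rcases le_abs.1 hi with h | h <;> nlinarith
  refine ⟨T, fun α => ⟨(hT α).1, hTone α⟩, hiff, hlip, ?_, fun α hα => ?_⟩
  · intro α t ht hf h
    have htm' := (hfeas t ht.le).1 hf
    have h1 : t ≤ T α := ((hiff α t).1 ⟨ht, hf, h.le⟩).2
    have h2 : σ t = α := by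
      rw [← hσeq t ht] at h
      exact mul_right_cancel₀ ht.ne' h
    have h3 := hexp t ⟨ht.le, htm'⟩ _ (hT α) h1
    have h4 := hTge α (ht.trans_le h1)
    linarith
  rcases lt_or_gt_of_ne hα with hlt | hgt
  · have : T =ᶠ[𝓝 α] fun _ => 0 := by
      filter_upwards [Iio_mem_nhds hlt] with β hβ
      by_contra hne
      have h1 := (hT β).1.lt_of_ne (Ne.symm hne)
      have h2 := hTge β h1
      have h3 := hexp 0 ⟨le_rfl, htm.le⟩ _ (hT β) h1.le
      rw [hσ0] at h3
      simp only [Set.mem_Iio] at hβ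
      linarith
    exact contDiffAt_const.congr_of_eventuallyEq this
  -- The derivative of `T` on `(α₀, ∞)`, as a function of the value of `T`.
  set ψ : ℝ → ℝ := fun t => if t < tm then t ^ 2 / lineKL a b t else 0 with hψ
  have hTpos : ∀ β, α₀ < β → 0 < T β := by
    intro β hβ
    by_contra! hle
    have h0 : T β = 0 := le_antisymm hle (hT β).1
    have := hTle β (by rw [h0]; exact htm)
    rw [h0, hσ0] at this
    linarith
  have hTtm : ∀ β, T β < tm ↔ β < σ tm := by
    refine fun β => ⟨fun h => ?_, fun h => (hT β).2.lt_of_ne fun he => ?_⟩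
    · have h1 := hTle β h
      have := hexp _ (hT β) tm ⟨htm.le, le_rfl⟩ h.le
      linarith
    · have := hTge β (by rw [he]; exact htm)
      rw [he] at this; linarith
  have hKLpos : ∀ t, 0 < t → t < tm → 0 < lineKL a b t := fun t h1 h2 => by
    have := sq_div_four_le_lineKL ha hsa hsb hb (hpos t h1.le h2)
    have : 0 < t ^ 2 := by positivity
    linarith
  have hψc : ∀ t, 0 < t → ContinuousAt ψ t := by
    intro t ht
    rcases lt_trichotomy t tm with h | h | h
    · have : ψ =ᶠ[𝓝 t] fun t => t ^ 2 / lineKL a b t := by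
        filter_upwards [Iio_mem_nhds h] with s hs
        simp only [hψ, if_pos (show s < tm from hs)]
      refine ContinuousAt.congr ?_ this.symm
      exact (by fun_prop : ContinuousAt (fun t : ℝ => t ^ 2) t).div
        (continuousAt_lineKL (hpos t ht.le h)) (hKLpos t ht h).ne'
    · subst h
      rw [continuousAt_iff_continuous_left'_right']
      have h0 : ψ t = 0 := by simp [hψ]
      constructor
      · rw [ContinuousWithinAt, h0]
        have h1 : Tendsto (fun s : ℝ => s ^ 2 / lineKL a b s) (𝓝[<] t) (𝓝 0) :=
          Tendsto.div_atTop (a := t ^ 2)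
            ((Continuous.tendsto (by fun_prop) t).mono_left nhdsWithin_le_nhds)
            (tendsto_lineKL_atTop ha hsa hsb htm hpos hi₀)
        refine h1.congr' ?_
        filter_upwards [self_mem_nhdsWithin] with s hs
        simp only [hψ, if_pos (show s < t from hs)]
      · rw [ContinuousWithinAt, h0]
        refine tendsto_const_nhds.congr' ?_
        filter_upwards [self_mem_nhdsWithin] with s hs
        simp only [hψ, if_neg (not_lt.2 (le_of_lt (show t < s from hs)))]
    · have : ψ =ᶠ[𝓝 t] fun _ => 0 := by
        filter_upwards [Ioi_mem_nhds h] with s hs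
        simp only [hψ, if_neg (not_lt.2 (le_of_lt (show tm < s from hs)))]
      exact continuousAt_const.congr this.symm
  have hα₀tm : α₀ < σ tm := by
    have := hexp 0 ⟨le_rfl, htm.le⟩ tm ⟨htm.le, le_rfl⟩ htm.le
    rw [hσ0] at this; linarith
  have hderiv_lt : ∀ β, α₀ < β → β < σ tm → HasDerivAt T (ψ (T β)) β := by
    intro β h1 h2
    have h3 := hTpos β h1
    have h4 := (hTtm β).2 h2
    have h5 := HasDerivAt.of_local_left_inverse (f := σ) (g := T) (a := β) hTc.continuousAt
      (hσd _ h3 h4) (by have := hquarter _ h3 h4; linarith) (by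
        filter_upwards [Ioo_mem_nhds h1 h2] with γ hγ
        exact le_antisymm (hTge γ (hTpos γ hγ.1)) (hTle γ ((hTtm γ).2 hγ.2)))
    rwa [inv_div, show T β ^ 2 / lineKL a b (T β) = ψ (T β) by simp only [hψ, if_pos h4]] at h5
  have hTeq : ∀ β, σ tm ≤ β → T β = tm := fun β hβ =>
    le_antisymm (hT β).2 (not_lt.1 (mt (hTtm β).1 (not_lt.2 hβ)))
  have hψT : ∀ β, α₀ < β → ContinuousAt (fun γ => ψ (T γ)) β := fun β hβ =>
    ContinuousAt.comp (hψc _ (hTpos β hβ)) hTc.continuousAt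
  have hderiv : ∀ β, α₀ < β → HasDerivAt T (ψ (T β)) β := by
    intro β hβ
    rcases lt_trichotomy β (σ tm) with h | h | h
    · exact hderiv_lt β hβ h
    · have hleft : HasDerivWithinAt T (ψ (T β)) (Set.Iic β) β := by
        refine hasDerivWithinAt_Iic_of_tendsto_deriv (s := Set.Ioo α₀ β) ?_
          hTc.continuousWithinAt (Ioo_mem_nhdsLT hβ) ?_
        · exact fun γ hγ =>
            (hderiv_lt γ hγ.1 (hγ.2.trans_eq h)).differentiableAt.differentiableWithinAt
        · refine Tendsto.congr' ?_ ((hψT β hβ).tendsto.mono_left nhdsWithin_le_nhds)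
          filter_upwards [Ioo_mem_nhdsLT hβ] with γ hγ
          exact (hderiv_lt γ hγ.1 (hγ.2.trans_eq h)).deriv.symm
      have hright : HasDerivWithinAt T (ψ (T β)) (Set.Ici β) β := by
        have : ψ (T β) = 0 := by simp [hψ, hTeq β h.ge]
        rw [this]
        refine (hasDerivWithinAt_const β (Set.Ici β) tm).congr_of_mem (fun γ hγ => ?_)
          (Set.self_mem_Ici)
        exact hTeq γ (h.ge.trans hγ)
      have := hleft.union hright
      rwa [Set.Iic_union_Ici, hasDerivWithinAt_univ] at this
    · have h1 : ψ (T β) = 0 := by simp [hψ, hTeq β h.le]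
      rw [h1]
      refine (hasDerivAt_const β tm).congr_of_eventuallyEq ?_
      filter_upwards [Ioi_mem_nhds h] with γ hγ using hTeq γ (le_of_lt hγ)
  rw [contDiffAt_one_iff]
  refine ⟨fun β => ContinuousLinearMap.toSpanSingleton ℝ (ψ (T β)), Set.Ioi α₀, Ioi_mem_nhds hgt,
    fun β hβ => ?_, fun β hβ => (hderiv β hβ).hasFDerivAt⟩
  have := hψT β hβ
  exact ((ContinuousLinearMap.toSpanSingletonCLE (𝕜 := ℝ) (E := ℝ)).continuous.continuousAt.comp
    this).continuousWithinAt

end LineEntropy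

end Fewnomial

namespace Fewnomial

open Filter Topology
open scoped NNReal Pointwise

/-! ### Integrals depending on a parameter in a Lipschitz way -/

section ParametricIntegral

variable {m : ℕ} {α : Type*} [MeasurableSpace α] {μ : Measure α}
  {G : Type*} [NormedAddCommGroup G] [NormedSpace ℝ G]

/-- A pointwise derivative of measurable functions is measurable: its columns are limits of
difference quotients. -/
theorem aestronglyMeasurable_of_hasFDerivAt {f : (Fin m → ℝ) → α → G}
    {f' : α → (Fin m → ℝ) →L[ℝ] G} {x : Fin m → ℝ} (hf : ∀ x, AEStronglyMeasurable (f x) μ)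
    (hd : ∀ᵐ a ∂μ, HasFDerivAt (fun x => f x a) (f' a) x) : AEStronglyMeasurable f' μ := by
  have h1 : ∀ v, AEStronglyMeasurable (fun a => f' a v) μ := by
    intro v
    refine aestronglyMeasurable_of_tendsto_ae (u := atTop)
      (f := fun (k : ℕ) a => (k : ℝ) • (f (x + (k : ℝ)⁻¹ • v) a - f x a))
      (fun k => ((hf _).sub (hf _)).const_smul _) ?_
    filter_upwards [hd] with a ha
    refine ha.lim (c := fun k : ℕ => (k : ℝ)) (l := atTop) v ?_
    simpa using tendsto_natCast_atTop_atTop (R := ℝ)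
  have h2 : f' = fun a => ∑ i, (ContinuousLinearMap.smulRightL ℝ (Fin m → ℝ) G
      (ContinuousLinearMap.proj i)) (f' a (Pi.single i 1)) := by
    funext a
    ext v
    conv_lhs => rw [← Finset.univ_sum_single v]
    rw [map_sum, _root_.sum_apply]
    refine Finset.sum_congr rfl fun i _ => ?_
    have : (Pi.single i (v i) : Fin m → ℝ) = v i • Pi.single i 1 := by
      rw [← Pi.single_smul, smul_eq_mul, mul_one]
    rw [this, map_smul]
    rfl
  rw [h2]
  refine Finset.aestronglyMeasurable_fun_sum _ fun i _ => ?_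
  exact (ContinuousLinearMap.continuous _).comp_aestronglyMeasurable (h1 _)

/-- An integral over a finite measure of functions that are uniformly Lipschitz in the parameter
is `C¹` as soon as, for each value of the parameter, almost every one of them is `C¹` there. -/
theorem contDiffAt_integral_of_lipschitz [IsFiniteMeasure μ] {f : (Fin m → ℝ) → α → G}
    {K : ℝ≥0} {U : Set (Fin m → ℝ)} (hU : IsOpen U) (hf : ∀ x, Integrable (f x) μ)
    (hlip : ∀ᵐ a ∂μ, LipschitzWith K (fun x => f x a))
    (hd : ∀ x ∈ U, ∀ᵐ a ∂μ, ContDiffAt ℝ 1 (fun x => f x a) x) {x₀ : Fin m → ℝ} (hx₀ : x₀ ∈ U) :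
    ContDiffAt ℝ 1 (fun x => ∫ a, f x a ∂μ) x₀ := by
  have hfd : ∀ x ∈ U, ∀ᵐ a ∂μ, HasFDerivAt (fun x => f x a) (fderiv ℝ (fun x => f x a) x) x := by
    intro x hx
    filter_upwards [hd x hx] with a ha
    exact (ha.differentiableAt (by norm_num)).hasFDerivAt
  have hmeas : ∀ x ∈ U, AEStronglyMeasurable (fun a => fderiv ℝ (fun x => f x a) x) μ :=
    fun x hx => aestronglyMeasurable_of_hasFDerivAt (fun x => (hf x).1) (hfd x hx)
  rw [contDiffAt_one_iff]
  refine ⟨fun x => ∫ a, fderiv ℝ (fun x => f x a) x ∂μ, U, hU.mem_nhds hx₀, ?_, ?_⟩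
  · intro x hx
    refine ContinuousAt.continuousWithinAt ?_
    refine continuousAt_of_dominated (bound := fun _ => (K : ℝ)) ?_ ?_ (integrable_const _) ?_
    · filter_upwards [hU.mem_nhds hx] with y hy using hmeas y hy
    · filter_upwards with y
      filter_upwards [hlip] with a ha
      exact norm_fderiv_le_of_lipschitz ℝ ha
    · filter_upwards [hd x hx] with a ha
      exact (ha.fderiv_right (m := 0) (by norm_num)).continuousAt
  · intro x hx
    refine (hasFDerivAt_integral_of_dominated_loc_of_lip (bound := fun _ => (K : ℝ)) (s := Set.univ)
      univ_mem (Eventually.of_forall fun x => (hf x).1) (hf x) (hmeas x hx) ?_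
      (integrable_const _) (hfd x hx)).2
    filter_upwards [hlip] with a ha
    simpa [lipschitzOnWith_univ] using ha

end ParametricIntegral

/-! ### Polar coordinates around a point -/

section Polar

variable {m : ℕ}

/-- Polar coordinates centred at `l`: the volume of a set is the integral over all directions
of the radial measure of its slices. -/
theorem volume_eq_lintegral_sphere (hm : 1 ≤ m) {A : Set (Fin m → ℝ)} (hA : MeasurableSet A)
    (l : Fin m → ℝ) :
    volume A = ∫⁻ u : Metric.sphere (0 : Fin m → ℝ) 1,
      Measure.volumeIoiPow (m - 1) {r | l + r.1 • u.1 ∈ A}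
        ∂(volume : Measure (Fin m → ℝ)).toSphere := by
  have : Nonempty (Fin m) := ⟨⟨0, hm⟩⟩
  have mp := Measure.measurePreserving_homeomorphUnitSphereProd (volume : Measure (Fin m → ℝ))
  rw [Module.finrank_fin_fun] at mp
  set B : Set (Fin m → ℝ) := (fun x => l + x) ⁻¹' A with hB
  have hBm : MeasurableSet B := measurable_const_add l hA
  set S : Set (Metric.sphere (0 : Fin m → ℝ) 1 × Set.Ioi (0 : ℝ)) :=
    {p | l + p.2.1 • p.1.1 ∈ A} with hS
  have hSm : MeasurableSet S := by
    have : Measurable fun p : Metric.sphere (0 : Fin m → ℝ) 1 × Set.Ioi (0 : ℝ) =>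
        l + p.2.1 • p.1.1 := by fun_prop
    exact this hA
  have h1 : volume A = volume B := (measure_preimage_add volume l A).symm
  have h2 : volume B = volume (Subtype.val '' (Subtype.val ⁻¹' B : Set ({0}ᶜ : Set (Fin m → ℝ)))) := by
    rw [Subtype.image_preimage_coe, Set.inter_comm]
    refine (measure_inter_conull ?_).symm
    exact measure_mono_null (t := {0}) (by intro x; simp) (measure_singleton 0)
  rw [h1, h2, ← comap_subtype_coe_apply (measurableSet_singleton _).compl]
  have h3 : (Subtype.val ⁻¹' B : Set ({0}ᶜ : Set (Fin m → ℝ))) =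
      homeomorphUnitSphereProd (Fin m → ℝ) ⁻¹' S := by
    ext x
    have : ‖x.1‖ ≠ 0 := norm_ne_zero_iff.2 x.2
    simp [hS, hB, homeomorphUnitSphereProd_apply_fst_coe,
      homeomorphUnitSphereProd_apply_snd_coe, smul_smul, this]
  rw [h3, mp.measure_preimage hSm.nullMeasurableSet, Measure.prod_apply hSm]
  rfl

theorem volumeIoiPow_singleton (n : ℕ) (x : Set.Ioi (0 : ℝ)) :
    Measure.volumeIoiPow n {x} = 0 := by
  refine withDensity_absolutelyContinuous _ _ ?_
  rw [comap_subtype_coe_apply measurableSet_Ioi, Set.image_singleton, measure_singleton]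

theorem volumeIoiPow_setOf_le (n : ℕ) {T : ℝ} (hT : 0 ≤ T) :
    Measure.volumeIoiPow n {r | r.1 ≤ T} = ENNReal.ofReal (T ^ (n + 1) / (n + 1)) := by
  rcases hT.eq_or_lt with rfl | hT
  · have : {r : Set.Ioi (0 : ℝ) | r.1 ≤ 0} = ∅ := by
      ext r; simpa using Set.mem_Ioi.1 r.2
    rw [this]; simp
  · have : {r : Set.Ioi (0 : ℝ) | r.1 ≤ T} = Set.Iio ⟨T, hT⟩ ∪ {⟨T, hT⟩} := by
      ext r
      simp [le_iff_lt_or_eq, ← Subtype.coe_lt_coe, Subtype.ext_iff]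
    rw [this, measure_congr (union_ae_eq_left_of_ae_eq_empty
      (ae_eq_empty.2 (volumeIoiPow_singleton n _))), Measure.volumeIoiPow_apply_Iio]

theorem volume_hyperplane {c : Fin m → ℝ} (hc : c ≠ 0) (d : ℝ) :
    volume {x : Fin m → ℝ | ∑ i, c i * x i = d} = 0 := by
  set ℓ : (Fin m → ℝ) →ₗ[ℝ] ℝ := ∑ i, c i • LinearMap.proj i with hℓ
  have hℓa : ∀ x, ℓ x = ∑ i, c i * x i := fun x => by simp [hℓ]
  rcases Set.eq_empty_or_nonempty {x : Fin m → ℝ | ∑ i, c i * x i = d} with h | ⟨x₀, hx₀⟩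
  · rw [h, measure_empty]
  have h1 : {x : Fin m → ℝ | ∑ i, c i * x i = d} =
      (fun x => -x₀ + x) ⁻¹' (LinearMap.ker ℓ : Set (Fin m → ℝ)) := by
    ext x
    have hx₀' : ℓ x₀ = d := (hℓa x₀).trans hx₀
    rw [Set.mem_preimage, SetLike.mem_coe, LinearMap.mem_ker, map_add, map_neg, hx₀', hℓa,
      neg_add_eq_zero]
    exact eq_comm
  rw [h1, measure_preimage_add]
  refine Measure.addHaar_submodule volume _ fun h => hc ?_
  funext i
  have h1 : (Pi.single i 1 : Fin m → ℝ) ∈ LinearMap.ker ℓ := h ▸ Submodule.mem_top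
  rw [LinearMap.mem_ker, hℓa] at h1
  simpa [Pi.single_apply] using h1

/-- A hyperplane meets the unit sphere in a set of measure zero. -/
theorem ae_toSphere_sum_mul_ne_zero {c : Fin m → ℝ} (hc : c ≠ 0) :
    ∀ᵐ u : Metric.sphere (0 : Fin m → ℝ) 1 ∂(volume : Measure (Fin m → ℝ)).toSphere,
      ∑ i, c i * u.1 i ≠ 0 := by
  have hmeas : MeasurableSet {u : Metric.sphere (0 : Fin m → ℝ) 1 | ∑ i, c i * u.1 i = 0} := by
    have : Continuous fun u : Metric.sphere (0 : Fin m → ℝ) 1 => ∑ i, c i * u.1 i :=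
      continuous_finsetSum _ fun i _ =>
        continuous_const.mul ((continuous_apply i).comp continuous_subtype_val)
    exact this.measurable (measurableSet_singleton 0)
  rw [ae_iff]
  simp only [not_not]
  rw [Measure.toSphere_apply' _ hmeas]
  have : volume (Set.Ioo (0 : ℝ) 1 • (Subtype.val ''
      {u : Metric.sphere (0 : Fin m → ℝ) 1 | ∑ i, c i * u.1 i = 0})) = 0 := by
    refine measure_mono_null ?_ (volume_hyperplane hc 0)
    rintro _ ⟨r, -, _, ⟨u, hu, rfl⟩, rfl⟩
    have h1 : ∑ i, c i * (r * u.1 i) = r * ∑ i, c i * u.1 i := by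
      rw [Finset.mul_sum]
      exact Finset.sum_congr rfl fun i _ => by ring
    exact h1.trans (by rw [show ∑ i, c i * u.1 i = 0 from hu, mul_zero])
  rw [this, mul_zero]

end Polar

end Fewnomial

namespace Fewnomial

open Filter Topology
open scoped NNReal Pointwise

/-! ### Volumes of the superlevel sets of the phase -/

section Superlevel

variable {m : ℕ}

/-- The direction in the hyperplane `∑ x_i = 0` of `ℝ^(m+1)` that corresponds to `u ∈ ℝ^m`. -/
def hatDir (u : Fin m → ℝ) : Fin (m + 1) → ℝ :=
  Fin.cons (-∑ i, u i) u

theorem sum_hat (l : Fin m → ℝ) : ∑ i, hat l i = 1 := by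
  simp [hat, Fin.sum_univ_succ]

theorem sum_hatDir (u : Fin m → ℝ) : ∑ i, hatDir u i = 0 := by
  simp [hatDir, Fin.sum_univ_succ]

theorem hat_add_smul (l u : Fin m → ℝ) (r : ℝ) (i : Fin (m + 1)) :
    hat (l + r • u) i = hat l i + r * hatDir u i := by
  refine Fin.cases ?_ (fun j => ?_) i
  · simp only [hat, hatDir, Fin.cons_zero, Pi.add_apply, Pi.smul_apply, smul_eq_mul,
      Finset.sum_add_distrib, ← Finset.mul_sum]
    ring
  · simp [hat, hatDir]

theorem continuous_hat (i : Fin (m + 1)) : Continuous fun l : Fin m → ℝ => hat l i := by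
  refine Fin.cases ?_ (fun j => ?_) i
  · simp only [hat, Fin.cons_zero]; fun_prop
  · simp only [hat, Fin.cons_succ]; fun_prop

theorem mem_simplex_iff {l : Fin m → ℝ} : l ∈ simplex m ↔ ∀ i, 0 ≤ hat l i := by
  rw [Fin.forall_fin_succ]
  simp [simplex, hat, and_comm]

theorem isClosed_simplex : IsClosed (simplex m) := by
  have : simplex m = ⋂ i, {l | 0 ≤ hat l i} := by
    ext l; simp [mem_simplex_iff]
  rw [this]
  exact isClosed_iInter fun i => isClosed_le continuous_const (continuous_hat i)

theorem simplex_subset_Icc : simplex m ⊆ Set.Icc 0 1 := by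
  intro l hl
  refine ⟨fun i => hl.1 i, fun i => ?_⟩
  exact (Finset.single_le_sum (f := l) (fun j _ => hl.1 j) (Finset.mem_univ i)).trans hl.2

theorem volume_simplex_ne_top : volume (simplex m) ≠ ⊤ :=
  ((measure_mono simplex_subset_Icc).trans_lt isCompact_Icc.measure_lt_top).ne

instance : IsFiniteMeasure (simplexMeasure m) := by
  refine ⟨?_⟩
  rw [simplexMeasure, Measure.smul_apply, Measure.restrict_apply_univ, smul_eq_mul]
  exact ENNReal.mul_lt_top (ENNReal.natCast_lt_top _) (lt_top_iff_ne_top.2 volume_simplex_ne_top)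

theorem simplexMeasure_absolutelyContinuous :
    simplexMeasure m ≪ (volume : Measure (Fin m → ℝ)) :=
  (Measure.smul_absolutelyContinuous).trans Measure.restrict_le_self.absolutelyContinuous

theorem ae_mem_simplex : ∀ᵐ l ∂(simplexMeasure m), l ∈ simplex m :=
  Measure.ae_smul_measure (ae_restrict_mem isClosed_simplex.measurableSet) _

theorem continuous_phase : Continuous fun p : (Fin m → ℝ) × (Fin m → ℝ) => phase p.1 p.2 := by
  unfold phase
  refine Continuous.sub (by fun_prop) (continuous_finsetSum _ fun i _ => ?_)
  exact Real.continuous_mul_log.comp ((continuous_hat i).comp continuous_snd)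

theorem continuous_phase_right (ρ : Fin m → ℝ) : Continuous (phase ρ) :=
  continuous_phase.comp (by fun_prop : Continuous fun l => (ρ, l))

theorem phase_add_smul (ρ l u : Fin m → ℝ) (r : ℝ) :
    phase ρ (l + r • u) = phase ρ l + ((∑ i, ρ i * u i) * r -
      (lineEntropy (hat l) (hatDir u) r - lineEntropy (hat l) (hatDir u) 0)) := by
  simp only [phase, lineEntropy, hat_add_smul, Pi.add_apply, Pi.smul_apply, smul_eq_mul, mul_add,
    Finset.sum_add_distrib, zero_mul, add_zero, Finset.sum_mul]
  have : ∑ i, ρ i * (r * u i) = ∑ i, ρ i * u i * r := Finset.sum_congr rfl fun i _ => by ring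
  rw [this]
  ring

/-- The gradient of the entropy `⟨l̂, log l̂⟩` on the open simplex. -/
noncomputable def entropyGrad (l : Fin m → ℝ) : Fin m → ℝ :=
  fun i => Real.log (hat l i.succ) - Real.log (hat l 0)

theorem sum_hatDir_mul_log (l u : Fin m → ℝ) :
    ∑ i, hatDir u i * Real.log (hat l i) = ∑ i, entropyGrad l i * u i := by
  rw [Fin.sum_univ_succ]
  simp only [hatDir, Fin.cons_zero, Fin.cons_succ, entropyGrad, sub_mul, Finset.sum_sub_distrib,
    neg_mul, Finset.sum_mul]
  rw [neg_add_eq_sub]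
  congr 1 <;> exact Finset.sum_congr rfl fun i _ => mul_comm _ _

/-- The entropy gradient is injective on the open simplex. -/
theorem entropyGrad_injOn {l l' : Fin m → ℝ} (hl : ∀ i, 0 < hat l i) (hl' : ∀ i, 0 < hat l' i)
    (h : entropyGrad l = entropyGrad l') : l = l' := by
  have key : ∀ {l : Fin m → ℝ}, (∀ i, 0 < hat l i) →
      ∀ i, hat l i.succ = hat l 0 * Real.exp (entropyGrad l i) := fun {l} hl i => by
    rw [entropyGrad, Real.exp_sub, Real.exp_log (hl _), Real.exp_log (hl _)]
    field_simp [(hl 0).ne']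
  have h0 : ∀ {l : Fin m → ℝ}, (∀ i, 0 < hat l i) →
      hat l 0 * (1 + ∑ i, Real.exp (entropyGrad l i)) = 1 := fun {l} hl => by
    refine Eq.trans ?_ (sum_hat l)
    rw [Fin.sum_univ_succ, mul_add, mul_one, Finset.mul_sum]
    congr 1
    exact Finset.sum_congr rfl fun i _ => (key hl i).symm
  have h1 : hat l 0 = hat l' 0 := by
    have e1 := h0 hl
    have e2 := h0 hl'
    rw [h] at e1
    have : 0 < 1 + ∑ i, Real.exp (entropyGrad l' i) := by positivity
    exact mul_right_cancel₀ this.ne' (e1.trans e2.symm)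
  funext i
  have e1 := key hl i
  have e2 := key hl' i
  rw [h, h1, ← e2] at e1
  simpa [hat] using e1

/-- The volume of the part of the simplex where the phase is at least its value at `l`. -/
noncomputable def superVol (ρ l : Fin m → ℝ) : ℝ :=
  volume.real {x | x ∈ simplex m ∧ phase ρ l ≤ phase ρ x}

theorem measurableSet_superlevel (ρ l : Fin m → ℝ) :
    MeasurableSet {x | x ∈ simplex m ∧ phase ρ l ≤ phase ρ x} :=
  isClosed_simplex.measurableSet.inter
    (isClosed_le continuous_const (continuous_phase_right ρ)).measurableSet

theorem exists_one_le_abs_hatDir (u : Metric.sphere (0 : Fin m → ℝ) 1) :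
    ∃ i, 1 ≤ |hatDir u.1 i| := by
  by_contra! h
  have h1 : ‖u.1‖ < 1 := by
    rw [pi_norm_lt_iff one_pos]
    intro i
    simpa [hatDir] using h i.succ
  have h2 : ‖u.1‖ = 1 := by simp
  linarith

theorem add_smul_mem_simplex_iff (l u : Fin m → ℝ) (r : ℝ) :
    l + r • u ∈ simplex m ↔ ∀ i, 0 ≤ hat l i + r * hatDir u i := by
  simp only [mem_simplex_iff, hat_add_smul]

/-- The level set of the phase through an interior point of the simplex has measure zero: a ray
from that point meets it at most once more. -/
theorem volume_level_eq_zero (hm : 1 ≤ m) (ρ : Fin m → ℝ) {l : Fin m → ℝ}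
    (hl : ∀ i, 0 < hat l i) : volume {x | x ∈ simplex m ∧ phase ρ x = phase ρ l} = 0 := by
  have hA : MeasurableSet {x | x ∈ simplex m ∧ phase ρ x = phase ρ l} :=
    isClosed_simplex.measurableSet.inter
      (isClosed_eq (continuous_phase_right ρ) continuous_const).measurableSet
  rw [volume_eq_lintegral_sphere hm hA l]
  refine (lintegral_congr fun u => ?_).trans lintegral_zero
  obtain ⟨T, -, -, -, huniq, -⟩ := exists_levelTime hl (sum_hat l) (sum_hatDir u.1)
    (exists_one_le_abs_hatDir u)
  have hs : ∀ r ∈ {r : Set.Ioi (0 : ℝ) | l + r.1 • u.1 ∈ {x | x ∈ simplex m ∧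
      phase ρ x = phase ρ l}}, r.1 = T (∑ i, ρ i * u.1 i) := by
    rintro r ⟨h1, h2⟩
    rw [add_smul_mem_simplex_iff] at h1
    rw [phase_add_smul] at h2
    exact huniq _ _ r.2 h1 (by linarith)
  rcases Set.eq_empty_or_nonempty {r : Set.Ioi (0 : ℝ) | l + r.1 • u.1 ∈ {x | x ∈ simplex m ∧
      phase ρ x = phase ρ l}} with h | ⟨r, hr⟩
  · rw [h, measure_empty]
  · refine measure_mono_null (t := {r}) (fun s hs' => ?_) (volumeIoiPow_singleton _ r)
    exact Subtype.ext ((hs s hs').trans (hs r hr).symm)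

/-- A Lipschitz constant, in `ρ`, for `superVol ρ l`. -/
noncomputable def superVolLip (m : ℕ) : ℝ≥0 :=
  (4 * m) * ((volume : Measure (Fin m → ℝ)).toSphere.real Set.univ).toNNReal

/-- For an interior point `l` of the simplex, the volume of the superlevel set through `l` is a
Lipschitz function of `ρ`, with a constant independent of `l`, and it is `C¹` away from the value
of `ρ` for which `l` is the maximum point of the phase. -/
theorem superVol_regularity (hm : 1 ≤ m) {l : Fin m → ℝ} (hl : ∀ i, 0 < hat l i) :
    LipschitzWith (superVolLip m) (fun ρ => superVol ρ l) ∧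
      ∀ ρ, ρ ≠ entropyGrad l → ContDiffAt ℝ 1 (fun ρ => superVol ρ l) ρ := by
  choose T hT01 hTiff hTlip _ hTc using fun u : Metric.sphere (0 : Fin m → ℝ) 1 =>
    exists_levelTime hl (sum_hat l) (sum_hatDir u.1) (exists_one_le_abs_hatDir u)
  have hm0 : (0 : ℝ) < m := by exact_mod_cast hm
  set f : (Fin m → ℝ) → Metric.sphere (0 : Fin m → ℝ) 1 → ℝ :=
    fun ρ u => T u (∑ i, ρ i * u.1 i) ^ m / m with hf
  have hslice : ∀ ρ (u : Metric.sphere (0 : Fin m → ℝ) 1),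
      Measure.volumeIoiPow (m - 1) {r | l + r.1 • u.1 ∈ {x | x ∈ simplex m ∧
        phase ρ l ≤ phase ρ x}} = ENNReal.ofReal (f ρ u) := by
    intro ρ u
    have : {r : Set.Ioi (0 : ℝ) | l + r.1 • u.1 ∈ {x | x ∈ simplex m ∧ phase ρ l ≤ phase ρ x}} =
        {r | r.1 ≤ T u (∑ i, ρ i * u.1 i)} := by
      ext r
      have hr : 0 < r.1 := r.2
      have := hTiff u (∑ i, ρ i * u.1 i) r.1
      simp only [hr, true_and] at this
      simp only [Set.mem_ofPred_eq, add_smul_mem_simplex_iff, ← this, phase_add_smul]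
      refine and_congr_right fun _ => ?_
      constructor <;> intro h <;> linarith
    rw [this, volumeIoiPow_setOf_le _ (hT01 u _).1]
    congr 2
    · congr 1; omega
    · rw [Nat.cast_sub hm]; simp
  have hf0 : ∀ ρ u, 0 ≤ f ρ u := fun ρ u => div_nonneg (pow_nonneg (hT01 u _).1 _) hm0.le
  have hf1 : ∀ ρ u, f ρ u ≤ 1 := fun ρ u => by
    refine div_le_one_of_le₀ ((pow_le_one₀ (hT01 u _).1 (hT01 u _).2).trans ?_) hm0.le
    exact_mod_cast hm
  have hfm : ∀ ρ, Measurable (f ρ) := by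
    intro ρ
    have h1 : MeasurableSet {p : Metric.sphere (0 : Fin m → ℝ) 1 × Set.Ioi (0 : ℝ) |
        l + p.2.1 • p.1.1 ∈ {x | x ∈ simplex m ∧ phase ρ l ≤ phase ρ x}} := by
      have : Measurable fun p : Metric.sphere (0 : Fin m → ℝ) 1 × Set.Ioi (0 : ℝ) =>
        l + p.2.1 • p.1.1 := by fun_prop
      exact this (measurableSet_superlevel ρ l)
    have h2 := (measurable_measure_prodMk_left (ν := Measure.volumeIoiPow (m - 1)) h1).ennreal_toReal
    convert h2 using 1
    funext u
    rw [← ENNReal.toReal_ofReal (hf0 ρ u), ← hslice ρ u]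
    rfl
  have hfi : ∀ ρ, Integrable (f ρ) (volume : Measure (Fin m → ℝ)).toSphere := fun ρ =>
    Integrable.of_bound (hfm ρ).aestronglyMeasurable 1
      (Eventually.of_forall fun u => by rw [Real.norm_of_nonneg (hf0 ρ u)]; exact hf1 ρ u)
  have hsv : ∀ ρ, superVol ρ l = ∫ u, f ρ u ∂(volume : Measure (Fin m → ℝ)).toSphere := by
    intro ρ
    rw [superVol, Measure.real, volume_eq_lintegral_sphere hm (measurableSet_superlevel ρ l) l,
      integral_eq_lintegral_of_nonneg_ae (Eventually.of_forall (hf0 ρ))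
        (hfm ρ).aestronglyMeasurable]
    simp only [hslice]
  have hflip : ∀ ρ ρ' u, |f ρ u - f ρ' u| ≤ 4 * m * ‖ρ - ρ'‖ := by
    intro ρ ρ' u
    set t := T u (∑ i, ρ i * u.1 i)
    set t' := T u (∑ i, ρ' i * u.1 i)
    have h1 : |t ^ m - t' ^ m| ≤ |t - t'| * m := by
      refine (abs_pow_sub_pow_le t t' m).trans ?_
      refine mul_le_of_le_one_right (by positivity) (pow_le_one₀ (by positivity) ?_)
      rw [abs_of_nonneg (hT01 u _).1, abs_of_nonneg (hT01 u _).1]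
      exact max_le (hT01 u _).2 (hT01 u _).2
    have h2 : |∑ i, ρ i * u.1 i - ∑ i, ρ' i * u.1 i| ≤ m * ‖ρ - ρ'‖ := by
      rw [← Finset.sum_sub_distrib]
      refine (Finset.abs_sum_le_sum_abs _ _).trans ?_
      calc ∑ i, |ρ i * u.1 i - ρ' i * u.1 i| ≤ ∑ _i : Fin m, ‖ρ - ρ'‖ := by
            refine Finset.sum_le_sum fun i _ => ?_
            rw [← sub_mul, abs_mul]
            have h3 : |u.1 i| ≤ 1 := by
              have h4 : ‖u.1‖ = 1 := by simp
              exact (norm_le_pi_norm u.1 i).trans h4.le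
            exact (mul_le_of_le_one_right (abs_nonneg _) h3).trans (norm_le_pi_norm (ρ - ρ') i)
        _ = m * ‖ρ - ρ'‖ := by simp
    rw [hf]
    simp only
    rw [← sub_div, abs_div, abs_of_pos hm0, div_le_iff₀ hm0]
    refine h1.trans ?_
    have := (hTlip u (∑ i, ρ i * u.1 i) (∑ i, ρ' i * u.1 i))
    calc |t - t'| * m ≤ (4 * (m * ‖ρ - ρ'‖)) * m := by
          gcongr; exact this.trans (by gcongr)
      _ = _ := by ring
  refine ⟨LipschitzWith.of_dist_le_mul fun ρ ρ' => ?_, fun ρ hρ => ?_⟩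
  · rw [hsv, hsv, dist_eq_norm, ← integral_sub (hfi ρ) (hfi ρ'), dist_eq_norm]
    refine (norm_integral_le_of_norm_le_const (C := 4 * m * ‖ρ - ρ'‖)
      (Eventually.of_forall fun u => ?_)).trans (le_of_eq ?_)
    · simpa using hflip ρ ρ' u
    · simp only [superVolLip, NNReal.coe_mul, NNReal.coe_ofNat, NNReal.coe_natCast]
      rw [Real.coe_toNNReal _ measureReal_nonneg]; ring
  · simp only [hsv]
    refine contDiffAt_integral_of_lipschitz (K := 4 * m) (U := {entropyGrad l}ᶜ)
      isOpen_compl_singleton hfi (Eventually.of_forall fun u => ?_) (fun ρ hρ => ?_) hρ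
    · refine LipschitzWith.of_dist_le_mul fun ρ ρ' => ?_
      rw [Real.dist_eq, dist_eq_norm]
      exact_mod_cast hflip ρ ρ' u
    · filter_upwards [ae_toSphere_sum_mul_ne_zero (sub_ne_zero.2 hρ)] with u hu
      have h1 : ContDiffAt ℝ 1 (T u) (∑ i, ρ i * u.1 i) := by
        refine hTc u _ fun h => hu ?_
        rw [sum_hatDir_mul_log] at h
        simp only [Pi.sub_apply, sub_mul, Finset.sum_sub_distrib, h, sub_self]
      have h2 : ContDiffAt ℝ 1 (fun ρ : Fin m → ℝ => ∑ i, ρ i * u.1 i) ρ := by fun_prop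
      exact ((h1.comp ρ h2).pow m).div_const _

end Superlevel

end Fewnomial

namespace Fewnomial

open Filter Topology
open scoped NNReal

/-! ### The potential is twice continuously differentiable -/

section Potential

variable {m : ℕ}

theorem ae_hat_pos : ∀ᵐ l ∂(simplexMeasure m), ∀ i, 0 < hat l i := by
  have h1 : ∀ i : Fin (m + 1), ∀ᵐ l : Fin m → ℝ, hat l i ≠ 0 := by
    refine Fin.cases ?_ fun i => ?_
    · rcases Nat.eq_zero_or_pos m with rfl | hm
      · simp [hat]
      · have h2 := volume_hyperplane (c := fun _ : Fin m => (1 : ℝ))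
          (fun h => one_ne_zero (congrFun h ⟨0, hm⟩)) 1
        rw [ae_iff]
        refine measure_mono_null (fun l hl => ?_) h2
        simp only [hat, Fin.cons_zero, ne_eq, not_not, Set.mem_ofPred_eq] at hl
        simp only [one_mul, Set.mem_ofPred_eq]
        linarith
    · have h2 := volume_hyperplane (c := (Pi.single i 1 : Fin m → ℝ))
          (fun h => by simpa using congrFun h i) 0
      rw [ae_iff]
      refine measure_mono_null (fun l hl => ?_) h2
      simp only [hat, Fin.cons_succ, ne_eq, not_not, Set.mem_ofPred_eq] at hl
      simp [Pi.single_apply, hl]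
  filter_upwards [ae_mem_simplex,
    simplexMeasure_absolutelyContinuous.ae_le (ae_all_iff.2 h1)] with l h2 h3 i
  exact lt_of_le_of_ne (mem_simplex_iff.1 h2 i) (h3 i).symm

/-- The mass of the set where the phase is smaller than its value at `l`. -/
noncomputable def belowMass (ρ l : Fin m → ℝ) : ℝ :=
  (simplexMeasure m).real {x | phase ρ x < phase ρ l}

theorem belowMass_eq (ρ l : Fin m → ℝ) :
    belowMass ρ l = m.factorial * (volume.real (simplex m) - superVol ρ l) := by
  have h1 : MeasurableSet {x : Fin m → ℝ | phase ρ x < phase ρ l} :=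
    (isOpen_lt (continuous_phase_right ρ) continuous_const).measurableSet
  have h2 : {x : Fin m → ℝ | phase ρ x < phase ρ l} ∩ simplex m =
      simplex m \ {x | x ∈ simplex m ∧ phase ρ l ≤ phase ρ x} := by
    ext x
    simp only [Set.mem_inter_iff, Set.mem_ofPred_eq, Set.mem_sdiff, not_and, not_le]
    tauto
  rw [belowMass, Measure.real, simplexMeasure, Measure.smul_apply, Measure.restrict_apply h1,
    smul_eq_mul, ENNReal.toReal_mul, h2, superVol, ENNReal.toReal_natCast]
  congr 1
  exact measureReal_sdiff (fun x hx => hx.1) (measurableSet_superlevel ρ l) volume_simplex_ne_top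

theorem belowMass_nonneg (ρ l : Fin m → ℝ) : 0 ≤ belowMass ρ l := measureReal_nonneg

theorem belowMass_le (ρ l : Fin m → ℝ) :
    belowMass ρ l ≤ (simplexMeasure m).real Set.univ := measureReal_mono (Set.subset_univ _)

theorem measurable_belowMass (ρ : Fin m → ℝ) : Measurable (belowMass ρ) := by
  have h1 : MeasurableSet {p : (Fin m → ℝ) × (Fin m → ℝ) | phase ρ p.2 < phase ρ p.1} :=
    (isOpen_lt ((continuous_phase_right ρ).comp continuous_snd)
      ((continuous_phase_right ρ).comp continuous_fst)).measurableSet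
  exact (measurable_measure_prodMk_left (ν := simplexMeasure m) h1).ennreal_toReal

theorem belowMass_regularity (hm : 1 ≤ m) {l : Fin m → ℝ} (hl : ∀ i, 0 < hat l i) :
    LipschitzWith (m.factorial * superVolLip m) (fun ρ => belowMass ρ l) ∧
      ∀ ρ, ρ ≠ entropyGrad l → ContDiffAt ℝ 1 (fun ρ => belowMass ρ l) ρ := by
  obtain ⟨h1, h2⟩ := superVol_regularity hm hl
  simp only [belowMass_eq]
  refine ⟨LipschitzWith.of_dist_le_mul fun ρ ρ' => ?_, fun ρ hρ =>
    contDiffAt_const.mul (contDiffAt_const.sub (h2 ρ hρ))⟩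
  have := h1.dist_le_mul ρ ρ'
  rw [Real.dist_eq] at this ⊢
  rw [← mul_sub, sub_sub_sub_cancel_left, abs_mul, abs_sub_comm, Nat.abs_cast]
  push_cast
  rw [mul_assoc]
  gcongr

/-- The linear form `⟨·, l⟩`. -/
noncomputable def pairing (l : Fin m → ℝ) : (Fin m → ℝ) →L[ℝ] ℝ :=
  ∑ i, l i • ContinuousLinearMap.proj i

theorem pairing_apply (l ρ : Fin m → ℝ) : pairing l ρ = ∑ i, ρ i * l i := by
  simp [pairing, mul_comm]

theorem continuous_pairing : Continuous (pairing : (Fin m → ℝ) → (Fin m → ℝ) →L[ℝ] ℝ) := by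
  unfold pairing; fun_prop

theorem norm_pairing_le {l : Fin m → ℝ} (hl : l ∈ simplex m) : ‖pairing l‖ ≤ 1 := by
  refine ContinuousLinearMap.opNorm_le_bound _ zero_le_one fun ρ => ?_
  rw [pairing_apply, one_mul]
  calc ‖∑ i, ρ i * l i‖ ≤ ∑ i, ‖ρ‖ * l i := by
        refine (norm_sum_le _ _).trans (Finset.sum_le_sum fun i _ => ?_)
        rw [norm_mul, Real.norm_of_nonneg (hl.1 i)]
        exact mul_le_mul_of_nonneg_right (norm_le_pi_norm ρ i) (hl.1 i)
    _ ≤ ‖ρ‖ := by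
        rw [← Finset.mul_sum]
        exact mul_le_of_le_one_right (norm_nonneg _) hl.2

theorem phase_eq_pairing (ρ l : Fin m → ℝ) :
    phase ρ l = pairing l ρ - ∑ i, hat l i * Real.log (hat l i) := by
  rw [pairing_apply, phase]

theorem hasFDerivAt_phase (ρ l : Fin m → ℝ) :
    HasFDerivAt (fun ρ => phase ρ l) (pairing l) ρ := by
  simp only [phase_eq_pairing]
  exact (pairing l).hasFDerivAt.sub_const _

theorem abs_phase_le {ρ l : Fin m → ℝ} (hl : l ∈ simplex m) : |phase ρ l| ≤ ‖ρ‖ + (m + 1) := by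
  rw [phase_eq_pairing]
  have h1 : |pairing l ρ| ≤ ‖ρ‖ := by
    have := (pairing l).le_opNorm ρ
    exact this.trans (mul_le_of_le_one_left (norm_nonneg _) (norm_pairing_le hl))
  have h2 : |∑ i, hat l i * Real.log (hat l i)| ≤ m + 1 := by
    calc _ ≤ ∑ i : Fin (m + 1), |hat l i * Real.log (hat l i)| := Finset.abs_sum_le_sum_abs _ _
      _ ≤ ∑ _i : Fin (m + 1), (1 : ℝ) := by
          refine Finset.sum_le_sum fun i _ => ?_
          have h3 := mem_simplex_iff.1 hl i
          rcases h3.eq_or_lt with h | h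
          · rw [← h]; simp
          · rw [mul_comm]
            exact (Real.abs_log_mul_self_lt _ h
              (le_one_of_sum_eq_one (mem_simplex_iff.1 hl) (sum_hat l) i)).le
      _ = m + 1 := by simp
  calc _ ≤ |pairing l ρ| + |∑ i, hat l i * Real.log (hat l i)| := abs_sub _ _
    _ ≤ _ := add_le_add h1 h2

theorem ae_pi_mem_simplex (n : ℕ) :
    ∀ᵐ L ∂(Measure.pi fun _ : Fin n => simplexMeasure m), ∀ j, L j ∈ simplex m :=
  ae_all_iff.2 fun j => (Measure.tendsto_eval_ae_ae (i := j)).eventually ae_mem_simplex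

theorem measurable_maxPhase {n : ℕ} (ρ : Fin m → ℝ) :
    Measurable fun L : Fin n → Fin m → ℝ => maxPhase ρ L :=
  Measurable.iSup fun j => (continuous_phase_right ρ).measurable.comp (measurable_pi_apply j)

theorem abs_maxPhase_le {n : ℕ} {ρ : Fin m → ℝ} {L : Fin (n + 1) → Fin m → ℝ}
    (hL : ∀ j, L j ∈ simplex m) : |maxPhase ρ L| ≤ ‖ρ‖ + (m + 1) := by
  obtain ⟨j, hj⟩ := exists_eq_ciSup_of_finite (f := fun j => phase ρ (L j))
  rw [maxPhase, ← hj]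
  exact abs_phase_le (hL j)

theorem integrable_maxPhase (n : ℕ) (ρ : Fin m → ℝ) :
    Integrable (fun L : Fin (n + 1) → Fin m → ℝ => maxPhase ρ L)
      (Measure.pi fun _ : Fin (n + 1) => simplexMeasure m) := by
  refine Integrable.of_bound (measurable_maxPhase ρ).aestronglyMeasurable (‖ρ‖ + (m + 1)) ?_
  filter_upwards [ae_pi_mem_simplex (n + 1)] with L hL using abs_maxPhase_le hL

theorem maxPhase_lipschitz {n : ℕ} {L : Fin (n + 1) → Fin m → ℝ} (hL : ∀ j, L j ∈ simplex m) :
    LipschitzWith 1 fun ρ => maxPhase ρ L := by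
  refine LipschitzWith.of_le_add fun ρ ρ' => ciSup_le fun j => ?_
  have h1 : phase ρ' (L j) ≤ maxPhase ρ' L :=
    le_ciSup (f := fun j => phase ρ' (L j)) (Set.finite_range _).bddAbove j
  have h2 : pairing (L j) ρ - pairing (L j) ρ' ≤ dist ρ ρ' := by
    rw [← map_sub, dist_eq_norm]
    exact (le_abs_self _).trans (((pairing (L j)).le_opNorm _).trans
      (mul_le_of_le_one_left (norm_nonneg _) (norm_pairing_le (hL j))))
  rw [phase_eq_pairing] at h1 ⊢
  linarith

/-- Almost surely, the phase takes different values at the points of a random tuple. -/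
theorem ae_phase_ne (hm : 1 ≤ m) (n : ℕ) (ρ : Fin m → ℝ) :
    ∀ᵐ L ∂(Measure.pi fun _ : Fin (n + 1) => simplexMeasure m), ∀ j (i : Fin n),
      phase ρ (L (j.succAbove i)) ≠ phase ρ (L j) := by
  refine ae_all_iff.2 fun j => ?_
  have mp := measurePreserving_piFinSuccAbove (fun _ : Fin (n + 1) => simplexMeasure m) j
  refine mp.quasiMeasurePreserving.ae
    (p := fun q : (Fin m → ℝ) × (Fin n → Fin m → ℝ) => ∀ i, phase ρ (q.2 i) ≠ phase ρ q.1) ?_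
  have hmeas : MeasurableSet {q : (Fin m → ℝ) × (Fin n → Fin m → ℝ) |
      ∀ i, phase ρ (q.2 i) ≠ phase ρ q.1} := by
    simp only [Set.ofPred_forall]
    refine MeasurableSet.iInter fun i => ?_
    refine IsOpen.measurableSet (isOpen_ne_fun ?_ ?_)
    · exact (continuous_phase_right ρ).comp ((continuous_apply i).comp continuous_snd)
    · exact (continuous_phase_right ρ).comp continuous_fst
  refine (Measure.ae_prod_iff_ae_ae hmeas).2 ?_
  filter_upwards [ae_hat_pos] with l hl
  refine ae_all_iff.2 fun i => ?_
  refine (Measure.tendsto_eval_ae_ae (i := i)).eventually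
    (p := fun x => phase ρ x ≠ phase ρ l) ?_
  filter_upwards [ae_mem_simplex, simplexMeasure_absolutelyContinuous.ae_le
    (compl_mem_ae_iff.2 (volume_level_eq_zero hm ρ hl))] with x h1 h2 h3
  exact h2 ⟨h1, h3⟩

/-- The derivative of `maxPhase`, off the ties: the linear form given by the maximizing point. -/
noncomputable def maxPairing {n : ℕ} (ρ : Fin m → ℝ) (L : Fin (n + 1) → Fin m → ℝ) :
    (Fin m → ℝ) →L[ℝ] ℝ :=
  ∑ j, Set.indicator {q : (Fin m → ℝ) × (Fin n → Fin m → ℝ) | ∀ i, phase ρ (q.2 i) < phase ρ q.1}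
    (fun q => pairing q.1) (L j, fun i => L (j.succAbove i))

theorem hasFDerivAt_maxPhase {n : ℕ} {ρ : Fin m → ℝ} {L : Fin (n + 1) → Fin m → ℝ}
    (h : ∀ j (i : Fin n), phase ρ (L (j.succAbove i)) ≠ phase ρ (L j)) :
    HasFDerivAt (fun ρ => maxPhase ρ L) (maxPairing ρ L) ρ := by
  obtain ⟨j, hj⟩ := Finite.exists_max fun j => phase ρ (L j)
  have hlt : ∀ i : Fin n, phase ρ (L (j.succAbove i)) < phase ρ (L j) := fun i =>
    lt_of_le_of_ne (hj _) (h j i)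
  have h1 : maxPairing ρ L = pairing (L j) := by
    rw [maxPairing, Finset.sum_eq_single j]
    · rw [Set.indicator_of_mem]
      exact hlt
    · intro k _ hk
      refine Set.indicator_of_notMem (fun hmem => ?_) _
      obtain ⟨i, rfl⟩ := Fin.exists_succAbove_eq hk.symm
      exact absurd (hj k) (not_le.2 (hmem i))
    · simp
  rw [h1]
  refine (hasFDerivAt_phase ρ (L j)).congr_of_eventuallyEq ?_
  have h2 : ∀ᶠ ρ' in 𝓝 ρ, ∀ i : Fin n, phase ρ' (L (j.succAbove i)) < phase ρ' (L j) := by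
    refine eventually_all.2 fun i => ?_
    exact (hasFDerivAt_phase ρ _).continuousAt.eventually_lt
      (hasFDerivAt_phase ρ _).continuousAt (hlt i)
  filter_upwards [h2] with ρ' h3
  refine le_antisymm (ciSup_le fun k => ?_)
    (le_ciSup (f := fun j => phase ρ' (L j)) (Set.finite_range _).bddAbove j)
  rcases eq_or_ne k j with rfl | hk
  · exact le_rfl
  · obtain ⟨i, rfl⟩ := Fin.exists_succAbove_eq hk
    exact (h3 i).le

/-- The gradient of `F` is the expectation of the maximizing point. Conditioning on which of the
points is the maximizing one turns it into an integral over a single copy of the simplex. -/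
theorem integral_maxPairing (n : ℕ) (ρ : Fin m → ℝ) :
    ∫ L, maxPairing ρ L ∂(Measure.pi fun _ : Fin (n + 1) => simplexMeasure m) =
      (n + 1 : ℝ) • ∫ l, belowMass ρ l ^ n • pairing l ∂(simplexMeasure m) := by
  set S : Set ((Fin m → ℝ) × (Fin n → Fin m → ℝ)) :=
    {q | ∀ i, phase ρ (q.2 i) < phase ρ q.1} with hS
  have hSm : MeasurableSet S := by
    simp only [hS, Set.ofPred_forall]
    refine MeasurableSet.iInter fun i => IsOpen.measurableSet (isOpen_lt ?_ ?_)
    · exact (continuous_phase_right ρ).comp ((continuous_apply i).comp continuous_snd)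
    · exact (continuous_phase_right ρ).comp continuous_fst
  set g : (Fin m → ℝ) × (Fin n → Fin m → ℝ) → (Fin m → ℝ) →L[ℝ] ℝ :=
    S.indicator fun q => pairing q.1 with hg
  have hgi : Integrable g ((simplexMeasure m).prod
      (Measure.pi fun _ : Fin n => simplexMeasure m)) := by
    refine Integrable.of_bound (C := 1) ?_ ?_
    · exact ((continuous_pairing.comp continuous_fst).aestronglyMeasurable).indicator hSm
    · have : ∀ᵐ q ∂((simplexMeasure m).prod (Measure.pi fun _ : Fin n => simplexMeasure m)),
          q.1 ∈ simplex m := Measure.quasiMeasurePreserving_fst.ae ae_mem_simplex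
      filter_upwards [this] with q hq
      exact (norm_indicator_le_norm_self _ _).trans (norm_pairing_le hq)
  have hint : ∫ q, g q ∂((simplexMeasure m).prod (Measure.pi fun _ : Fin n => simplexMeasure m)) =
      ∫ l, belowMass ρ l ^ n • pairing l ∂(simplexMeasure m) := by
    rw [integral_prod _ hgi]
    refine integral_congr_ae (Eventually.of_forall fun l => ?_)
    have h1 : (fun y => g (l, y)) = Set.indicator (Set.pi Set.univ fun _ : Fin n =>
        {x | phase ρ x < phase ρ l}) fun _ => pairing l := by
      funext y
      simp only [hg, hS, Set.indicator, Set.mem_ofPred_eq, Set.mem_univ_pi]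
    have h2 : MeasurableSet {x : Fin m → ℝ | phase ρ x < phase ρ l} :=
      (isOpen_lt (continuous_phase_right ρ) continuous_const).measurableSet
    simp only [h1]
    rw [integral_indicator_const _ (MeasurableSet.univ_pi fun _ => h2), Measure.real,
      Measure.pi_pi, ENNReal.toReal_prod, Finset.prod_const, Finset.card_univ, Fintype.card_fin]
    rfl
  have hj : ∀ j : Fin (n + 1), Integrable (fun L => g (L j, fun i => L (j.succAbove i)))
        (Measure.pi fun _ : Fin (n + 1) => simplexMeasure m) ∧
      ∫ L, g (L j, fun i => L (j.succAbove i))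
        ∂(Measure.pi fun _ : Fin (n + 1) => simplexMeasure m) =
      ∫ l, belowMass ρ l ^ n • pairing l ∂(simplexMeasure m) := by
    intro j
    have mp := measurePreserving_piFinSuccAbove (fun _ : Fin (n + 1) => simplexMeasure m) j
    refine ⟨?_, ?_⟩
    · exact (mp.integrable_comp_emb (MeasurableEquiv.measurableEmbedding _)).2 hgi
    · rw [← hint, ← mp.integral_comp (MeasurableEquiv.measurableEmbedding _)]
      rfl
  simp only [maxPairing]
  rw [integral_finsetSum _ fun j _ => (hj j).1]
  simp only [(hj _).2]
  rw [Finset.sum_const, Finset.card_univ, Fintype.card_fin, ← Nat.cast_smul_eq_nsmul ℝ]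
  push_cast
  rfl

theorem hasFDerivAt_F (hm : 1 ≤ m) (n : ℕ) (ρ : Fin m → ℝ) :
    HasFDerivAt (F m (n + 1))
      ((n + 1 : ℝ) • ∫ l, belowMass ρ l ^ n • pairing l ∂(simplexMeasure m)) ρ := by
  rw [← integral_maxPairing]
  have hd : ∀ᵐ L ∂(Measure.pi fun _ : Fin (n + 1) => simplexMeasure m),
      HasFDerivAt (fun ρ => maxPhase ρ L) (maxPairing ρ L) ρ := by
    filter_upwards [ae_phase_ne hm n ρ] with L hL using hasFDerivAt_maxPhase hL
  refine (hasFDerivAt_integral_of_dominated_loc_of_lip (bound := fun _ => (1 : ℝ))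
    (s := Set.univ) univ_mem
    (Eventually.of_forall fun ρ => (integrable_maxPhase n ρ).1) (integrable_maxPhase n ρ)
    (aestronglyMeasurable_of_hasFDerivAt (fun ρ => (integrable_maxPhase n ρ).1) hd) ?_
    (integrable_const _) hd).2
  filter_upwards [ae_pi_mem_simplex (n + 1)] with L hL
  simpa [lipschitzOnWith_univ] using maxPhase_lipschitz hL

theorem contDiff_gradient (hm : 1 ≤ m) (n : ℕ) :
    ContDiff ℝ 1 fun ρ : Fin m → ℝ =>
      ∫ l, belowMass ρ l ^ n • pairing l ∂(simplexMeasure m) := by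
  rw [contDiff_iff_contDiffAt]
  intro ρ₀
  set M : ℝ≥0 := ⟨(simplexMeasure m).real Set.univ, measureReal_nonneg⟩ with hM
  have : NullSingletonClass (volume : Measure (Fin m → ℝ)) := by
    have : Nonempty (Fin m) := ⟨⟨0, hm⟩⟩
    infer_instance
  refine contDiffAt_integral_of_lipschitz (U := Set.univ)
    (K := m.factorial * superVolLip m * n * M ^ (n - 1)) isOpen_univ (fun ρ => ?_) ?_
    (fun ρ _ => ?_) (Set.mem_univ ρ₀)
  · refine Integrable.of_bound (C := (M : ℝ) ^ n) ?_ ?_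
    · exact (((measurable_belowMass ρ).pow_const n).aestronglyMeasurable).smul
        continuous_pairing.aestronglyMeasurable
    · filter_upwards [ae_mem_simplex] with l hl
      rw [norm_smul, norm_pow, Real.norm_of_nonneg (belowMass_nonneg ρ l)]
      refine (mul_le_of_le_one_right (pow_nonneg (belowMass_nonneg ρ l) _)
        (norm_pairing_le hl)).trans ?_
      exact pow_le_pow_left₀ (belowMass_nonneg ρ l) (belowMass_le ρ l) n
  · filter_upwards [ae_hat_pos, ae_mem_simplex] with l hl hl'
    refine LipschitzWith.of_dist_le_mul fun ρ ρ' => ?_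
    have h1 := ((belowMass_regularity hm hl).1.dist_le_mul ρ ρ')
    have h0 : belowMass ρ l ^ n • pairing l - belowMass ρ' l ^ n • pairing l =
        (belowMass ρ l ^ n - belowMass ρ' l ^ n) • pairing l := (sub_smul _ _ _).symm
    rw [dist_eq_norm, h0, norm_smul]
    refine (mul_le_of_le_one_right (norm_nonneg _) (norm_pairing_le hl')).trans ?_
    refine (abs_pow_sub_pow_le _ _ n).trans ?_
    rw [Real.dist_eq] at h1
    have h2 : max |belowMass ρ l| |belowMass ρ' l| ≤ M := by
      rw [abs_of_nonneg (belowMass_nonneg _ _), abs_of_nonneg (belowMass_nonneg _ _)]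
      exact max_le (belowMass_le _ _) (belowMass_le _ _)
    calc _ ≤ (((m.factorial * superVolLip m : ℝ≥0) : ℝ) * dist ρ ρ') * n * (M : ℝ) ^ (n - 1) := by
          gcongr
      _ = _ := by push_cast; ring
  · have h1 : ∀ᵐ l ∂(simplexMeasure m), ¬ (l ∈ {l | (∀ i, 0 < hat l i) ∧ entropyGrad l = ρ}) := by
      refine simplexMeasure_absolutelyContinuous.ae_le (compl_mem_ae_iff.2 ?_)
      refine Set.Subsingleton.measure_zero ?_ _
      exact fun l hl l' hl' => entropyGrad_injOn hl.1 hl'.1 (hl.2.trans hl'.2.symm)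
    filter_upwards [ae_hat_pos, h1] with l hl hl'
    have h2 := (belowMass_regularity hm hl).2 ρ fun h => hl' ⟨hl, h.symm⟩
    exact (h2.pow n).smul contDiffAt_const

theorem contDiff_F (hm : 1 ≤ m) (n : ℕ) : ContDiff ℝ 2 (F m (n + 1)) := by
  have h1 := hasFDerivAt_F hm n
  have h2 : fderiv ℝ (F m (n + 1)) = fun ρ =>
      (n + 1 : ℝ) • ∫ l, belowMass ρ l ^ n • pairing l ∂(simplexMeasure m) :=
    funext fun ρ => (h1 ρ).fderiv
  rw [show (2 : WithTop ℕ∞) = 1 + 1 from rfl, contDiff_succ_iff_fderiv]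
  refine ⟨fun ρ => (h1 ρ).differentiableAt, by simp, ?_⟩
  rw [h2]
  exact (contDiff_gradient hm n).const_smul (n + 1 : ℝ)

end Potential

end Fewnomial

namespace Fewnomial

open Filter Topology

/-! ### Powers of a 2-form as sums over permutations -/

section WedgePowers

variable {m : ℕ}

/-- A real bilinear map as a multilinear map in two variables. -/
noncomputable def bilinMulti (B : (Fin m → ℂ) →ₗ[ℝ] (Fin m → ℂ) →ₗ[ℝ] ℂ) :
    MultilinearMap ℝ (fun _ : Fin 2 => Fin m → ℂ) ℂ where
  toFun v := B (v 0) (v 1)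
  map_update_add' v i x y := by
    fin_cases i <;> simp [Function.update]
  map_update_smul' v i c x := by
    fin_cases i <;> simp [Function.update]

/-- The multilinear map `v ↦ ∏_i B(v_{2i}, v_{2i+1})`. -/
noncomputable def pairProd (B : (Fin m → ℂ) →ₗ[ℝ] (Fin m → ℂ) →ₗ[ℝ] ℂ) :
    (k : ℕ) → MultilinearMap ℝ (fun _ : Fin (2 * k) => Fin m → ℂ) ℂ
  | 0 => MultilinearMap.constOfIsEmpty ℝ (fun _ : Fin 0 => Fin m → ℂ) 1
  | k + 1 => ((LinearMap.mul' ℝ ℂ).compMultilinearMap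
      ((pairProd B k).domCoprod (bilinMulti B))).domDomCongr finSumFinEquiv

/-- The even index `2 i` below `2 k`. -/
def evenIdx {k : ℕ} (i : Fin k) : Fin (2 * k) := ⟨2 * i.1, by omega⟩

/-- The odd index `2 i + 1` below `2 k`. -/
def oddIdx {k : ℕ} (i : Fin k) : Fin (2 * k) := ⟨2 * i.1 + 1, by omega⟩

theorem pairProd_apply (B : (Fin m → ℂ) →ₗ[ℝ] (Fin m → ℂ) →ₗ[ℝ] ℂ) :
    ∀ (k : ℕ) (v : Fin (2 * k) → Fin m → ℂ),
      pairProd B k v = ∏ i : Fin k, B (v (evenIdx i)) (v (oddIdx i))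
  | 0, v => by rw [Fin.prod_univ_zero]; rfl
  | k + 1, v => by
    rw [Fin.prod_univ_castSucc]
    simp only [pairProd, MultilinearMap.domDomCongr_apply, LinearMap.compMultilinearMap_apply,
      MultilinearMap.domCoprod_apply, LinearMap.mul'_apply, pairProd_apply B k]
    rfl

/-- The wedge product of two antisymmetrized multilinear maps is their antisymmetrized tensor
product, without factorials, because `wedge` is a sum over shuffles. -/
theorem wedge_apply_of_alternatization {p q : ℕ} {α : Form m p} {β : Form m q}
    {s : MultilinearMap ℝ (fun _ : Fin p => Fin m → ℂ) ℂ}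
    {t : MultilinearMap ℝ (fun _ : Fin q => Fin m → ℂ) ℂ}
    (hα : α.toAlternatingMap = MultilinearMap.alternatization s)
    (hβ : β.toAlternatingMap = MultilinearMap.alternatization t) (v : Fin (p + q) → Fin m → ℂ) :
    wedge α β v = ∑ σ : Equiv.Perm (Fin (p + q)), Equiv.Perm.sign σ •
      (s (fun i => v (σ (Fin.castAdd q i))) * t (fun j => v (σ (Fin.natAdd p j)))) := by
  have h1 : wedge α β v = wedgeAux α β (fun i => v (finSumFinEquiv i)) := rfl
  rw [h1, wedgeAux, hα, hβ, ← MultilinearMap.domCoprod_alternization,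
    LinearMap.compAlternatingMap_apply, MultilinearMap.alternatization_apply, map_sum]
  refine Fintype.sum_equiv (finSumFinEquiv.permCongr) _ _ fun σ => ?_
  rw [Equiv.Perm.sign_permCongr]
  simp only [Units.smul_def, map_zsmul, MultilinearMap.domDomCongr_apply,
    MultilinearMap.domCoprod_apply, LinearMap.mul'_apply, Equiv.permCongr_apply]
  simp

theorem alternatization_bilinMulti (B : (Fin m → ℂ) →ₗ[ℝ] (Fin m → ℂ) →ₗ[ℝ] ℂ)
    (v : Fin 2 → Fin m → ℂ) :
    MultilinearMap.alternatization (bilinMulti B) v = B (v 0) (v 1) - B (v 1) (v 0) := by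
  rw [MultilinearMap.alternatization_apply]
  have : (Finset.univ : Finset (Equiv.Perm (Fin 2))) = {1, Equiv.swap 0 1} := by decide
  rw [this, Finset.sum_pair (by decide)]
  simp [bilinMulti, sub_eq_add_neg]

/-- A `2`-form that is the antisymmetrization of a bilinear map `B`. -/
def IsAltOf (α : Form m 2) (B : (Fin m → ℂ) →ₗ[ℝ] (Fin m → ℂ) →ₗ[ℝ] ℂ) : Prop :=
  ∀ x y, α ![x, y] = B x y - B y x

theorem IsAltOf.toAlternatingMap {α : Form m 2} {B : (Fin m → ℂ) →ₗ[ℝ] (Fin m → ℂ) →ₗ[ℝ] ℂ}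
    (h : IsAltOf α B) : α.toAlternatingMap = MultilinearMap.alternatization (bilinMulti B) := by
  ext v
  have hv : v = ![v 0, v 1] := by
    funext i
    fin_cases i <;> rfl
  rw [alternatization_bilinMulti, ← h, ← hv]
  rfl

theorem wedgePow_toAlternatingMap {α : Form m 2}
    {B : (Fin m → ℂ) →ₗ[ℝ] (Fin m → ℂ) →ₗ[ℝ] ℂ} (h : IsAltOf α B) :
    ∀ k, (wedgePow α k).toAlternatingMap = MultilinearMap.alternatization (pairProd B k)
  | 0 => by
    ext v
    have : Subsingleton (Equiv.Perm (Fin (2 * 0))) :=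
      inferInstanceAs (Subsingleton (Equiv.Perm (Fin 0)))
    rw [MultilinearMap.alternatization_apply, Fintype.sum_eq_single 1
      (fun σ hσ => absurd (Subsingleton.elim σ 1) hσ), Equiv.Perm.sign_one, one_smul]
    rfl
  | k + 1 => by
    ext v
    refine (wedge_apply_of_alternatization (wedgePow_toAlternatingMap h k)
      h.toAlternatingMap v).trans ?_
    rw [MultilinearMap.alternatization_apply]
    rfl

/-- The power of a `2`-form `α(x, y) = B(x, y) - B(y, x)` as a sum over permutations. -/
theorem wedgePow_apply {α : Form m 2} {B : (Fin m → ℂ) →ₗ[ℝ] (Fin m → ℂ) →ₗ[ℝ] ℂ}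
    (h : IsAltOf α B) (k : ℕ) (v : Fin (2 * k) → Fin m → ℂ) :
    wedgePow α k v = ∑ σ : Equiv.Perm (Fin (2 * k)), Equiv.Perm.sign σ •
      ∏ i : Fin k, B (v (σ (evenIdx i))) (v (σ (oddIdx i))) := by
  have h1 : wedgePow α k v = (wedgePow α k).toAlternatingMap v := rfl
  rw [h1, wedgePow_toAlternatingMap h, MultilinearMap.alternatization_apply]
  simp only [MultilinearMap.domDomCongr_apply, pairProd_apply]

/-- The product of a power of a `2`-form with another `2`-form as a sum over permutations. -/
theorem wedge_wedgePow_apply {α β : Form m 2} {B C : (Fin m → ℂ) →ₗ[ℝ] (Fin m → ℂ) →ₗ[ℝ] ℂ}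
    (h : IsAltOf α B) (h' : IsAltOf β C) (k : ℕ) (v : Fin (2 * (k + 1)) → Fin m → ℂ) :
    wedge (wedgePow α k) β v = ∑ σ : Equiv.Perm (Fin (2 * (k + 1))), Equiv.Perm.sign σ •
      ((∏ i : Fin k, B (v (σ (evenIdx i.castSucc))) (v (σ (oddIdx i.castSucc)))) *
        C (v (σ (evenIdx (Fin.last k)))) (v (σ (oddIdx (Fin.last k))))) := by
  refine (wedge_apply_of_alternatization (wedgePow_toAlternatingMap h k)
      h'.toAlternatingMap v).trans ?_
  simp only [pairProd_apply]
  rfl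

/-- Every `2`-form is the antisymmetrization of a half of itself. -/
theorem exists_isAltOf_half (α : Form m 2) :
    ∃ B : (Fin m → ℂ) →ₗ[ℝ] (Fin m → ℂ) →ₗ[ℝ] ℂ, IsAltOf α B ∧
      ∀ x y, B x y = (1 / 2 : ℝ) • α ![x, y] := by
  have hswap : ∀ x y, α ![y, x] = - α ![x, y] := by
    intro x y
    have h1 : ![x, y] ∘ Equiv.swap (0 : Fin 2) 1 = ![y, x] := by
      funext i
      fin_cases i <;> rfl
    have h2 := α.toAlternatingMap.map_swap ![x, y] (show (0 : Fin 2) ≠ 1 by decide)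
    rw [h1] at h2
    exact h2
  have hadd1 : ∀ x x' y, α ![x + x', y] = α ![x, y] + α ![x', y] := fun x x' y =>
    α.toAlternatingMap.toMultilinearMap.cons_add ![y] x x'
  have hadd2 : ∀ x y y', α ![x, y + y'] = α ![x, y] + α ![x, y'] := fun x y y' => by
    rw [hswap, hadd1, hswap x y, hswap x y']; ring
  have hsmul1 : ∀ (c : ℝ) x y, α ![c • x, y] = c • α ![x, y] := fun c x y =>
    α.toAlternatingMap.toMultilinearMap.cons_smul ![y] c x
  have hsmul2 : ∀ (c : ℝ) x y, α ![x, c • y] = c • α ![x, y] := fun c x y => by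
    rw [hswap, hsmul1, hswap x y, smul_neg, neg_neg]
  refine ⟨LinearMap.mk₂ ℝ (fun x y => (1 / 2 : ℝ) • α ![x, y]) ?_ ?_ ?_ ?_, ?_, fun x y => rfl⟩
  · intro x x' y; rw [hadd1, smul_add]
  · intro c x y; rw [hsmul1, smul_comm]
  · intro x y y'; rw [hadd2, smul_add]
  · intro c x y; rw [hsmul2, smul_comm]
  · intro x y
    simp only [LinearMap.mk₂_apply, hswap x y, smul_neg, sub_neg_eq_add, ← add_smul]
    norm_num

theorem isBidegree_wedgePow {α : Form m 2} (h : IsBidegree 1 1 α) (k : ℕ) :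
    IsBidegree k k (wedgePow α k) := by
  refine ⟨two_mul k, fun c v => ?_⟩
  obtain ⟨B, hB, hBα⟩ := exists_isAltOf_half α
  have hc : ∀ x y, B (c • x) (c • y) = (c * starRingEnd ℂ c) * B x y := fun x y => by
    have := h.2 c ![x, y]
    rw [hBα, hBα, mul_smul_comm]
    congr 1
    rw [pow_one, pow_one] at this
    rw [← this]
    congr 1
    ext i : 1
    fin_cases i <;> rfl
  rw [wedgePow_apply hB, wedgePow_apply hB, Finset.mul_sum]
  refine Finset.sum_congr rfl fun σ _ => ?_
  simp only [hc, Finset.prod_mul_distrib, Finset.prod_const, Finset.card_univ, Fintype.card_fin,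
    mul_smul_comm]

end WedgePowers

/-! ### Continuity of families of forms -/

section Topology

variable {m : ℕ}

instance finiteDimensional_form (p : ℕ) : FiniteDimensional ℝ (Form m p) :=
  FiniteDimensional.of_injective
    ({ toFun := fun α => α.toAlternatingMap.toMultilinearMap
       map_add' := fun _ _ => rfl
       map_smul' := fun _ _ => rfl } :
      Form m p →ₗ[ℝ] MultilinearMap ℝ (fun _ : Fin p => Fin m → ℂ) ℂ)
    fun α β h => by
      ext v
      exact congrArg (fun f => f v) h

/-- Continuity of a family of forms can be tested on vectors. -/
theorem continuousOn_form {X : Type*} [TopologicalSpace X] {p : ℕ} {η : X → Form m p} {s : Set X}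
    (h : ∀ v, ContinuousOn (fun z => η z v) s) : ContinuousOn η s := by
  set Φ : Form m p →ₗ[ℝ] ((Fin p → Fin m → ℂ) → ℂ) :=
    { toFun := fun α v => α v
      map_add' := fun _ _ => rfl
      map_smul' := fun _ _ => rfl } with hΦ
  have hker : LinearMap.ker Φ = ⊥ := by
    rw [LinearMap.ker_eq_bot]
    intro α β hαβ
    ext v
    exact congrFun hαβ v
  have hemb := (LinearMap.isClosedEmbedding_of_injective hker).isInducing
  rw [hemb.continuousOn_iff]
  exact continuousOn_pi.2 h

end Topology

/-! ### The form `(i / 2π) ∂∂̄ u` of a `C²` function -/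

section DDbar

variable {m : ℕ}

theorem J_apply (v : Fin m → ℂ) : J m v = Complex.I • v := rfl

theorem extDeriv_oneForm {P : (Fin m → ℂ) → (Fin m → ℂ) →L[ℝ] ℂ} {z : Fin m → ℂ}
    (hP : DifferentiableAt ℝ P z) (v : Fin 2 → Fin m → ℂ) :
    extDeriv (fun w => (ContinuousAlternatingMap.ofSubsingleton ℝ (Fin m → ℂ) ℂ (0 : Fin 1)
      (P w) : Form m 1)) z v = fderiv ℝ P z (v 0) (v 1) - fderiv ℝ P z (v 1) (v 0) := by
  have hd : DifferentiableAt ℝ (fun w => (ContinuousAlternatingMap.ofSubsingleton ℝ (Fin m → ℂ) ℂ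
      (0 : Fin 1) (P w) : Form m 1)) z :=
    (ContinuousAlternatingMap.ofSubsingletonLIE (𝕜 := ℝ) (E := Fin m → ℂ) (F := ℂ)
      (0 : Fin 1)).toContinuousLinearEquiv.differentiableAt.comp z hP
  have hev : ∀ y x, fderiv ℝ (fun w => P w y) z x = fderiv ℝ P z x y := fun y x => by
    rw [fderiv_clm_apply hP (differentiableAt_const y)]
    simp
  rw [extDeriv_apply hd, Fin.sum_univ_two]
  simp [hev, Fin.removeNth, sub_eq_add_neg, Fin.succAbove]
  rfl

/-- The bilinear map `(x, y) ↦ -H(x, i y) / 4π` of a bilinear form `H`; the form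
`(i / 2π) ∂∂̄ u` is its antisymmetrization when `H` is the second derivative of `u`. -/
noncomputable def leviBilin (H : (Fin m → ℂ) →L[ℝ] (Fin m → ℂ) →L[ℝ] ℝ) :
    (Fin m → ℂ) →ₗ[ℝ] (Fin m → ℂ) →ₗ[ℝ] ℂ :=
  LinearMap.mk₂ ℝ (fun x y => ((-(1 / (4 * Real.pi)) * H x (J m y) : ℝ) : ℂ))
    (fun x x' y => by simp [mul_add]) (fun c x y => by simp; ring)
    (fun x y y' => by simp [mul_add]) (fun c x y => by simp; ring)

theorem leviBilin_apply (H : (Fin m → ℂ) →L[ℝ] (Fin m → ℂ) →L[ℝ] ℝ) (x y : Fin m → ℂ) :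
    leviBilin H x y = ((-(1 / (4 * Real.pi)) * H x (J m y) : ℝ) : ℂ) := rfl

/-- The complex linear form `∂̄u` of a function with differential `D`. -/
noncomputable def dbarPart (D : (Fin m → ℂ) →L[ℝ] ℝ) : (Fin m → ℂ) →L[ℝ] ℂ :=
  (1 / 2 : ℂ) • (Complex.ofRealCLM.comp D + Complex.I • Complex.ofRealCLM.comp (D.comp (J m)))

theorem dbarPart_apply (D : (Fin m → ℂ) →L[ℝ] ℝ) (x : Fin m → ℂ) :
    dbarPart D x = (1 / 2 : ℂ) * ((D x : ℂ) + Complex.I * (D (J m x) : ℂ)) := rfl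

theorem delbar_zeroForm {u : (Fin m → ℂ) → ℝ} {w : Fin m → ℂ} (hu : DifferentiableAt ℝ u w) :
    delbar (zeroForm u) w = ContinuousAlternatingMap.ofSubsingleton ℝ (Fin m → ℂ) ℂ (0 : Fin 1)
      (dbarPart (fderiv ℝ u w)) := by
  have h1 : extDeriv (zeroForm u) w = ContinuousAlternatingMap.ofSubsingleton ℝ (Fin m → ℂ) ℂ
      (0 : Fin 1) (Complex.ofRealCLM.comp (fderiv ℝ u w)) := by
    have h2 : fderiv ℝ (fun x => (u x : ℂ)) w = Complex.ofRealCLM.comp (fderiv ℝ u w) :=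
      (Complex.ofRealCLM.hasFDerivAt.comp w hu.hasFDerivAt).fderiv
    rw [← h2]
    exact extDeriv_constOfIsEmpty (fun x => (u x : ℂ)) w
  have h3 : (fun w => (zeroForm u w).compContinuousLinearMap (J m)) = zeroForm u := by
    funext w
    ext v
    rfl
  ext v
  simp only [delbar, dc, h3, h1]
  simp only [ContinuousAlternatingMap.smul_apply, ContinuousAlternatingMap.sub_apply,
    ContinuousAlternatingMap.compContinuousLinearMap_apply]
  change (1 / 2 : ℂ) * ((fderiv ℝ u w (v 0) : ℂ) - Complex.I * (fderiv ℝ u w ((-J m) (v 0)) : ℂ)) =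
    dbarPart (fderiv ℝ u w) (v 0)
  rw [dbarPart_apply, _root_.neg_apply, map_neg]
  push_cast
  ring

theorem fderiv_dbarPart {u : (Fin m → ℂ) → ℝ} {z : Fin m → ℂ}
    (hu : DifferentiableAt ℝ (fderiv ℝ u) z) :
    DifferentiableAt ℝ (fun w => dbarPart (fderiv ℝ u w)) z ∧
      ∀ x y, fderiv ℝ (fun w => dbarPart (fderiv ℝ u w)) z x y =
        (1 / 2 : ℂ) * ((fderiv ℝ (fderiv ℝ u) z x y : ℂ) +
          Complex.I * (fderiv ℝ (fderiv ℝ u) z x (J m y) : ℂ)) := by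
  have hd : DifferentiableAt ℝ (fun w => dbarPart (fderiv ℝ u w)) z := by
    unfold dbarPart
    have h1 : DifferentiableAt ℝ (fun w => Complex.ofRealCLM.comp (fderiv ℝ u w)) z :=
      (differentiableAt_const _).clm_comp hu
    have h2 : DifferentiableAt ℝ
        (fun w => Complex.ofRealCLM.comp ((fderiv ℝ u w).comp (J m))) z :=
      (differentiableAt_const _).clm_comp (hu.clm_comp (differentiableAt_const _))
    exact (h1.add (h2.const_smul Complex.I)).const_smul (1 / 2 : ℂ)
  refine ⟨hd, fun x y => ?_⟩
  have h1 : fderiv ℝ (fun w => dbarPart (fderiv ℝ u w)) z x y =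
      fderiv ℝ (fun w => dbarPart (fderiv ℝ u w) y) z x := by
    rw [fderiv_clm_apply hd (differentiableAt_const y)]; simp
  have h2 : ∀ y, HasFDerivAt (fun w => ((fderiv ℝ u w y : ℝ) : ℂ))
      (Complex.ofRealCLM.comp ((fderiv ℝ (fderiv ℝ u) z).flip y)) z := fun y =>
    Complex.ofRealCLM.hasFDerivAt.comp z
      ((ContinuousLinearMap.apply ℝ ℝ y).hasFDerivAt.comp z hu.hasFDerivAt)
  rw [h1]
  simp only [dbarPart_apply]
  have h3 : HasFDerivAt (fun w => (1 / 2 : ℂ) * ((fderiv ℝ u w y : ℂ) +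
      Complex.I * (fderiv ℝ u w (J m y) : ℂ))) _ z :=
    ((h2 y).add ((h2 (J m y)).const_mul Complex.I)).const_mul (1 / 2 : ℂ)
  rw [h3.fderiv]
  rfl

theorem J_J (v : Fin m → ℂ) : J m (J m v) = -v := by
  rw [J_apply, J_apply, smul_smul, Complex.I_mul_I, neg_one_smul]

/-- The form `(i / 2π) ∂∂̄ u` in terms of the second derivative of `u`. -/
theorem ddbar_isAltOf {u : (Fin m → ℂ) → ℝ} {z : Fin m → ℂ} (hu : ContDiffAt ℝ 2 u z) :
    IsAltOf (ddbar u z) (leviBilin (fderiv ℝ (fderiv ℝ u) z)) := by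
  intro x y
  have hfd : DifferentiableAt ℝ (fderiv ℝ u) z :=
    (hu.fderiv_right (m := 1) (by norm_num)).differentiableAt (by norm_num)
  obtain ⟨hPd, hP⟩ := fderiv_dbarPart hfd
  have hsymm : ∀ x y, fderiv ℝ (fderiv ℝ u) z x y = fderiv ℝ (fderiv ℝ u) z y x :=
    fun x y => (hu.isSymmSndFDerivAt (by simp)) x y
  have hev : delbar (zeroForm u) =ᶠ[𝓝 z] fun w => ContinuousAlternatingMap.ofSubsingleton ℝ
      (Fin m → ℂ) ℂ (0 : Fin 1) (dbarPart (fderiv ℝ u w)) := by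
    filter_upwards [hu.eventually (by simp)] with w hw
    exact delbar_zeroForm (hw.differentiableAt (by norm_num))
  have hev' : (fun w => (delbar (zeroForm u) w).compContinuousLinearMap (J m)) =ᶠ[𝓝 z]
      fun w => ContinuousAlternatingMap.ofSubsingleton ℝ
      (Fin m → ℂ) ℂ (0 : Fin 1) ((dbarPart (fderiv ℝ u w)).comp (J m)) := by
    filter_upwards [hev] with w hw
    rw [hw]
    ext v
    rfl
  have hPJ : DifferentiableAt ℝ (fun w => (dbarPart (fderiv ℝ u w)).comp (J m)) z :=
    hPd.clm_comp (differentiableAt_const _)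
  have hPJ' : ∀ x y, fderiv ℝ (fun w => (dbarPart (fderiv ℝ u w)).comp (J m)) z x y =
      fderiv ℝ (fun w => dbarPart (fderiv ℝ u w)) z x (J m y) := by
    intro x y
    rw [fderiv_clm_comp hPd (differentiableAt_const _)]
    simp
  rw [ddbar, del, dc, hev.extDeriv_eq, hev'.extDeriv_eq]
  simp only [ContinuousAlternatingMap.smul_apply, ContinuousAlternatingMap.add_apply,
    ContinuousAlternatingMap.compContinuousLinearMap_apply, extDeriv_oneForm hPd,
    extDeriv_oneForm hPJ, hPJ', hP, smul_eq_mul, Function.comp_apply]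
  simp only [Matrix.cons_val_zero, Matrix.cons_val_one, _root_.neg_apply, map_neg, J_J, neg_neg,
    leviBilin_apply]
  rw [hsymm x y, hsymm (J m y) x, hsymm (J m x) y, hsymm (J m x) (J m y)]
  have hI : Complex.I ^ 2 = -1 := Complex.I_sq
  push_cast
  have hpi : (Real.pi : ℂ) ≠ 0 := by exact_mod_cast Real.pi_ne_zero
  field_simp
  linear_combination (8 * ((fderiv ℝ (fderiv ℝ u) z x (J m y) : ℂ) -
    (fderiv ℝ (fderiv ℝ u) z y (J m x) : ℂ))) * hI

end DDbar

end Fewnomial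

namespace Fewnomial

open Filter Topology

-- For the norm on the space `E →L[ℝ] E →L[ℝ] ℝ` of second derivatives.
set_option maxSynthPendingDepth 3

/-! ### Integration by parts in an antisymmetrized product -/

section IntegrationByParts

variable {E : Type*} [NormedAddCommGroup E] [NormedSpace ℝ E]

theorem sum_sign_mul_eq_zero {N : ℕ} {g : Equiv.Perm (Fin N) → ℝ} {a b : Fin N} (hab : a ≠ b)
    (h : ∀ σ, g (σ * Equiv.swap a b) = g σ) :
    ∑ σ : Equiv.Perm (Fin N), ((Equiv.Perm.sign σ : ℤ) : ℝ) * g σ = 0 := by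
  have h1 : ∑ σ : Equiv.Perm (Fin N), ((Equiv.Perm.sign σ : ℤ) : ℝ) * g σ =
      ∑ σ : Equiv.Perm (Fin N), -(((Equiv.Perm.sign σ : ℤ) : ℝ) * g σ) := by
    refine Fintype.sum_equiv (Equiv.mulRight (Equiv.swap a b)) _ _ fun σ => ?_
    simp only [Equiv.coe_mulRight, h, Equiv.Perm.sign_mul, Equiv.Perm.sign_swap hab]
    simp
  rw [Finset.sum_neg_distrib] at h1
  linarith

theorem fderiv_fderiv_apply {f : E → ℝ} {z : E} (hf : DifferentiableAt ℝ (fderiv ℝ f) z)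
    (x y : E) : fderiv ℝ (fun w => fderiv ℝ f w y) z x = fderiv ℝ (fderiv ℝ f) z x y := by
  rw [fderiv_clm_apply hf (differentiableAt_const y)]
  simp

/-- The third derivative of `f` at `z` in the directions `x, y, w`. -/
noncomputable def thirdDeriv (f : E → ℝ) (z x y w : E) : ℝ :=
  fderiv ℝ (fun z => fderiv ℝ (fderiv ℝ f) z y w) z x

theorem contDiff_fderiv_apply {f : E → ℝ} (hf : ContDiff ℝ ∞ f) (y : E) :
    ContDiff ℝ ∞ fun z => fderiv ℝ f z y :=
  (hf.fderiv_right (m := ∞) (by simp)).clm_apply contDiff_const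

theorem contDiff_fderiv_fderiv_apply {f : E → ℝ} (hf : ContDiff ℝ ∞ f) (x y : E) :
    ContDiff ℝ ∞ fun z => fderiv ℝ (fderiv ℝ f) z x y :=
  (((hf.fderiv_right (m := ∞) (by simp)).fderiv_right (m := ∞) (by simp)).clm_apply
    contDiff_const).clm_apply contDiff_const

theorem fderiv_fderiv_symm {f : E → ℝ} (hf : ContDiff ℝ ∞ f) (z x y : E) :
    fderiv ℝ (fderiv ℝ f) z x y = fderiv ℝ (fderiv ℝ f) z y x :=
  ((contDiff_infty.1 hf 2).contDiffAt.isSymmSndFDerivAt (by simp)) x y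

theorem thirdDeriv_symm_right {f : E → ℝ} (hf : ContDiff ℝ ∞ f) (z x y w : E) :
    thirdDeriv f z x y w = thirdDeriv f z x w y := by
  simp only [thirdDeriv, fderiv_fderiv_symm hf _ y w]

theorem thirdDeriv_symm_left {f : E → ℝ} (hf : ContDiff ℝ ∞ f) (z x y w : E) :
    thirdDeriv f z x y w = thirdDeriv f z y x w := by
  have h1 : ∀ x y, thirdDeriv f z x y w = fderiv ℝ (fderiv ℝ fun z => fderiv ℝ f z w) z x y := by
    intro x y
    have h2 : (fun z => fderiv ℝ (fderiv ℝ f) z y w) =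
        fun z => fderiv ℝ (fun z => fderiv ℝ f z w) z y := by
      funext z
      exact (fderiv_fderiv_apply
        ((hf.fderiv_right (m := ∞) (by simp)).differentiable (by simp) z) y w).symm
    rw [thirdDeriv, h2, fderiv_fderiv_apply]
    exact ((contDiff_fderiv_apply hf w).fderiv_right (m := ∞) (by simp)).differentiable (by simp) z
  rw [h1, h1, fderiv_fderiv_symm (contDiff_fderiv_apply hf w)]

theorem thirdDeriv_symm_outer {f : E → ℝ} (hf : ContDiff ℝ ∞ f) (z x y w : E) :
    thirdDeriv f z x y w = thirdDeriv f z w y x := by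
  rw [thirdDeriv_symm_left hf, thirdDeriv_symm_right hf, thirdDeriv_symm_left hf]

/-- The product of `k` second derivatives in the directions `(v_{σ(2i)}, A v_{σ(2i+1)})`, `i < k`. -/
noncomputable def pairWeight (A : E →L[ℝ] E) {k : ℕ} (v : Fin (2 * (k + 1)) → E)
    (P : E →L[ℝ] E →L[ℝ] ℝ) (σ : Equiv.Perm (Fin (2 * (k + 1)))) : ℝ :=
  ∏ i : Fin k, P (v (σ (evenIdx i.castSucc))) (A (v (σ (oddIdx i.castSucc))))

/-- The antisymmetrized product of `k` copies of the bilinear form `P(x, A y)` and of `Q(x, A y)`. -/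
noncomputable def altSum (A : E →L[ℝ] E) {k : ℕ} (v : Fin (2 * (k + 1)) → E)
    (P Q : E →L[ℝ] E →L[ℝ] ℝ) : ℝ :=
  ∑ σ : Equiv.Perm (Fin (2 * (k + 1))), ((Equiv.Perm.sign σ : ℤ) : ℝ) *
    (pairWeight A v P σ *
      Q (v (σ (evenIdx (Fin.last k)))) (A (v (σ (oddIdx (Fin.last k))))))

variable {A : E →L[ℝ] E} {k : ℕ} {v : Fin (2 * (k + 1)) → E} {f g : E → ℝ}

theorem altSum_zero_right (P : E →L[ℝ] E →L[ℝ] ℝ) : altSum A v P 0 = 0 := by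
  simp [altSum]

theorem contDiff_pairWeight (hf : ContDiff ℝ ∞ f) (σ : Equiv.Perm (Fin (2 * (k + 1)))) :
    ContDiff ℝ ∞ fun z => pairWeight A v (fderiv ℝ (fderiv ℝ f) z) σ :=
  contDiff_prod fun _ _ => contDiff_fderiv_fderiv_apply hf _ _

theorem fderiv_pairWeight (hf : ContDiff ℝ ∞ f) (σ : Equiv.Perm (Fin (2 * (k + 1)))) (z p : E) :
    fderiv ℝ (fun z => pairWeight A v (fderiv ℝ (fderiv ℝ f) z) σ) z p =
      ∑ i : Fin k, (∏ j ∈ Finset.univ.erase i, fderiv ℝ (fderiv ℝ f) z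
        (v (σ (evenIdx j.castSucc))) (A (v (σ (oddIdx j.castSucc))))) *
          thirdDeriv f z p (v (σ (evenIdx i.castSucc))) (A (v (σ (oddIdx i.castSucc)))) := by
  simp only [pairWeight]
  rw [fderiv_finsetProd fun i _ =>
    (contDiff_fderiv_fderiv_apply hf _ _).differentiable (by simp) z]
  simp only [_root_.sum_apply, _root_.smul_apply, smul_eq_mul, thirdDeriv]

/-- Closedness: antisymmetrizing the derivative of `pairWeight` in the direction of the next even
vector gives zero, since third derivatives are symmetric. -/
theorem sum_sign_fderiv_pairWeight_even (hf : ContDiff ℝ ∞ f) (z : E) (G : E → ℝ) :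
    ∑ σ : Equiv.Perm (Fin (2 * (k + 1))), ((Equiv.Perm.sign σ : ℤ) : ℝ) *
      (fderiv ℝ (fun z => pairWeight A v (fderiv ℝ (fderiv ℝ f) z) σ) z
        (v (σ (evenIdx (Fin.last k)))) * G (v (σ (oddIdx (Fin.last k))))) = 0 := by
  simp only [fderiv_pairWeight hf, Finset.sum_mul, Finset.mul_sum]
  rw [Finset.sum_comm]
  refine Finset.sum_eq_zero fun i _ => ?_
  have hne : (evenIdx i.castSucc : Fin (2 * (k + 1))) ≠ evenIdx (Fin.last k) := by
    simp only [evenIdx, ne_eq, Fin.ext_iff, Fin.val_castSucc, Fin.val_last]; omega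
  refine sum_sign_mul_eq_zero hne fun σ => ?_
  have h1 : ∀ j : Fin (k + 1), Equiv.swap (evenIdx i.castSucc) (evenIdx (Fin.last k)) (oddIdx j) =
      (oddIdx j : Fin (2 * (k + 1))) := fun j => by
    refine Equiv.swap_apply_of_ne_of_ne ?_ ?_ <;>
    · simp only [evenIdx, oddIdx, ne_eq, Fin.ext_iff]; omega
  have h2 : ∀ j ∈ Finset.univ.erase i,
      Equiv.swap (evenIdx i.castSucc) (evenIdx (Fin.last k)) (evenIdx j.castSucc) =
      (evenIdx j.castSucc : Fin (2 * (k + 1))) := fun j hj => by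
    have hji : j.1 ≠ i.1 := fun h => (Finset.ne_of_mem_erase hj) (Fin.ext h)
    refine Equiv.swap_apply_of_ne_of_ne ?_ ?_ <;>
    · simp only [evenIdx, ne_eq, Fin.ext_iff, Fin.val_castSucc, Fin.val_last]; omega
  simp only [Equiv.Perm.mul_apply, h1, Equiv.swap_apply_left, Equiv.swap_apply_right]
  rw [thirdDeriv_symm_left hf]
  congr 2
  exact Finset.prod_congr rfl fun j hj => by rw [h2 j hj]

/-- Closedness in the direction of the next odd vector. -/
theorem sum_sign_fderiv_pairWeight_odd (hf : ContDiff ℝ ∞ f) (z : E) (G : E → ℝ) :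
    ∑ σ : Equiv.Perm (Fin (2 * (k + 1))), ((Equiv.Perm.sign σ : ℤ) : ℝ) *
      (fderiv ℝ (fun z => pairWeight A v (fderiv ℝ (fderiv ℝ f) z) σ) z
        (A (v (σ (oddIdx (Fin.last k))))) * G (v (σ (evenIdx (Fin.last k))))) = 0 := by
  simp only [fderiv_pairWeight hf, Finset.sum_mul, Finset.mul_sum]
  rw [Finset.sum_comm]
  refine Finset.sum_eq_zero fun i _ => ?_
  have hne : (oddIdx i.castSucc : Fin (2 * (k + 1))) ≠ oddIdx (Fin.last k) := by
    simp only [oddIdx, ne_eq, Fin.ext_iff, Fin.val_castSucc, Fin.val_last]; omega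
  refine sum_sign_mul_eq_zero hne fun σ => ?_
  have h1 : ∀ j : Fin (k + 1), Equiv.swap (oddIdx i.castSucc) (oddIdx (Fin.last k)) (evenIdx j) =
      (evenIdx j : Fin (2 * (k + 1))) := fun j => by
    refine Equiv.swap_apply_of_ne_of_ne ?_ ?_ <;>
    · simp only [evenIdx, oddIdx, ne_eq, Fin.ext_iff]; omega
  have h2 : ∀ j ∈ Finset.univ.erase i,
      Equiv.swap (oddIdx i.castSucc) (oddIdx (Fin.last k)) (oddIdx j.castSucc) =
      (oddIdx j.castSucc : Fin (2 * (k + 1))) := fun j hj => by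
    have hji : j.1 ≠ i.1 := fun h => (Finset.ne_of_mem_erase hj) (Fin.ext h)
    refine Equiv.swap_apply_of_ne_of_ne ?_ ?_ <;>
    · simp only [oddIdx, ne_eq, Fin.ext_iff, Fin.val_castSucc, Fin.val_last]; omega
  simp only [Equiv.Perm.mul_apply, h1, Equiv.swap_apply_left, Equiv.swap_apply_right]
  rw [thirdDeriv_symm_outer hf]
  congr 2
  exact Finset.prod_congr rfl fun j hj => by rw [h2 j hj]

variable [MeasurableSpace E] [BorelSpace E] [FiniteDimensional ℝ E] {μ : Measure E}
  [μ.IsAddHaarMeasure]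

theorem integral_mul_fderiv_of_contDiff {a b w : E → ℝ} (ha : ContDiff ℝ ∞ a)
    (hac : HasCompactSupport a) (hb : ContDiff ℝ ∞ b) (hw : ContDiff ℝ ∞ w) (x : E) :
    ∫ z, a z * w z * fderiv ℝ b z x ∂μ =
      -(∫ z, fderiv ℝ a z x * w z * b z ∂μ) - ∫ z, a z * fderiv ℝ w z x * b z ∂μ := by
  have hac' : HasCompactSupport fun z => fderiv ℝ a z x := hac.fderiv_apply ℝ x
  have h1 : Integrable (fun z => fderiv ℝ a z x * w z * b z) μ :=
    (((contDiff_fderiv_apply ha x).continuous.mul hw.continuous).mul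
      hb.continuous).integrable_of_hasCompactSupport hac'.mul_right.mul_right
  have h2 : Integrable (fun z => a z * fderiv ℝ w z x * b z) μ :=
    ((ha.continuous.mul (contDiff_fderiv_apply hw x).continuous).mul
      hb.continuous).integrable_of_hasCompactSupport hac.mul_right.mul_right
  have h3 : ∀ z, fderiv ℝ (fun z => a z * w z) z x = fderiv ℝ a z x * w z +
      a z * fderiv ℝ w z x := fun z => by
    rw [fderiv_fun_mul (ha.differentiable (by simp) z) (hw.differentiable (by simp) z)]
    simp; ring
  have h4 := integral_mul_fderiv_eq_neg_fderiv_mul_of_integrable (μ := μ) (f := fun z => a z * w z)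
    (g := b) (v := x) ?_ ?_ ?_ (fun z _ => (ha.mul hw).differentiable (by simp) z)
    (fun z _ => hb.differentiable (by simp) z)
  · have h5 := integral_sub h1.neg h2
    simp only [Pi.neg_apply] at h5
    rw [h4, ← integral_neg, ← integral_neg, ← h5]
    congr 1
    funext z
    rw [h3]; ring
  · refine (h1.add h2).congr (Eventually.of_forall fun z => ?_)
    simp only [Pi.add_apply, h3]; ring
  · exact ((ha.continuous.mul hw.continuous).mul
      (contDiff_fderiv_apply hb x).continuous).integrable_of_hasCompactSupport
      hac.mul_right.mul_right
  · exact ((ha.continuous.mul hw.continuous).mul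
      hb.continuous).integrable_of_hasCompactSupport hac.mul_right.mul_right

/-- Two integrations by parts move the second derivative from `g` to `f`. The terms in which a
derivative falls on `pairWeight` cancel in the antisymmetrization. -/
theorem integral_mul_altSum_of_contDiff (hf : ContDiff ℝ ∞ f) (hfc : HasCompactSupport f)
    (hg : ContDiff ℝ ∞ g) (hgc : HasCompactSupport g) :
    ∫ z, g z * altSum A v (fderiv ℝ (fderiv ℝ f) z) (fderiv ℝ (fderiv ℝ f) z) ∂μ =
      ∫ z, f z * altSum A v (fderiv ℝ (fderiv ℝ f) z) (fderiv ℝ (fderiv ℝ g) z) ∂μ := by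
  set W : Equiv.Perm (Fin (2 * (k + 1))) → E → ℝ :=
    fun σ z => pairWeight A v (fderiv ℝ (fderiv ℝ f) z) σ with hW
  have hWc : ∀ σ, ContDiff ℝ ∞ (W σ) := fun σ => contDiff_pairWeight hf σ
  set p : Equiv.Perm (Fin (2 * (k + 1))) → E := fun σ => v (σ (evenIdx (Fin.last k))) with hp
  set q : Equiv.Perm (Fin (2 * (k + 1))) → E := fun σ => A (v (σ (oddIdx (Fin.last k)))) with hq
  have hfd : ∀ z, DifferentiableAt ℝ (fderiv ℝ f) z := fun z =>
    (hf.fderiv_right (m := ∞) (by simp)).differentiable (by simp) z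
  have hgd : ∀ z, DifferentiableAt ℝ (fderiv ℝ g) z := fun z =>
    (hg.fderiv_right (m := ∞) (by simp)).differentiable (by simp) z
  have hexpand : ∀ (a b : E → ℝ), ContDiff ℝ ∞ a → HasCompactSupport a → ContDiff ℝ ∞ b →
      ∫ z, a z * altSum A v (fderiv ℝ (fderiv ℝ f) z) (fderiv ℝ (fderiv ℝ b) z) ∂μ =
      ∑ σ, ((Equiv.Perm.sign σ : ℤ) : ℝ) *
        ∫ z, a z * W σ z * fderiv ℝ (fderiv ℝ b) z (p σ) (q σ) ∂μ := by
    intro a b ha hac hb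
    simp only [← integral_const_mul]
    rw [← integral_finsetSum]
    · congr 1
      funext z
      rw [altSum, Finset.mul_sum]
      refine Finset.sum_congr rfl fun σ _ => ?_
      simp only [hW, hp, hq]; ring
    · intro σ _
      refine Integrable.const_mul ?_ _
      exact ((ha.continuous.mul (hWc σ).continuous).mul
        (contDiff_fderiv_fderiv_apply hb _ _).continuous).integrable_of_hasCompactSupport
        hac.mul_right.mul_right
  rw [hexpand g f hg hgc hf, hexpand f g hf hfc hg]
  have h1 : ∀ σ, ∫ z, g z * W σ z * fderiv ℝ (fderiv ℝ f) z (p σ) (q σ) ∂μ =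
      -(∫ z, fderiv ℝ g z (q σ) * W σ z * fderiv ℝ f z (p σ) ∂μ) -
        ∫ z, g z * fderiv ℝ (W σ) z (q σ) * fderiv ℝ f z (p σ) ∂μ := by
    intro σ
    rw [← integral_mul_fderiv_of_contDiff hg hgc (contDiff_fderiv_apply hf (p σ)) (hWc σ)]
    simp only [fderiv_fderiv_apply (hfd _), fderiv_fderiv_symm hf _ (q σ) (p σ)]
  have h2 : ∀ σ, ∫ z, f z * W σ z * fderiv ℝ (fderiv ℝ g) z (p σ) (q σ) ∂μ =
      -(∫ z, fderiv ℝ f z (p σ) * W σ z * fderiv ℝ g z (q σ) ∂μ) -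
        ∫ z, f z * fderiv ℝ (W σ) z (p σ) * fderiv ℝ g z (q σ) ∂μ := by
    intro σ
    rw [← integral_mul_fderiv_of_contDiff hf hfc (contDiff_fderiv_apply hg (q σ)) (hWc σ)]
    simp only [fderiv_fderiv_apply (hgd _)]
  have h3 : ∑ σ, ((Equiv.Perm.sign σ : ℤ) : ℝ) *
      ∫ z, g z * fderiv ℝ (W σ) z (q σ) * fderiv ℝ f z (p σ) ∂μ = 0 := by
    simp only [← integral_const_mul]
    rw [← integral_finsetSum]
    · refine integral_eq_zero_of_ae (Eventually.of_forall fun z => ?_)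
      have := congrArg (fun t => g z * t)
        (sum_sign_fderiv_pairWeight_odd (A := A) (v := v) hf z (fun x => fderiv ℝ f z x))
      simp only [Finset.mul_sum, mul_zero] at this
      refine Eq.trans (Finset.sum_congr rfl fun σ _ => ?_) this
      simp only [hW, hp, hq]; ring
    · intro σ _
      exact (((hg.continuous.mul (contDiff_fderiv_apply (hWc σ) _).continuous).mul
        (contDiff_fderiv_apply hf _).continuous).integrable_of_hasCompactSupport
        hgc.mul_right.mul_right).const_mul _
  have h4 : ∑ σ, ((Equiv.Perm.sign σ : ℤ) : ℝ) *
      ∫ z, f z * fderiv ℝ (W σ) z (p σ) * fderiv ℝ g z (q σ) ∂μ = 0 := by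
    simp only [← integral_const_mul]
    rw [← integral_finsetSum]
    · refine integral_eq_zero_of_ae (Eventually.of_forall fun z => ?_)
      have := congrArg (fun t => f z * t)
        (sum_sign_fderiv_pairWeight_even (A := A) (v := v) hf z (fun x => fderiv ℝ g z (A x)))
      simp only [Finset.mul_sum, mul_zero] at this
      refine Eq.trans (Finset.sum_congr rfl fun σ _ => ?_) this
      simp only [hW, hp, hq]; ring
    · intro σ _
      exact (((hf.continuous.mul (contDiff_fderiv_apply (hWc σ) _).continuous).mul
        (contDiff_fderiv_apply hg _).continuous).integrable_of_hasCompactSupport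
        hfc.mul_right.mul_right).const_mul _
  simp only [h1, h2, mul_sub, Finset.sum_sub_distrib, h3, h4, sub_zero]
  refine Finset.sum_congr rfl fun σ _ => ?_
  congr 2
  refine integral_congr_ae (Eventually.of_forall fun z => ?_)
  simp only; ring

end IntegrationByParts

/-! ### Integration by parts for `C²` functions -/

section Mollification

variable {E : Type*} [NormedAddCommGroup E] [NormedSpace ℝ E] [MeasurableSpace E] [BorelSpace E]
  [FiniteDimensional ℝ E] (μ : Measure E) [μ.IsAddHaarMeasure]

theorem fderiv_convolution_normed {F : Type*} [NormedAddCommGroup F] [NormedSpace ℝ F]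
    [CompleteSpace F] (χ : ContDiffBump (0 : E)) {g : E → F} (hg : ContDiff ℝ 1 g)
    (hgc : HasCompactSupport g) :
    fderiv ℝ (convolution (χ.normed μ) g (ContinuousLinearMap.lsmul ℝ ℝ) μ) =
      convolution (χ.normed μ) (fderiv ℝ g) (ContinuousLinearMap.lsmul ℝ ℝ) μ := by
  funext z
  have h1 := hgc.hasFDerivAt_convolution_right (μ := μ) (ContinuousLinearMap.lsmul ℝ ℝ)
    (f := χ.normed μ) (χ.continuous_normed.locallyIntegrable) hg z
  rw [h1.fderiv]
  rfl

theorem norm_convolution_normed_le {F : Type*} [NormedAddCommGroup F] [NormedSpace ℝ F]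
    [CompleteSpace F] (χ : ContDiffBump (0 : E)) {g : E → F} (hg : Continuous g) {C : ℝ}
    (hC : ∀ z, ‖g z‖ ≤ C) (z : E) :
    ‖convolution (χ.normed μ) g (ContinuousLinearMap.lsmul ℝ ℝ) μ z‖ ≤ 3 * C := by
  have h1 := χ.dist_normed_convolution_le (μ := μ) (x₀ := z) (ε := 2 * C)
    hg.aestronglyMeasurable fun x _ => by
      rw [dist_eq_norm]
      exact (norm_sub_le _ _).trans (by linarith [hC x, hC z])
  rw [dist_eq_norm] at h1
  have h2 := norm_le_norm_sub_add
    (convolution (χ.normed μ) g (ContinuousLinearMap.lsmul ℝ ℝ) μ z) (g z)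
  linarith [hC z]

omit μ [μ.IsAddHaarMeasure] in
/-- A compactly supported `C²` function is the limit of smooth ones, pointwise and boundedly
together with its second derivative. -/
theorem exists_mollification {f : E → ℝ} (hf : ContDiff ℝ 2 f) (hfc : HasCompactSupport f) :
    ∃ (F : ℕ → E → ℝ) (C : ℝ), (∀ n, ContDiff ℝ ∞ (F n)) ∧ (∀ n, HasCompactSupport (F n)) ∧
      (∀ n z, ‖F n z‖ ≤ C) ∧ (∀ n z, ‖fderiv ℝ (fderiv ℝ (F n)) z‖ ≤ C) ∧
      (∀ z, Tendsto (fun n => F n z) atTop (𝓝 (f z))) ∧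
      ∀ z, Tendsto (fun n => fderiv ℝ (fderiv ℝ (F n)) z) atTop
        (𝓝 (fderiv ℝ (fderiv ℝ f) z)) := by
  set μ : Measure E := Measure.addHaar
  set χ : ℕ → ContDiffBump (0 : E) := fun n =>
    ⟨1 / (2 * ((n : ℝ) + 1)), 1 / ((n : ℝ) + 1), by positivity, by
      refine one_div_lt_one_div_of_lt (by positivity) ?_
      have : (0 : ℝ) ≤ n := Nat.cast_nonneg n
      linarith⟩ with hχ
  have hχ0 : Tendsto (fun n => (χ n).rOut) atTop (𝓝 0) := tendsto_one_div_add_atTop_nhds_zero_nat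
  have hf1 : ContDiff ℝ 1 (fderiv ℝ f) := hf.fderiv_right (by norm_num)
  have hf0 : Continuous (fderiv ℝ (fderiv ℝ f)) := hf1.continuous_fderiv (by norm_num)
  have hdd : ∀ n, fderiv ℝ (fderiv ℝ
      (convolution ((χ n).normed μ) f (ContinuousLinearMap.lsmul ℝ ℝ) μ)) =
      convolution ((χ n).normed μ) (fderiv ℝ (fderiv ℝ f)) (ContinuousLinearMap.lsmul ℝ ℝ) μ := by
    intro n
    rw [fderiv_convolution_normed μ (χ n) (hf.of_le (by norm_num)) hfc,
      fderiv_convolution_normed μ (χ n) hf1 (hfc.fderiv ℝ)]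
  obtain ⟨C₁, hC₁⟩ := hfc.exists_bound_of_continuous hf.continuous
  obtain ⟨C₂, hC₂⟩ := ((hfc.fderiv ℝ).fderiv ℝ).exists_bound_of_continuous hf0
  refine ⟨fun n => convolution ((χ n).normed μ) f (ContinuousLinearMap.lsmul ℝ ℝ) μ,
    max (3 * C₁) (3 * C₂), fun n => ?_, fun n => ?_, fun n z => ?_, fun n z => ?_, fun z => ?_,
    fun z => ?_⟩
  · exact (χ n).hasCompactSupport_normed.contDiff_convolution_left _ (χ n).contDiff_normed
      hf.continuous.locallyIntegrable
  · exact HasCompactSupport.convolution _ (χ n).hasCompactSupport_normed hfc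
  · exact (norm_convolution_normed_le μ (χ n) hf.continuous hC₁ z).trans (le_max_left _ _)
  · rw [hdd]
    exact (norm_convolution_normed_le μ (χ n) hf0 hC₂ z).trans (le_max_right _ _)
  · exact ContDiffBump.convolution_tendsto_right_of_continuous hχ0 hf.continuous z
  · simp only [hdd]
    exact ContDiffBump.convolution_tendsto_right_of_continuous hχ0 hf0 z

variable {μ} {A : E →L[ℝ] E} {k : ℕ} {v : Fin (2 * (k + 1)) → E} {f g : E → ℝ}

omit [MeasurableSpace E] [BorelSpace E] [FiniteDimensional ℝ E] in
theorem continuous_altSum : Continuous fun p : (E →L[ℝ] E →L[ℝ] ℝ) × (E →L[ℝ] E →L[ℝ] ℝ) =>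
    altSum A v p.1 p.2 := by
  unfold altSum pairWeight
  fun_prop

-- `altSum` is a sum over permutations, which unification should not unfold.
attribute [irreducible] altSum

omit [MeasurableSpace E] [BorelSpace E] [FiniteDimensional ℝ E] in
theorem tendsto_altSum {ι : Type*} {l : Filter ι} {P Q : ι → E →L[ℝ] E →L[ℝ] ℝ}
    {p q : E →L[ℝ] E →L[ℝ] ℝ} (hP : Tendsto P l (𝓝 p)) (hQ : Tendsto Q l (𝓝 q)) :
    Tendsto (fun n => altSum A v (P n) (Q n)) l (𝓝 (altSum A v p q)) :=
  (continuous_altSum.tendsto (p, q)).comp (hP.prodMk_nhds hQ)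

omit [MeasurableSpace E] [BorelSpace E] in
theorem exists_bound_altSum (C : ℝ) : ∃ M, ∀ P Q : E →L[ℝ] E →L[ℝ] ℝ, ‖P‖ ≤ C → ‖Q‖ ≤ C →
    ‖altSum A v P Q‖ ≤ M := by
  have hK : IsCompact ((Metric.closedBall (0 : E →L[ℝ] E →L[ℝ] ℝ) C) ×ˢ
      (Metric.closedBall (0 : E →L[ℝ] E →L[ℝ] ℝ) C)) :=
    (isCompact_closedBall _ _).prod (isCompact_closedBall _ _)
  obtain ⟨M, hM⟩ := hK.exists_bound_of_continuousOn
    (continuous_altSum (A := A) (v := v)).continuousOn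
  exact ⟨M, fun P Q hP hQ => hM (P, Q) ⟨by simpa using hP, by simpa using hQ⟩⟩

/-- The integration by parts formula for a compactly supported `C²` function `f`. -/
theorem integral_mul_altSum (hf : ContDiff ℝ 2 f) (hfc : HasCompactSupport f)
    (hg : ContDiff ℝ ∞ g) (hgc : HasCompactSupport g) :
    ∫ z, g z * altSum A v (fderiv ℝ (fderiv ℝ f) z) (fderiv ℝ (fderiv ℝ f) z) ∂μ =
      ∫ z, f z * altSum A v (fderiv ℝ (fderiv ℝ f) z) (fderiv ℝ (fderiv ℝ g) z) ∂μ := by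
  obtain ⟨F, C, hF, hFc, hFb, hFb2, hFt, hFt2⟩ := exists_mollification hf hfc
  have hg2 : Continuous (fderiv ℝ (fderiv ℝ g)) :=
    ((hg.fderiv_right (m := ∞) (by simp)).fderiv_right (m := ∞) (by simp)).continuous
  have hF2 : ∀ n, Continuous (fderiv ℝ (fderiv ℝ (F n))) := fun n =>
    (((hF n).fderiv_right (m := ∞) (by simp)).fderiv_right (m := ∞) (by simp)).continuous
  obtain ⟨Cg, hCg⟩ := ((hgc.fderiv ℝ).fderiv ℝ).exists_bound_of_continuous hg2
  obtain ⟨M, hM⟩ := exists_bound_altSum (A := A) (v := v) (max C Cg)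
  have hL : Tendsto (fun n => ∫ z, g z * altSum A v (fderiv ℝ (fderiv ℝ (F n)) z)
      (fderiv ℝ (fderiv ℝ (F n)) z) ∂μ) atTop
      (𝓝 (∫ z, g z * altSum A v (fderiv ℝ (fderiv ℝ f) z) (fderiv ℝ (fderiv ℝ f) z) ∂μ)) := by
    refine tendsto_integral_of_dominated_convergence (fun z => ‖g z‖ * M) (fun n => ?_) ?_
      (fun n => Eventually.of_forall fun z => ?_) (Eventually.of_forall fun z => ?_)
    · exact (hg.continuous.mul
        (continuous_altSum.comp ((hF2 n).prodMk (hF2 n)))).aestronglyMeasurable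
    · exact (hg.continuous.integrable_of_hasCompactSupport hgc).norm.mul_const M
    · rw [norm_mul]
      gcongr
      exact hM _ _ ((hFb2 n z).trans (le_max_left _ _)) ((hFb2 n z).trans (le_max_left _ _))
    · exact tendsto_const_nhds.mul (tendsto_altSum (hFt2 z) (hFt2 z))
  have hR : Tendsto (fun n => ∫ z, F n z * altSum A v (fderiv ℝ (fderiv ℝ (F n)) z)
      (fderiv ℝ (fderiv ℝ g) z) ∂μ) atTop
      (𝓝 (∫ z, f z * altSum A v (fderiv ℝ (fderiv ℝ f) z) (fderiv ℝ (fderiv ℝ g) z) ∂μ)) := by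
    have hK : IsCompact (tsupport (fderiv ℝ (fderiv ℝ g))) := (hgc.fderiv ℝ).fderiv ℝ
    refine tendsto_integral_of_dominated_convergence
      ((tsupport (fderiv ℝ (fderiv ℝ g))).indicator fun _ => C * M) (fun n => ?_) ?_
      (fun n => Eventually.of_forall fun z => ?_) (Eventually.of_forall fun z => ?_)
    · exact ((hF n).continuous.mul
        (continuous_altSum.comp ((hF2 n).prodMk hg2))).aestronglyMeasurable
    · exact (integrable_indicator_iff hK.measurableSet).2
        (integrableOn_const hK.measure_lt_top.ne)
    · by_cases hz : z ∈ tsupport (fderiv ℝ (fderiv ℝ g))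
      · rw [Set.indicator_of_mem hz, norm_mul]
        have hC0 : 0 ≤ C := (norm_nonneg _).trans (hFb n z)
        gcongr
        · exact hFb n z
        · exact hM _ _ ((hFb2 n z).trans (le_max_left _ _)) ((hCg z).trans (le_max_right _ _))
      · rw [Set.indicator_of_notMem hz, image_eq_zero_of_notMem_tsupport hz]
        simp [altSum_zero_right]
    · exact (hFt z).mul (tendsto_altSum (hFt2 z) tendsto_const_nhds)
  refine tendsto_nhds_unique hL (hR.congr fun n => ?_)
  exact (integral_mul_altSum_of_contDiff (hF n) (hFc n) hg hgc).symm

end Mollification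

end Fewnomial

namespace Fewnomial

open Filter Topology

-- For the norm on the space `E →L[ℝ] E →L[ℝ] ℝ` of second derivatives.
set_option maxSynthPendingDepth 3

/-! ### The Bedford-Taylor powers of a `C²` function -/

section Currents

variable {m : ℕ} {U : Set (Fin m → ℂ)} {u φ : (Fin m → ℂ) → ℝ}

theorem continuousOn_fderiv_fderiv (hU : IsOpen U) (hu : ContDiffOn ℝ 2 u U) :
    ContinuousOn (fderiv ℝ (fderiv ℝ u)) U := by
  intro z hz
  have h1 : ContDiffAt ℝ 2 u z := hu.contDiffAt (hU.mem_nhds hz)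
  exact (((h1.fderiv_right (m := 1) (by norm_num)).fderiv_right (m := 0)
    (by norm_num)).continuousAt).continuousWithinAt

theorem powForm_apply {z : Fin m → ℂ} (hu : ContDiffAt ℝ 2 u z) (k : ℕ)
    (v : Fin (2 * k) → Fin m → ℂ) :
    powForm u k z v = ∑ σ : Equiv.Perm (Fin (2 * k)), Equiv.Perm.sign σ •
      ∏ i : Fin k, leviBilin (fderiv ℝ (fderiv ℝ u) z) (v (σ (evenIdx i))) (v (σ (oddIdx i))) :=
  wedgePow_apply (ddbar_isAltOf hu) k v

theorem continuousOn_powForm (hU : IsOpen U) (hu : ContDiffOn ℝ 2 u U) (k : ℕ) :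
    ContinuousOn (powForm u k) U := by
  refine continuousOn_form fun v => ?_
  refine ContinuousOn.congr ?_ fun z hz =>
    powForm_apply (hu.contDiffAt (hU.mem_nhds hz)) k v
  have hD := continuousOn_fderiv_fderiv hU hu
  refine continuousOn_finsetSum _ fun σ _ => ContinuousOn.const_smul ?_ _
  refine continuousOn_finsetProd _ fun i _ => ?_
  simp only [leviBilin_apply]
  refine Complex.continuous_ofReal.comp_continuousOn (continuousOn_const.mul ?_)
  exact (hD.clm_apply continuousOn_const).clm_apply continuousOn_const

theorem wedge_powForm_ddbar_apply {z : Fin m → ℂ} (hu : ContDiffAt ℝ 2 u z)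
    (hφ : ContDiffAt ℝ 2 φ z) (k : ℕ) (v : Fin (2 * (k + 1)) → Fin m → ℂ) :
    wedge (powForm u k z) (ddbar φ z) v =
      (((-(1 / (4 * Real.pi))) ^ (k + 1) * altSum (J m) v (fderiv ℝ (fderiv ℝ u) z)
        (fderiv ℝ (fderiv ℝ φ) z) : ℝ) : ℂ) := by
  refine (wedge_wedgePow_apply (ddbar_isAltOf hu) (ddbar_isAltOf hφ) k v).trans ?_
  simp only [altSum, pairWeight, leviBilin_apply, Finset.mul_sum]
  push_cast
  refine Finset.sum_congr rfl fun σ _ => ?_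
  rw [Finset.prod_mul_distrib, Finset.prod_const, Finset.card_univ, Fintype.card_fin,
    Units.smul_def, zsmul_eq_mul, pow_succ]
  ring

theorem exists_cutoff (hU : IsOpen U) (hu : ContDiffOn ℝ 2 u U) {K : Set (Fin m → ℂ)}
    (hK : IsCompact K) (hKU : K ⊆ U) :
    ∃ w : (Fin m → ℂ) → ℝ, ContDiff ℝ 2 w ∧ HasCompactSupport w ∧
      ∀ z ∈ K, w =ᶠ[𝓝 z] u := by
  obtain ⟨K', hK', hKK', hK'U⟩ := exists_compact_between hK hU hKU
  obtain ⟨χ, hχ1, hχ0, -⟩ := exists_contMDiffMap_one_nhds_of_subset_interior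
    (n := (⊤ : ℕ∞)) (modelWithCornersSelf ℝ (Fin m → ℂ)) hK.isClosed hKK'
  have hχs : ContDiff ℝ ∞ (χ : (Fin m → ℂ) → ℝ) := χ.contMDiff.contDiff
  have hsupp : tsupport (χ : (Fin m → ℂ) → ℝ) ⊆ K' := by
    refine closure_minimal (fun z hz => ?_) hK'.isClosed
    by_contra h
    exact hz (hχ0 z h)
  refine ⟨fun z => χ z * u z, ?_, ?_, fun z hz => ?_⟩
  · rw [contDiff_iff_contDiffAt]
    intro z
    by_cases hz : z ∈ U
    · exact (contDiff_infty.1 hχs 2).contDiffAt.mul (hu.contDiffAt (hU.mem_nhds hz))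
    · have h1 : (fun z => χ z * u z) =ᶠ[𝓝 z] fun _ => 0 := by
        have h2 : z ∉ tsupport (χ : (Fin m → ℂ) → ℝ) := fun h => hz (hK'U (hsupp h))
        filter_upwards [(isClosed_tsupport _).isOpen_compl.mem_nhds h2] with y hy
        rw [image_eq_zero_of_notMem_tsupport hy, zero_mul]
      exact contDiffAt_const.congr_of_eventuallyEq h1
  · exact (HasCompactSupport.of_support_subset_isCompact hK' fun z hz => by
      by_contra h
      exact hz (hχ0 z h)).mul_right
  · filter_upwards [hχ1.filter_mono (nhds_le_nhdsSet hz)] with y hy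
    rw [hy, one_mul]

theorem powForm_succ_apply {z : Fin m → ℂ} (hu : ContDiffAt ℝ 2 u z) (k : ℕ)
    (v : Fin (2 * (k + 1)) → Fin m → ℂ) :
    powForm u (k + 1) z v =
      (((-(1 / (4 * Real.pi))) ^ (k + 1) * altSum (J m) v (fderiv ℝ (fderiv ℝ u) z)
        (fderiv ℝ (fderiv ℝ u) z) : ℝ) : ℂ) :=
  wedge_powForm_ddbar_apply hu hu k v

theorem IsTest.continuous_fderiv_fderiv (hφ : IsTest U φ) :
    Continuous (fderiv ℝ (fderiv ℝ φ)) :=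
  ((hφ.1.fderiv_right (m := ∞) (by simp)).fderiv_right (m := ∞) (by simp)).continuous

theorem IsTest.contDiffAt (hφ : IsTest U φ) (z : Fin m → ℂ) : ContDiffAt ℝ 2 φ z :=
  (contDiff_infty.1 hφ.1 2).contDiffAt

theorem fderiv_fderiv_eq_zero_of_notMem_tsupport {z : Fin m → ℂ} (hz : z ∉ tsupport φ) :
    fderiv ℝ (fderiv ℝ φ) z = 0 :=
  image_eq_zero_of_notMem_tsupport (f := fderiv ℝ (fderiv ℝ φ)) fun h =>
    hz (tsupport_fderiv_subset ℝ (tsupport_fderiv_subset ℝ h))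

theorem integrableOn_smul_powForm (hU : IsOpen U) (hu : ContDiffOn ℝ 2 u U) (k : ℕ)
    (hφ : IsTest U φ) : IntegrableOn (fun z => φ z • powForm u k z) U := by
  refine IntegrableOn.of_forall_sdiff_eq_zero (s := tsupport φ) ?_ hU.measurableSet ?_
  · exact ((hφ.1.continuous.continuousOn.smul
      (continuousOn_powForm hU hu k)).mono hφ.2.2).integrableOn_compact hφ.2.1
  · intro z hz
    rw [image_eq_zero_of_notMem_tsupport hz.2, zero_smul]

theorem continuousOn_wedge_powForm_ddbar (hU : IsOpen U) (hu : ContDiffOn ℝ 2 u U) (k : ℕ)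
    (hφ : IsTest U φ) : ContinuousOn (fun z => wedge (powForm u k z) (ddbar φ z)) U := by
  refine continuousOn_form fun v => ?_
  refine ContinuousOn.congr ?_ fun z hz =>
    wedge_powForm_ddbar_apply (hu.contDiffAt (hU.mem_nhds hz)) (hφ.contDiffAt z) k v
  refine Complex.continuous_ofReal.comp_continuousOn (continuousOn_const.mul ?_)
  exact continuous_altSum.comp_continuousOn
    ((continuousOn_fderiv_fderiv hU hu).prodMk hφ.continuous_fderiv_fderiv.continuousOn)

theorem integrableOn_smul_wedge_powForm_ddbar (hU : IsOpen U) (hu : ContDiffOn ℝ 2 u U) (k : ℕ)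
    (hφ : IsTest U φ) : IntegrableOn (fun z => u z • wedge (powForm u k z) (ddbar φ z)) U := by
  refine IntegrableOn.of_forall_sdiff_eq_zero (s := tsupport φ) ?_ hU.measurableSet ?_
  · exact ContinuousOn.integrableOn_compact hφ.2.1
      ((hu.continuousOn.smul (continuousOn_wedge_powForm_ddbar hU hu k hφ)).mono hφ.2.2)
  · intro z hz
    have : wedge (powForm u k z) (ddbar φ z) = 0 := by
      ext v
      rw [wedge_powForm_ddbar_apply (hu.contDiffAt (hU.mem_nhds hz.1)) (hφ.contDiffAt z) k v,
        fderiv_fderiv_eq_zero_of_notMem_tsupport hz.2, altSum_zero_right, mul_zero]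
      rfl
    rw [this, smul_zero]

theorem setIntegral_mul_altSum (hU : IsOpen U) (hu : ContDiffOn ℝ 2 u U) {k : ℕ}
    {v : Fin (2 * (k + 1)) → Fin m → ℂ} (hφ : IsTest U φ) :
    ∫ z in U, φ z * altSum (J m) v (fderiv ℝ (fderiv ℝ u) z) (fderiv ℝ (fderiv ℝ u) z) =
      ∫ z in U, u z * altSum (J m) v (fderiv ℝ (fderiv ℝ u) z) (fderiv ℝ (fderiv ℝ φ) z) := by
  obtain ⟨hφs, hφc, hφU⟩ := hφ
  obtain ⟨w, hw2, hwc, hwu⟩ := exists_cutoff hU hu hφc hφU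
  have hφ0 : ∀ z, z ∉ tsupport φ → φ z = 0 := fun z hz => image_eq_zero_of_notMem_tsupport hz
  have hwD : ∀ z ∈ tsupport φ, fderiv ℝ (fderiv ℝ w) z = fderiv ℝ (fderiv ℝ u) z := fun z hz =>
    (hwu z hz).fderiv.fderiv_eq
  rw [setIntegral_eq_integral_of_forall_compl_eq_zero,
    setIntegral_eq_integral_of_forall_compl_eq_zero]
  · have e3 := integral_mul_altSum (μ := volume) (A := J m) (v := v) hw2 hwc hφs hφc
    refine Eq.trans (integral_congr_ae (Eventually.of_forall fun z => ?_))
      (e3.trans (integral_congr_ae (Eventually.of_forall fun z => ?_)))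
    · by_cases hz : z ∈ tsupport φ
      · simp only [hwD z hz]
      · simp only [hφ0 z hz, zero_mul]
    · by_cases hz : z ∈ tsupport φ
      · simp only [hwD z hz, (hwu z hz).eq_of_nhds]
      · simp only [fderiv_fderiv_eq_zero_of_notMem_tsupport hz, altSum_zero_right, mul_zero]
  · intro z hz
    rw [fderiv_fderiv_eq_zero_of_notMem_tsupport fun h => hz (hφU h), altSum_zero_right, mul_zero]
  · intro z hz
    rw [hφ0 z fun h => hz (hφU h), zero_mul]

theorem integral_form_apply {p : ℕ} {g : (Fin m → ℂ) → Form m p} (hg : IntegrableOn g U)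
    (v : Fin p → Fin m → ℂ) : (∫ z in U, g z) v = ∫ z in U, g z v :=
  ((ContinuousAlternatingMap.apply ℝ (Fin m → ℂ) ℂ v).integral_comp_comm hg).symm

/-- On constant coefficients, the integration by parts formula says that the pointwise power
`powForm u (k + 1)` is the current `(i / 2π) ∂∂̄ (u powForm u k)`. -/
theorem integral_smul_powForm (hU : IsOpen U) (hu : ContDiffOn ℝ 2 u U) (k : ℕ)
    (hφ : IsTest U φ) :
    ∫ z in U, φ z • powForm u (k + 1) z =
      ∫ z in U, u z • wedge (powForm u k z) (ddbar φ z) := by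
  have hu2 : ∀ z ∈ U, ContDiffAt ℝ 2 u z := fun z hz => hu.contDiffAt (hU.mem_nhds hz)
  ext v
  rw [integral_form_apply (integrableOn_smul_powForm hU hu (k + 1) hφ) v]
  refine Eq.trans ?_ (integral_form_apply (integrableOn_smul_wedge_powForm_ddbar hU hu k hφ) v).symm
  set c : ℝ := (-(1 / (4 * Real.pi))) ^ (k + 1) with hc
  have e1 : ∫ z in U, (φ z • powForm u (k + 1) z) v = ((∫ z in U, c * (φ z *
      altSum (J m) v (fderiv ℝ (fderiv ℝ u) z) (fderiv ℝ (fderiv ℝ u) z)) : ℝ) : ℂ) := by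
    rw [← integral_complex_ofReal]
    refine setIntegral_congr_fun hU.measurableSet fun z hz => ?_
    simp only [ContinuousAlternatingMap.smul_apply, powForm_succ_apply (hu2 z hz) k v,
      Complex.real_smul, ← hc]
    push_cast
    ring
  have e2 : ∫ z in U, (u z • wedge (powForm u k z) (ddbar φ z)) v = ((∫ z in U, c * (u z *
      altSum (J m) v (fderiv ℝ (fderiv ℝ u) z) (fderiv ℝ (fderiv ℝ φ) z)) : ℝ) : ℂ) := by
    rw [← integral_complex_ofReal]
    refine setIntegral_congr_fun hU.measurableSet fun z hz => ?_
    have hz' : (u z • wedge (powForm u k z) (ddbar φ z)) v =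
      u z • (wedge (powForm u k z) (ddbar φ z) v) := rfl
    refine hz'.trans ?_
    rw [wedge_powForm_ddbar_apply (hu2 z hz) (hφ.contDiffAt z) k v, Complex.real_smul,
      ← hc]
    push_cast
    ring
  rw [e1]
  refine Eq.trans ?_ e2.symm
  rw [integral_const_mul, integral_const_mul, setIntegral_mul_altSum hU hu hφ]

/-- For a `C²` function, the Bedford-Taylor powers are the pointwise powers. -/
theorem representsPow_powForm (hU : IsOpen U) (hu : ContDiffOn ℝ 2 u U) :
    ∀ k, RepresentsPow U u k (powForm u k)
  | 0 => Eventually.of_forall fun _ => rfl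
  | k + 1 => by
    refine ⟨(continuousOn_powForm hU hu (k + 1)).locallyIntegrableOn hU.measurableSet,
      powForm u k, representsPow_powForm hU hu k, ?_, fun φ hφ => integral_smul_powForm hU hu k hφ⟩
    exact (hu.continuousOn.smul (continuousOn_powForm hU hu k)).locallyIntegrableOn
      hU.measurableSet

theorem isBidegree_ddbar {z : Fin m → ℂ} (hu : ContDiffAt ℝ 2 u z) :
    IsBidegree 1 1 (ddbar u z) := by
  refine ⟨rfl, fun c v => ?_⟩
  have hsymm : ∀ x y, fderiv ℝ (fderiv ℝ u) z x y = fderiv ℝ (fderiv ℝ u) z y x :=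
    fun x y => (hu.isSymmSndFDerivAt (by simp)) x y
  have hv : v = ![v 0, v 1] := by
    funext i
    fin_cases i <;> rfl
  have hcv : (fun i => c • v i) = ![c • v 0, c • v 1] := by
    funext i
    fin_cases i <;> rfl
  have hcx : ∀ x : Fin m → ℂ, c • x = c.re • x + c.im • J m x := fun x => by
    funext i
    simp only [J_apply, Pi.smul_apply, Pi.add_apply, smul_eq_mul, Complex.real_smul]
    conv_lhs => rw [← Complex.re_add_im c]
    ring
  have hJc : ∀ x : Fin m → ℂ, J m (c • x) = c.re • J m x - c.im • x := fun x => by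
    rw [hcx, map_add, map_smul, map_smul, J_J, smul_neg, sub_eq_add_neg]
  rw [hcv]
  conv_rhs => rw [hv]
  rw [ddbar_isAltOf hu, ddbar_isAltOf hu]
  have hcc : c ^ 1 * (starRingEnd ℂ) c ^ 1 = ((c.re ^ 2 + c.im ^ 2 : ℝ) : ℂ) := by
    rw [pow_one, pow_one, Complex.mul_conj, Complex.normSq_apply]
    push_cast; ring
  rw [hcc]
  simp only [leviBilin_apply, hJc]
  simp only [hcx, map_add, map_smul, map_sub, _root_.add_apply, _root_.smul_apply, smul_eq_mul]
  rw [← Complex.ofReal_sub, ← Complex.ofReal_sub, ← Complex.ofReal_mul]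
  congr 1
  rw [hsymm (v 1) (v 0), hsymm (J m (v 1)) (v 0), hsymm (J m (v 1)) (J m (v 0)),
    hsymm (v 1) (J m (v 0))]
  ring

end Currents

end Fewnomial

namespace Fewnomial

open Filter Topology

/-! ### The top power as a determinant -/

section TopPower

variable {m : ℕ}

/-- The splitting of the indices below `2 m` into even and odd ones. -/
def evenOddEquiv (m : ℕ) : Fin m ⊕ Fin m ≃ Fin (2 * m) where
  toFun := Sum.elim evenIdx oddIdx
  invFun j := if j.1 % 2 = 0 then Sum.inl ⟨j.1 / 2, by omega⟩ else Sum.inr ⟨j.1 / 2, by omega⟩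
  left_inv s := by
    rcases s with i | i
    · simp [evenIdx]
    · have h1 : (2 * i.1 + 1) % 2 = 1 := by omega
      have h2 : (2 * i.1 + 1) / 2 = i.1 := by omega
      simp [oddIdx, h1, h2]
  right_inv j := by
    rcases Nat.mod_two_eq_zero_or_one j.1 with h | h
    · have : 2 * (j.1 / 2) = j.1 := by omega
      simp [evenIdx, h, this]
    · have : 2 * (j.1 / 2) + 1 = j.1 := by omega
      simp [oddIdx, h, this]

theorem det_sumElim_comp {R : Type*} [CommRing R] (a b : Fin m → Fin m ⊕ Fin m → R)
    (f : Fin m → Fin m) :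
    Matrix.det (Matrix.of (Sum.elim (a ∘ f) (b ∘ f))) =
      if Function.Bijective f then Matrix.det (Matrix.of (Sum.elim a b)) else 0 := by
  split_ifs with hf
  · set τ := Equiv.ofBijective f hf with hτ
    have h1 : Matrix.of (Sum.elim (a ∘ f) (b ∘ f)) =
        (Matrix.of (Sum.elim a b)).submatrix (Equiv.Perm.sumCongr τ τ) id := by
      ext p q
      rcases p with p | p <;> simp [hτ]
    rw [h1, Matrix.det_permute, Equiv.Perm.sign_sumCongr, Int.units_mul_self]
    simp
  · have hf' : ¬ Function.Injective f := fun h => hf (Finite.injective_iff_bijective.1 h)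
    simp only [Function.Injective, not_forall] at hf'
    obtain ⟨i, j, hij, hne⟩ := hf'
    refine Matrix.det_zero_of_row_eq (i := Sum.inl i) (j := Sum.inl j) (by simpa using hne) ?_
    funext q
    simp [hij]

/-- The `m`-th power of `∑ b, γ b ∧ β b` is `m! γ 0 ∧ β 0 ∧ ⋯`. -/
theorem wedgePow_sum_apply {α : Form m 2} {B : (Fin m → ℂ) →ₗ[ℝ] (Fin m → ℂ) →ₗ[ℝ] ℂ}
    (h : IsAltOf α B) {γ β : Fin m → (Fin m → ℂ) → ℂ}
    (hB : ∀ x y, B x y = ∑ b, γ b x * β b y) (v : Fin (2 * m) → Fin m → ℂ) :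
    wedgePow α m v = m.factorial * Matrix.det (Matrix.of (Sum.elim
      (fun b q => γ b (v (evenOddEquiv m q))) (fun b q => β b (v (evenOddEquiv m q))))) := by
  rw [wedgePow_apply h]
  simp only [hB, Finset.prod_univ_sum, Fintype.piFinset_univ, Finset.smul_sum]
  rw [Finset.sum_comm]
  set a : Fin m → Fin m ⊕ Fin m → ℂ := fun b q => γ b (v (evenOddEquiv m q)) with ha
  set b : Fin m → Fin m ⊕ Fin m → ℂ := fun b q => β b (v (evenOddEquiv m q)) with hb
  have h1 : ∀ f : Fin m → Fin m, ∑ σ : Equiv.Perm (Fin (2 * m)), Equiv.Perm.sign σ •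
      ∏ i : Fin m, (γ (f i) (v (σ (evenIdx i))) * β (f i) (v (σ (oddIdx i)))) =
      Matrix.det (Matrix.of (Sum.elim (a ∘ f) (b ∘ f))) := by
    intro f
    rw [← Matrix.det_transpose, Matrix.det_apply]
    symm
    refine Fintype.sum_equiv ((evenOddEquiv m).permCongr) _ _ fun σ => ?_
    rw [Equiv.Perm.sign_permCongr, Fintype.prod_sum_type, ← Finset.prod_mul_distrib]
    congr 1
    refine Finset.prod_congr rfl fun i _ => ?_
    have e1 : (evenOddEquiv m).symm (evenIdx i) = Sum.inl i :=
      (evenOddEquiv m).symm_apply_apply (Sum.inl i)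
    have e2 : (evenOddEquiv m).symm (oddIdx i) = Sum.inr i :=
      (evenOddEquiv m).symm_apply_apply (Sum.inr i)
    simp [Equiv.permCongr_apply, e1, e2, ha, hb]
  simp only [h1, det_sumElim_comp]
  rw [Finset.sum_ite, Finset.sum_const_zero, add_zero, Finset.sum_const, nsmul_eq_mul]
  congr 2
  rw [← Fintype.card_subtype, Fintype.card_congr (Equiv.ofBijective
    (fun f : {f : Fin m → Fin m // Function.Bijective f} => Equiv.ofBijective f.1 f.2)
    ⟨fun f g hfg => Subtype.ext (congrArg (fun τ : Equiv.Perm (Fin m) => (τ : Fin m → Fin m)) hfg),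
      fun τ => ⟨⟨τ, τ.bijective⟩, Equiv.ext fun _ => rfl⟩⟩),
    Fintype.card_perm, Fintype.card_fin]

theorem frame_even (q : Fin m) : frame m (evenOddEquiv m (Sum.inl q)) = Pi.single q 1 := by
  have h1 : (2 * q.1) % 2 = 0 := by omega
  simp [frame, evenOddEquiv, evenIdx]

theorem frame_odd (q : Fin m) : frame m (evenOddEquiv m (Sum.inr q)) = Pi.single q Complex.I := by
  have h1 : (2 * q.1 + 1) % 2 = 1 := by omega
  have h2 : (2 * q.1 + 1) / 2 = q.1 := by omega
  simp [frame, evenOddEquiv, oddIdx, h1, h2]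

/-- The top power of `c ∑ S_{ab} (dz_a / z_a) ∧ (dz̄_b / z̄_b)`. -/
theorem wedgePow_frame {α : Form m 2} {B : (Fin m → ℂ) →ₗ[ℝ] (Fin m → ℂ) →ₗ[ℝ] ℂ}
    (h : IsAltOf α B) {S : Matrix (Fin m) (Fin m) ℝ} {c : ℂ} {z : Fin m → ℂ}
    (hB : ∀ x y, B x y = c * ∑ a, ∑ b, (S a b : ℂ) * (x a / z a) * starRingEnd ℂ (y b / z b)) :
    wedgePow α m (frame m) = m.factorial * ((c * (-2 * Complex.I)) ^ m *
      ((S.det * ∏ i, (‖z i‖ ^ 2)⁻¹ : ℝ) : ℂ)) := by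
  rw [wedgePow_sum_apply h (γ := fun b x => c * ∑ a, (S a b : ℂ) * (x a / z a))
    (β := fun b y => starRingEnd ℂ (y b / z b))]
  · congr 1
    set G : Matrix (Fin m) (Fin m) ℂ := Matrix.of fun b q => (c * (z q)⁻¹) * (S q b : ℂ) with hG
    set E : Matrix (Fin m) (Fin m) ℂ := Matrix.diagonal fun q => starRingEnd ℂ (z q)⁻¹ with hE
    have h1 : (Matrix.of (Sum.elim
        (fun (b : Fin m) (q : Fin m ⊕ Fin m) => c * ∑ a, (S a b : ℂ) *
          (frame m (evenOddEquiv m q) a / z a))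
        (fun b q => starRingEnd ℂ (frame m (evenOddEquiv m q) b / z b)))) =
        Matrix.fromBlocks G 0 0 E * Matrix.fromBlocks 1 (Matrix.scalar _ Complex.I) 1
          (-Matrix.scalar _ Complex.I) := by
      rw [Matrix.fromBlocks_multiply]
      ext p q
      rcases p with p | p <;> rcases q with q | q
      · simp only [Matrix.of_apply, Sum.elim_inl, frame_even, Matrix.fromBlocks_apply₁₁]
        rw [Finset.sum_eq_single q (fun a _ ha => by simp [ha]) (by simp)]
        simp [hG]; ring
      · simp only [Matrix.of_apply, Sum.elim_inl, frame_odd, Matrix.fromBlocks_apply₁₂]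
        rw [Finset.sum_eq_single q (fun a _ ha => by simp [ha]) (by simp)]
        simp [hG]; ring
      · simp only [Matrix.of_apply, Sum.elim_inr, frame_even, Matrix.fromBlocks_apply₂₁]
        by_cases hpq : p = q
        · subst hpq; simp [hE]
        · simp [hE, hpq]
      · simp only [Matrix.of_apply, Sum.elim_inr, frame_odd, Matrix.fromBlocks_apply₂₂]
        by_cases hpq : p = q
        · subst hpq; simp [hE]; ring
        · simp [hE, hpq]
    rw [h1, Matrix.det_mul, Matrix.det_fromBlocks_zero₂₁, Matrix.det_fromBlocks_one₁₁]
    have h2 : (-Matrix.scalar (Fin m) Complex.I - 1 * Matrix.scalar (Fin m) Complex.I :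
        Matrix (Fin m) (Fin m) ℂ) = Matrix.scalar (Fin m) (-2 * Complex.I) := by
      rw [one_mul, ← map_neg, ← map_sub]
      congr 1; ring
    have h3 : G.det = (∏ q, c * (z q)⁻¹) * (S.det : ℂ) := by
      refine (Matrix.det_mul_row (fun q => c * (z q)⁻¹)
        (Complex.ofRealHom.mapMatrix S).transpose).trans ?_
      rw [Matrix.det_transpose, ← RingHom.map_det]
      rfl
    have h5 : ∀ q, (((‖z q‖ ^ 2)⁻¹ : ℝ) : ℂ) = (z q)⁻¹ * starRingEnd ℂ (z q)⁻¹ := fun q => by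
      rw [Complex.mul_conj, Complex.normSq_inv, Complex.normSq_eq_norm_sq]
    rw [h2, Matrix.scalar_apply, Matrix.det_diagonal, h3, Matrix.det_diagonal,
      Finset.prod_mul_distrib, Finset.prod_const, Finset.prod_const, Finset.card_univ,
      Fintype.card_fin, Complex.ofReal_mul, Complex.ofReal_prod,
      Finset.prod_congr rfl (fun q _ => h5 q), Finset.prod_mul_distrib, mul_pow]
    ring
  · intro x y
    rw [hB, Finset.sum_comm, Finset.mul_sum]
    refine Finset.sum_congr rfl fun b _ => ?_
    rw [← Finset.sum_mul]
    ring

end TopPower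

end Fewnomial

namespace Fewnomial

open Filter Topology

/-! ### The form `(i / 2π) ∂∂̄ f` in logarithmic coordinates -/

section LogCoordinates

variable {m : ℕ} {f : (Fin m → ℝ) → ℝ} {z : Fin m → ℂ}

theorem isOpen_torus : IsOpen (torus m) := by
  have : torus m = ⋂ i, {z | z i ≠ 0} := by ext; simp [torus]
  rw [this]
  exact isOpen_iInter_of_finite fun i => isOpen_ne_fun (continuous_apply i) continuous_const

/-- The map `z ↦ (log |z_1|², …, log |z_m|²)`. -/
noncomputable def logSq (z : Fin m → ℂ) : Fin m → ℝ := fun i => Real.log (‖z i‖ ^ 2)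

/-- The differential of `logSq`, namely `x ↦ 2 Re (x_i / z_i)`. -/
noncomputable def logSqDeriv (z : Fin m → ℂ) : (Fin m → ℂ) →L[ℝ] Fin m → ℝ :=
  ContinuousLinearMap.pi fun i =>
    (2 : ℝ) • Complex.reCLM.comp ((z i)⁻¹ • ContinuousLinearMap.proj i)

theorem logSqDeriv_apply (z x : Fin m → ℂ) :
    logSqDeriv z x = fun i => 2 * ((z i)⁻¹ * x i).re := rfl

theorem hasFDerivAt_logSq (hz : z ∈ torus m) : HasFDerivAt logSq (logSqDeriv z) z := by
  refine hasFDerivAt_pi'.2 fun i => ?_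
  have h1 : HasFDerivAt (fun w : Fin m → ℂ => ‖w i‖ ^ 2) _ z :=
    (ContinuousLinearMap.proj (R := ℝ) (φ := fun _ : Fin m => ℂ) i).hasFDerivAt.norm_sq
  have h0 : ‖z i‖ ^ 2 ≠ 0 := by simpa using hz i
  refine (h1.log h0).congr_fderiv ?_
  ext x
  have h2 : ((z i)⁻¹ * x i).re = (‖z i‖ ^ 2)⁻¹ * (starRingEnd ℂ (z i) * x i).re := by
    rw [Complex.inv_def, Complex.normSq_eq_norm_sq, mul_comm (starRingEnd ℂ (z i)), mul_assoc,
      Complex.re_ofReal_mul]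
  have h3 : inner ℝ (z i) (x i) = (starRingEnd ℂ (z i) * x i).re := by
    rw [Complex.inner, mul_comm]
  simp [logSqDeriv, h2, h3]
  ring

theorem contDiffOn_logSq : ContDiffOn ℝ 2 (logSq (m := m)) (torus m) := by
  intro z hz
  refine ContDiffAt.contDiffWithinAt ?_
  rw [contDiffAt_pi]
  intro i
  refine ContDiffAt.log ?_ (by simpa using hz i)
  exact ((contDiff_apply ℝ ℂ i).norm_sq ℝ).contDiffAt

theorem contDiffOn_pullLog (hf : ContDiff ℝ 2 f) : ContDiffOn ℝ 2 (pullLog f) (torus m) :=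
  hf.comp_contDiffOn contDiffOn_logSq

/-- The derivative in `z` of `logSqDeriv z y`. -/
noncomputable def logSqDeriv₂ (z y : Fin m → ℂ) : (Fin m → ℂ) →L[ℝ] Fin m → ℝ :=
  ContinuousLinearMap.pi fun i =>
    (2 : ℝ) • Complex.reCLM.comp ((-(y i * ((z i)⁻¹ * (z i)⁻¹))) • ContinuousLinearMap.proj i)

theorem logSqDeriv₂_apply (z y x : Fin m → ℂ) :
    logSqDeriv₂ z y x = fun i => 2 * (-(y i * ((z i)⁻¹ * (z i)⁻¹)) * x i).re := rfl

theorem hasFDerivAt_logSqDeriv (hz : z ∈ torus m) (y : Fin m → ℂ) :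
    HasFDerivAt (fun w => logSqDeriv w y) (logSqDeriv₂ z y) z := by
  refine hasFDerivAt_pi'.2 fun i => ?_
  have h1 : HasFDerivAt (fun w : Fin m → ℂ => (w i)⁻¹)
      ((-((z i)⁻¹ * (z i)⁻¹)) • ContinuousLinearMap.proj (R := ℝ) (φ := fun _ : Fin m => ℂ) i) z := by
    have h2 := (hasDerivAt_inv (hz i)).hasFDerivAt.restrictScalars ℝ
    refine (h2.comp z (ContinuousLinearMap.proj (R := ℝ)
      (φ := fun _ : Fin m => ℂ) i).hasFDerivAt).congr_fderiv ?_
    ext x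
    simp [pow_two]
    ring
  have h3 := (Complex.reCLM.hasFDerivAt.comp z (h1.mul_const (y i))).const_mul (2 : ℝ)
  refine h3.congr_fderiv ?_
  ext x
  change 2 * (y i * (-((z i)⁻¹ * (z i)⁻¹) * x i)).re =
    2 * (-(y i * ((z i)⁻¹ * (z i)⁻¹)) * x i).re
  congr 2
  ring

/-- The second derivative of `f (log |z_1|², …, log |z_m|²)`. -/
theorem fderiv_fderiv_pullLog (hf : ContDiff ℝ 2 f) (hz : z ∈ torus m) (x y : Fin m → ℂ) :
    fderiv ℝ (fderiv ℝ (pullLog f)) z x y =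
      fderiv ℝ (fderiv ℝ f) (logSq z) (logSqDeriv z x) (logSqDeriv z y) +
        fderiv ℝ f (logSq z) (logSqDeriv₂ z y x) := by
  have hd : DifferentiableAt ℝ (fderiv ℝ (pullLog f)) z :=
    (((contDiffOn_pullLog hf).contDiffAt (isOpen_torus.mem_nhds hz)).fderiv_right (m := 1)
      (by norm_num)).differentiableAt (by norm_num)
  have h1 : fderiv ℝ (fderiv ℝ (pullLog f)) z x y =
      fderiv ℝ (fun w => fderiv ℝ (pullLog f) w y) z x := by
    rw [fderiv_clm_apply hd (differentiableAt_const y)]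
    simp
  have h2 : (fun w => fderiv ℝ (pullLog f) w y) =ᶠ[𝓝 z]
      fun w => fderiv ℝ f (logSq w) (logSqDeriv w y) := by
    filter_upwards [isOpen_torus.mem_nhds hz] with w hw
    have h3 := ((hf.differentiable (by norm_num)) (logSq w)).hasFDerivAt.comp w
      (hasFDerivAt_logSq hw)
    exact congrArg (fun D => D y) h3.fderiv
  have hf1 : DifferentiableAt ℝ (fderiv ℝ f) (logSq z) :=
    (hf.fderiv_right (m := 1) (by norm_num)).differentiable (by norm_num) _
  have h4 := (hf1.hasFDerivAt.comp z (hasFDerivAt_logSq hz)).clm_apply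
    (hasFDerivAt_logSqDeriv hz y)
  rw [h1, h2.fderiv_eq]
  refine (congrArg (fun D => D x) h4.fderiv).trans ?_
  simp [add_comm]

theorem secondPartial_eq (hf : ContDiff ℝ 2 f) (ρ : Fin m → ℝ) (i j : Fin m) :
    secondPartial f ρ i j =
      fderiv ℝ (fderiv ℝ f) ρ (Pi.single i 1) (Pi.single j 1) := by
  have hf1 : DifferentiableAt ℝ (fderiv ℝ f) ρ :=
    (hf.fderiv_right (m := 1) (by norm_num)).differentiable (by norm_num) _
  rw [secondPartial, fderiv_clm_apply hf1 (differentiableAt_const _)]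
  simp

theorem fderiv_fderiv_eq_sum (hf : ContDiff ℝ 2 f) (ρ x y : Fin m → ℝ) :
    fderiv ℝ (fderiv ℝ f) ρ x y = ∑ i, ∑ j, secondPartial f ρ i j * (x i * y j) := by
  simp only [secondPartial_eq hf]
  conv_lhs => rw [pi_eq_sum_univ' x, pi_eq_sum_univ' y]
  simp only [map_sum, map_smul, _root_.sum_apply, _root_.smul_apply, smul_eq_mul,
    Finset.mul_sum]
  rw [Finset.sum_comm]
  refine Finset.sum_congr rfl fun i _ => Finset.sum_congr rfl fun j _ => ?_
  ring

/-- The complex bilinear map `(i / 2π) ∑ S_{ab} (dz_a / z_a) ⊗ (dz̄_b / z̄_b)`. -/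
noncomputable def logBilin (S : Matrix (Fin m) (Fin m) ℝ) (z : Fin m → ℂ) :
    (Fin m → ℂ) →ₗ[ℝ] (Fin m → ℂ) →ₗ[ℝ] ℂ :=
  LinearMap.mk₂ ℝ (fun x y => (Complex.I / (2 * (Real.pi : ℂ))) *
      ∑ a, ∑ b, (S a b : ℂ) * (x a / z a) * starRingEnd ℂ (y b / z b))
    (fun x x' y => by
      rw [← mul_add]; simp only [← Finset.sum_add_distrib]
      congr 1
      refine Finset.sum_congr rfl fun a _ => Finset.sum_congr rfl fun b _ => ?_
      simp only [Pi.add_apply]; ring)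
    (fun c x y => by
      simp only [Finset.smul_sum, Finset.mul_sum]
      refine Finset.sum_congr rfl fun a _ => Finset.sum_congr rfl fun b _ => ?_
      simp only [Pi.smul_apply, Complex.real_smul]; ring)
    (fun x y y' => by
      rw [← mul_add]; simp only [← Finset.sum_add_distrib]
      congr 1
      refine Finset.sum_congr rfl fun a _ => Finset.sum_congr rfl fun b _ => ?_
      simp only [Pi.add_apply, add_div, map_add]; ring)
    (fun c x y => by
      simp only [Finset.smul_sum, Finset.mul_sum]
      refine Finset.sum_congr rfl fun a _ => Finset.sum_congr rfl fun b _ => ?_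
      simp only [Pi.smul_apply, Complex.real_smul, mul_div_assoc, map_mul, Complex.conj_ofReal]
      ring)

/-- In logarithmic coordinates,
`(i / 2π) ∂∂̄ f = (i / 2π) ∑ f_{ab} (dz_a / z_a) ∧ (dz̄_b / z̄_b)`. -/
theorem isAltOf_logBilin (hf : ContDiff ℝ 2 f) (hz : z ∈ torus m) :
    IsAltOf (ddbar (pullLog f) z) (logBilin (Matrix.of (secondPartial f (logSq z))) z) := by
  intro x y
  have hu : ContDiffAt ℝ 2 (pullLog f) z :=
    (contDiffOn_pullLog hf).contDiffAt (isOpen_torus.mem_nhds hz)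
  have hS : ∀ a b, secondPartial f (logSq z) a b = secondPartial f (logSq z) b a := fun a b => by
    rw [secondPartial_eq hf, secondPartial_eq hf]
    exact (hf.contDiffAt.isSymmSndFDerivAt (by simp)) _ _
  have h0 : logSqDeriv₂ z (J m y) x = logSqDeriv₂ z (J m x) y := by
    rw [logSqDeriv₂_apply, logSqDeriv₂_apply]
    funext i
    simp only [J_apply, Pi.smul_apply, smul_eq_mul]
    congr 2; ring
  rw [ddbar_isAltOf hu, leviBilin_apply, leviBilin_apply, fderiv_fderiv_pullLog hf hz,
    fderiv_fderiv_pullLog hf hz, h0, fderiv_fderiv_eq_sum hf, fderiv_fderiv_eq_sum hf]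
  set S := secondPartial f (logSq z) with hSdef
  have h1 : (∑ a, ∑ b, (S a b : ℂ) * (y a / z a) * starRingEnd ℂ (x b / z b)) =
      ∑ a, ∑ b, (S a b : ℂ) * (y b / z b) * starRingEnd ℂ (x a / z a) := by
    rw [Finset.sum_comm]
    simp only [hS]
  have hJ : ∀ (x : Fin m → ℂ) i, ((z i)⁻¹ * J m x i).re = -(x i / z i).im := fun x i => by
    rw [J_apply, Pi.smul_apply, smul_eq_mul, ← mul_assoc, mul_comm _ Complex.I, mul_assoc,
      Complex.I_mul_re, div_eq_inv_mul]
  have hl : ∀ (x : Fin m → ℂ) i, ((z i)⁻¹ * x i).re = (x i / z i).re := fun x i => by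
    rw [div_eq_inv_mul]
  have h2 : ∑ i, ∑ j, S i j * (logSqDeriv z y i * logSqDeriv z (J m x) j) =
      ∑ i, ∑ j, S i j * (logSqDeriv z y j * logSqDeriv z (J m x) i) := by
    rw [Finset.sum_comm]
    simp only [hS]
  have hB : ∀ x y, logBilin (Matrix.of S) z x y = (Complex.I / (2 * (Real.pi : ℂ))) *
      ∑ a, ∑ b, (S a b : ℂ) * (x a / z a) * starRingEnd ℂ (y b / z b) := fun x y => rfl
  rw [← Complex.ofReal_sub, ← mul_sub, add_sub_add_right_eq_sub, h2, hB, hB, h1, ← mul_sub]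
  simp only [← Finset.sum_sub_distrib, Finset.mul_sum, Complex.ofReal_sum]
  refine Finset.sum_congr rfl fun a _ => Finset.sum_congr rfl fun b _ => ?_
  simp only [logSqDeriv_apply, hJ, hl]
  generalize x a / z a = p
  generalize y b / z b = q
  have key : p * starRingEnd ℂ q - q * starRingEnd ℂ p =
      2 * Complex.I * ((p.im : ℂ) * q.re - p.re * q.im) := by
    apply Complex.ext <;> simp <;> ring
  push_cast
  linear_combination (-(Complex.I * (S a b : ℂ) / (2 * (Real.pi : ℂ)))) * key -
    ((S a b : ℂ) * ((p.im : ℂ) * q.re - p.re * q.im) / (Real.pi : ℂ)) * Complex.I_sq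

end LogCoordinates

end Fewnomial

namespace Fewnomial

open Filter Topology

/-! ### Integration in logarithmic polar coordinates -/

section LogPolar

variable {m : ℕ}

/-- The differential of `(s, t) ↦ (exp (s / 2), t)`. -/
noncomputable def expHalfDeriv (q : ℝ × ℝ) : ℝ × ℝ →L[ℝ] ℝ × ℝ :=
  ((Real.exp (q.1 / 2) / 2) • ContinuousLinearMap.id ℝ ℝ).prodMap (ContinuousLinearMap.id ℝ ℝ)

theorem det_expHalfDeriv (q : ℝ × ℝ) : (expHalfDeriv q).det = Real.exp (q.1 / 2) / 2 := by
  rw [ContinuousLinearMap.det, expHalfDeriv, ContinuousLinearMap.coe_prodMap,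
    LinearMap.det_prodMap]
  simp

theorem hasFDerivAt_expHalf (q : ℝ × ℝ) :
    HasFDerivAt (fun q : ℝ × ℝ => (Real.exp (q.1 / 2), q.2)) (expHalfDeriv q) q := by
  have h0 : HasDerivAt (fun s : ℝ => Real.exp (s / 2)) (Real.exp (q.1 / 2) * (1 / 2)) q.1 :=
    ((hasDerivAt_id q.1).div_const 2).exp
  have h1 : HasFDerivAt (fun q : ℝ × ℝ => Real.exp (q.1 / 2)) _ q :=
    h0.hasFDerivAt.comp q hasFDerivAt_fst
  refine (h1.prodMk hasFDerivAt_snd).congr_fderiv ?_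
  ext <;> simp [expHalfDeriv, div_eq_mul_inv]

theorem image_expHalf :
    (fun p : Fin m → ℝ × ℝ => fun i => (Real.exp ((p i).1 / 2), (p i).2)) ''
      (Set.univ.pi fun _ => Set.univ ×ˢ Set.Ioo (-Real.pi) Real.pi) =
    Set.univ.pi fun _ => Complex.polarCoord.target := by
  refine (Set.piMap_image_univ_pi (fun _ : Fin m => fun q : ℝ × ℝ => (Real.exp (q.1 / 2), q.2))
    _).trans ?_
  congr 1
  funext _
  ext ⟨r, t⟩
  simp only [Set.mem_image, Set.mem_prod, Set.mem_univ, true_and, Prod.mk.injEq, Prod.exists,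
    Complex.polarCoord_target, Set.mem_Ioi]
  constructor
  · rintro ⟨a, b, hb, rfl, rfl⟩
    exact ⟨Real.exp_pos _, hb⟩
  · rintro ⟨hr, ht⟩
    refine ⟨2 * Real.log r, t, ht, ?_, rfl⟩
    rw [mul_div_cancel_left₀ _ two_ne_zero, Real.exp_log hr]

theorem volume_compl_torus : volume (torus m)ᶜ = 0 := by
  have : (torus m)ᶜ = ⋃ i, Function.eval i ⁻¹' {(0 : ℂ)} := by
    ext z; simp [torus]
  rw [this, measure_iUnion_null_iff]
  intro i
  exact Measure.quasiMeasurePreserving_eval (fun _ : Fin m => (volume : Measure ℂ)) i |>.preimage_null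
    (measure_singleton 0)

/-- Integration over `(ℂ^*)^m` in the coordinates `ρ_i = log |z_i|²` and `θ_i = arg z_i`. -/
theorem setIntegral_torus_eq (h : (Fin m → ℂ) → ℝ) :
    ∫ z in torus m, h z =
      ∫ x in (Set.univ : Set (Fin m → ℝ)) ×ˢ
          Set.pi (Set.univ : Set (Fin m)) (fun _ => Set.Ioc (-Real.pi) Real.pi),
        h (logPolar x.1 x.2) * ∏ i, (Real.exp (x.1 i) / 2) := by
  set A : Set (Fin m → ℝ × ℝ) := Set.univ.pi fun _ => Set.univ ×ˢ Set.Ioo (-Real.pi) Real.pi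
    with hA
  have hAm : MeasurableSet A :=
    MeasurableSet.univ_pi fun _ => MeasurableSet.univ.prod measurableSet_Ioo
  have htorus : torus m =ᵐ[volume] Set.univ := by
    rw [ae_eq_univ]; exact volume_compl_torus
  rw [setIntegral_congr_set htorus, setIntegral_univ, ← Complex.integral_comp_pi_polarCoord_symm,
    ← image_expHalf]
  have hinj : Set.InjOn (fun p : Fin m → ℝ × ℝ => fun i => (Real.exp ((p i).1 / 2), (p i).2)) A := by
    intro p _ q _ hpq
    funext i
    have h1 := congrFun hpq i
    simp only [Prod.mk.injEq, Real.exp_eq_exp] at h1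
    exact Prod.ext (by linarith [h1.1]) h1.2
  have hder : ∀ p ∈ A, HasFDerivWithinAt
      (fun p : Fin m → ℝ × ℝ => fun i => (Real.exp ((p i).1 / 2), (p i).2))
      (ContinuousLinearMap.pi fun i => (expHalfDeriv (p i)).comp (ContinuousLinearMap.proj i)) A p :=
    fun p _ => (hasFDerivAt_pi'.2 fun i => HasFDerivAt.comp
      (g := fun q : ℝ × ℝ => (Real.exp (q.1 / 2), q.2)) p (hasFDerivAt_expHalf (p i))
      (ContinuousLinearMap.proj (R := ℝ) (φ := fun _ : Fin m => ℝ × ℝ)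
        i).hasFDerivAt).hasFDerivWithinAt
  rw [integral_image_eq_integral_abs_det_fderiv_smul volume hAm hder hinj]
  have hset : (Set.univ : Set (Fin m → ℝ)) ×ˢ
      Set.pi (Set.univ : Set (Fin m)) (fun _ => Set.Ioc (-Real.pi) Real.pi) =ᵐ[volume]
      (Set.univ : Set (Fin m → ℝ)) ×ˢ
      Set.pi (Set.univ : Set (Fin m)) (fun _ => Set.Ioo (-Real.pi) Real.pi) := by
    rw [Measure.volume_eq_prod]
    refine Measure.set_prod_ae_eq ae_eq_rfl ?_
    exact Measure.ae_eq_set_pi fun _ _ => Ioo_ae_eq_Ioc.symm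
  rw [setIntegral_congr_set hset]
  have hmp := volume_measurePreserving_arrowProdEquivProdArrow ℝ ℝ (Fin m)
  have hpre : A = MeasurableEquiv.arrowProdEquivProdArrow ℝ ℝ (Fin m) ⁻¹'
      ((Set.univ : Set (Fin m → ℝ)) ×ˢ
      Set.pi (Set.univ : Set (Fin m)) (fun _ => Set.Ioo (-Real.pi) Real.pi)) := by
    ext p
    simp [hA, MeasurableEquiv.arrowProdEquivProdArrow, Equiv.arrowProdEquivProdArrow]
  rw [hpre, ← hmp.setIntegral_preimage_emb (MeasurableEquiv.measurableEmbedding _)]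
  refine setIntegral_congr_fun (hpre ▸ hAm) fun p _ => ?_
  simp only [ContinuousLinearMap.det_pi, det_expHalfDeriv, smul_eq_mul]
  have h1 : (fun i => Complex.polarCoord.symm (Real.exp ((p i).1 / 2), (p i).2)) =
      logPolar (MeasurableEquiv.arrowProdEquivProdArrow ℝ ℝ (Fin m) p).1
        (MeasurableEquiv.arrowProdEquivProdArrow ℝ ℝ (Fin m) p).2 := by
    funext i
    rw [Complex.polarCoord_symm_apply, logPolar]
    change _ = Complex.exp (((p i).1 : ℂ) / 2 + Complex.I * ((p i).2 : ℂ))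
    rw [Complex.exp_add, mul_comm Complex.I, Complex.exp_mul_I]
    push_cast
    rfl
  rw [h1, abs_of_nonneg (Finset.prod_nonneg fun i _ => by positivity), ← mul_assoc,
    ← Finset.prod_mul_distrib, mul_comm]
  congr 1
  refine Finset.prod_congr rfl fun i _ => ?_
  change _ = Real.exp ((p i).1) / 2
  rw [div_mul_eq_mul_div, ← Real.exp_add, add_halves]

theorem logSq_logPolar (ρ θ : Fin m → ℝ) : logSq (logPolar ρ θ) = ρ := by
  funext i
  rw [logSq, logPolar, Complex.norm_exp, Real.log_pow, Real.log_exp]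
  simp [mul_div_cancel₀]

theorem norm_logPolar_sq (ρ θ : Fin m → ℝ) (i : Fin m) :
    ‖logPolar ρ θ i‖ ^ 2 = Real.exp (ρ i) := by
  rw [logPolar, Complex.norm_exp, ← Real.exp_nat_mul]
  congr 1
  simp [mul_div_cancel₀]

/-- The top power in logarithmic polar coordinates. -/
theorem exists_powForm_top_density {f : (Fin m → ℝ) → ℝ} (hf : ContDiff ℝ 2 f) :
    ∃ g : (Fin m → ℂ) → ℝ, ContinuousOn g (torus m) ∧
      (∀ z ∈ torus m, powForm (pullLog f) m z (frame m) = (g z : ℂ)) ∧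
      ∀ ψ : (Fin m → ℂ) → ℝ, ∫ z in torus m, ψ z * g z =
          ∫ x in (Set.univ : Set (Fin m → ℝ)) ×ˢ
              Set.pi (Set.univ : Set (Fin m)) (fun _ => Set.Ioc (-Real.pi) Real.pi),
            ψ (logPolar x.1 x.2) * ((m.factorial : ℝ) * Matrix.det (Matrix.of fun i j : Fin m =>
                1 / (2 * Real.pi) * secondPartial f x.1 i j)) := by
  set g : (Fin m → ℂ) → ℝ := fun z => m.factorial * ((1 / Real.pi) ^ m *
    ((Matrix.of (secondPartial f (logSq z))).det * ∏ i, (‖z i‖ ^ 2)⁻¹)) with hg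
  have hpow : ∀ z ∈ torus m, powForm (pullLog f) m z (frame m) = (g z : ℂ) := by
    intro z hz
    rw [powForm, wedgePow_frame (isAltOf_logBilin hf hz) (fun x y => rfl), hg]
    have h1 : Complex.I / (2 * (Real.pi : ℂ)) * (-2 * Complex.I) = ((1 / Real.pi : ℝ) : ℂ) := by
      have hπ : (Real.pi : ℂ) ≠ 0 := by exact_mod_cast Real.pi_ne_zero
      push_cast
      field_simp
      rw [Complex.I_sq]; ring
    rw [h1]
    push_cast
    rfl
  refine ⟨g, ?_, hpow, fun ψ => ?_⟩
  · have hc := continuousOn_powForm isOpen_torus (contDiffOn_pullLog hf) m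
    have h1 : ContinuousOn (fun z => (powForm (pullLog f) m z (frame m)).re) (torus m) :=
      Complex.continuous_re.comp_continuousOn
        ((ContinuousAlternatingMap.apply ℝ (Fin m → ℂ) ℂ (frame m)).continuous.comp_continuousOn hc)
    exact h1.congr fun z hz => by
      simp only [hpow z hz, Complex.ofReal_re]
  · rw [setIntegral_torus_eq]
    congr 1
    funext x
    have h1 : (Matrix.of fun i j : Fin m => 1 / (2 * Real.pi) * secondPartial f x.1 i j) =
        (1 / (2 * Real.pi)) • Matrix.of (secondPartial f x.1) := rfl
    rw [mul_assoc, h1, Matrix.det_smul, Fintype.card_fin, hg]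
    simp only [logSq_logPolar, norm_logPolar_sq]
    congr 1
    have h2 : (∏ i, (Real.exp (x.1 i))⁻¹) * ∏ i, (Real.exp (x.1 i) / 2) = (1 / 2) ^ m := by
      rw [← Finset.prod_mul_distrib, Finset.prod_congr rfl fun i _ => show
        (Real.exp (x.1 i))⁻¹ * (Real.exp (x.1 i) / 2) = 1 / 2 by field_simp]
      simp
    rw [show 1 / (2 * Real.pi) = (1 / Real.pi) * (1 / 2) by field_simp, mul_pow, ← h2]
    ring

end LogPolar

end Fewnomial

theorem theorem1 (m n : ℕ) (hm : 1 ≤ m) (hn : 1 ≤ n) :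
    (∀ ρ : Fin m → ℝ, MeasureTheory.Integrable
      (fun L : Fin n → Fin m → ℝ => Fewnomial.maxPhase ρ L)
      (MeasureTheory.Measure.pi fun _ : Fin n => Fewnomial.simplexMeasure m)) ∧
    ContDiff ℝ 2 (Fewnomial.F m n) ∧
    (∀ k : ℕ, 1 ≤ k → k ≤ m →
      Fewnomial.RepresentsPow (Fewnomial.torus m) (Fewnomial.pullLog (Fewnomial.F m n)) k
        (Fewnomial.powForm (Fewnomial.pullLog (Fewnomial.F m n)) k) ∧
      ContinuousOn (Fewnomial.powForm (Fewnomial.pullLog (Fewnomial.F m n)) k)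
        (Fewnomial.torus m) ∧
      ∀ z ∈ Fewnomial.torus m, Fewnomial.IsBidegree k k
        (Fewnomial.powForm (Fewnomial.pullLog (Fewnomial.F m n)) k z)) ∧
    ∃ g : (Fin m → ℂ) → ℝ, ContinuousOn g (Fewnomial.torus m) ∧
      (∀ z ∈ Fewnomial.torus m,
        Fewnomial.powForm (Fewnomial.pullLog (Fewnomial.F m n)) m z (Fewnomial.frame m)
          = (g z : ℂ)) ∧
      ∀ ψ : (Fin m → ℂ) → ℝ, Continuous ψ → HasCompactSupport ψ →
        tsupport ψ ⊆ Fewnomial.torus m →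
        ∫ z in Fewnomial.torus m, ψ z * g z =
          ∫ x in (Set.univ : Set (Fin m → ℝ)) ×ˢ
              Set.pi (Set.univ : Set (Fin m)) (fun _ => Set.Ioc (-Real.pi) Real.pi),
            ψ (Fewnomial.logPolar x.1 x.2) *
              ((m.factorial : ℝ) * Matrix.det (Matrix.of fun i j : Fin m =>
                1 / (2 * Real.pi) * Fewnomial.secondPartial (Fewnomial.F m n) x.1 i j)) := by
  obtain ⟨n, rfl⟩ : ∃ n', n = n' + 1 := ⟨n - 1, by omega⟩
  have hF := Fewnomial.contDiff_F hm n
  have hu := Fewnomial.contDiffOn_pullLog hF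
  have hU := Fewnomial.isOpen_torus (m := m)
  obtain ⟨g, hg, hgz, hgi⟩ := Fewnomial.exists_powForm_top_density hF
  exact ⟨Fewnomial.integrable_maxPhase n, hF, fun k _ _ =>
    ⟨Fewnomial.representsPow_powForm hU hu k, Fewnomial.continuousOn_powForm hU hu k, fun z hz =>
      Fewnomial.isBidegree_wedgePow (Fewnomial.isBidegree_ddbar (hu.contDiffAt (hU.mem_nhds hz)))
        k⟩,
    g, hg, hgz, fun ψ _ _ _ => hgi ψ⟩
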